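/- Let $p$ be a prime, $S$ a finite $p$-group, $\mathcal F$ a saturated fusion system over $S$, and $\mathcal G$ a (not necessarily saturated) fusion system over a finite $p$-group $T\ge S$ with $\mathcal F\subseteq\mathcal G$. Let $\mathcal R$ be a commutative ring with unit. A subgroup $A\le S$ is $\mathcal F$-centric if $C_S(B)\le B$ for every $B$ that is $\mathcal F$-isomorphic to $A$. The orbit category $\mathcal O(\mathcal F)$ has the subgroups of $S$ as objects and $\operatorname{Hom}_{\mathcal O(\mathcal F)}(A,B)=\operatorname{Inn}(B)\backslash\operatorname{Hom}_{\mathcal F}(A,B)$; the class of $\varphi$ is denoted $\overline\varphi$. For $H\le S$, $\mathcal F_H(H)$ is the fusion system over $H$ whose morphisms are the conjugations by elements of $H$. *Mackey functors.* For a fusion system $\mathcal H$ over $L$, let $\mu_{\mathcal R}(\mathcal H)=\mathcal R\otimes_{\mathbb Z}\mu_{\mathbb Z}(\mathcal H)$, where $\mu_{\mathbb Z}(\mathcal H)$ is the Grothendieck ring of the semiring generated, under disjoint union and product $\times_J$ of bisets (the product of an $(A,J)$-biset and a $(J',B)$-biset being $0$ if $J\ne J'$), by the isomorphism classes of the bisets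 $I_A^B=(B\times A)/\Delta(A,\mathrm{Id})$, $R_A^B=(A\times B)/\Delta(A,\mathrm{Id})$ for $A\le B\le L$, and $c_\varphi=(\varphi(A)\times A)/\Delta(A,\varphi)$ for isomorphisms $\varphi:A\to\varphi(A)$ of $\mathcal H$; here $\Delta(A,\varphi)=\{(\varphi(a),a)\}$ for $I$ and $c$, and $\Delta(A,\mathrm{Id})=\{(a,a)\}$ for $R$. Its unit is $\sum_{A\le L}I_A^A$. A Mackey functor over $\mathcal H$ is a finitely generated left $\mu_{\mathcal R}(\mathcal H)$-module $M$; if $\mathcal H\subseteq\mathcal G$, it is $\mathcal G$-centric if $I_J^JM=0$ for every $J\le L$ that is not $\mathcal G$-centric. For $\mathcal H\subseteq\mathcal K$ put $M\downarrow^{\mathcal K}_{\mathcal H}=1_{\mu_{\mathcal R}(\mathcal H)}M$ and $N\uparrow^{\mathcal K}_{\mathcal H}=\mu_{\mathcal R}(\mathcal K)1_{\mu_{\mathcal R}(\mathcal H)}\otimes_{\mu_{\mathcal R}(\mathcal H)}N$. For a group isomorphism $\varphi:A\to B$ and a module $L$ over $\mu_{\mathcal R}(\mathcal F_A(A))$,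 ${}^{\varphi}L$ is $L$ with $\mu_{\mathcal R}(\mathcal F_B(B))$ acting through the ring isomorphism $\mu_{\mathcal R}(\mathcal F_B(B))\to\mu_{\mathcal R}(\mathcal F_A(A))$ induced by $\varphi^{-1}$. *Products.* For $\mathcal F$-centric $H,K$ consider the pairs $(A,\overline\varphi)$ with $A\le H$ an $\mathcal F$-centric subgroup and $\overline\varphi\in\operatorname{Hom}_{\mathcal O(\mathcal F)}(A,K)$, preordered by $(A,\overline\varphi)\precsim(B,\overline\psi)$ iff there is $h\in H$ with $A^h=h^{-1}Ah\le B$ and $\overline\varphi\,\overline{c_h}=\overline\psi\,\overline\iota$ on $A^h$, where $c_h(x)=hxh^{-1}$. Then $[H\times_{\mathcal F}K]$ denotes any set containing exactly one representative of each equivalence class of maximal pairs (and only such representatives). **Statement.** Let $H,K$ be $\mathcal F$-centric and let $M$ be a $\mathcal G$-centric Mackey functor over $\mathcal F_H(H)$ on $\mathcal R$. Fix a choice of $[H\times_{\mathcal F}K]$, and for each $(A,\overline\varphi)\in[H\times_{\mathcal F}K]$ fix a representative $\varphi$ of $\overline\varphi$, also viewed as an isomorphism $A\to\varphi(A)\le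 K$. Put $M_{(A,\overline\varphi)}={}^{\varphi}\bigl(M\downarrow^{\mathcal F_H(H)}_{\mathcal F_A(A)}\bigr)$, a module over $\mu_{\mathcal R}(\mathcal F_{\varphi(A)}(\varphi(A)))$. Then: 1. each $M_{(A,\overline\varphi)}$ is a $\mathcal G$-centric Mackey functor over $\mathcal F_{\varphi(A)}(\varphi(A))$; 2. for any choices of the sets $[\varphi(A)\times_{\mathcal F_K(K)}J]$ (for $J\le K$ an $\mathcal F$-centric subgroup) there is an isomorphism of $\mu_{\mathcal R}(\mathcal F_K(K))$-modules $$\Gamma:\bigoplus_{(A,\overline\varphi)\in[H\times_{\mathcal F}K]}M_{(A,\overline\varphi)}\uparrow^{\mathcal F_K(K)}_{\mathcal F_{\varphi(A)}(\varphi(A))}\;\xrightarrow{\ \cong\ }\;M\uparrow^{\mathcal F}_{\mathcal F_H(H)}\downarrow^{\mathcal F}_{\mathcal F_K(K)}$$ such that $$\Gamma\bigl(I_{\theta(C)}^{J}c_{\theta}\otimes x\bigr)=I_{\theta(C)}^{J}c_{\theta\varphi}\otimes x$$ for all $(A,\overline\varphi)\in[H\times_{\mathcal F}K]$, all $\mathcal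 F$-centric $J\le K$, all $(C,\overline\theta)\in[\varphi(A)\times_{\mathcal F_K(K)}J]$ with $C$ $\mathcal F$-centric, all representatives $\theta$ of $\overline\theta$ and all $x\in I_C^CM_{(A,\overline\varphi)}=I_{\varphi^{-1}(C)}^{\varphi^{-1}(C)}M$, where $\theta\varphi$ denotes the composite $\varphi^{-1}(C)\to C\to J$; and $\Gamma$ is the only additive map between these modules that satisfies these equations. -/

import Mathlib

universe u v w

/-! ### Finite bisets and their isomorphism classes -/

/-- A finite `(A, B)`-biset: a finite set with commuting left `A`-action and right `B`-action. -/
structure FinBiset (A B : Type u) [Group A] [Group B] : Type (u + 1) where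
  carrier : Type u
  finite : Finite carrier
  l : A → carrier → carrier
  r : carrier → B → carrier
  one_l : ∀ x, l 1 x = x
  mul_l : ∀ a a' x, l (a * a') x = l a (l a' x)
  r_one : ∀ x, r x 1 = x
  r_mul : ∀ x b b', r x (b * b') = r (r x b) b'
  l_r : ∀ a x b, r (l a x) b = l a (r x b)

namespace FinBiset

section

variable {A B C D : Type u} [Group A] [Group B] [Group C] [Group D]

/-- An isomorphism of bisets: a bijection that commutes with both actions. -/
structure Iso (X Y : FinBiset A B) where
  e : X.carrier ≃ Y.carrier
  map_l : ∀ a x, e (X.l a x) = Y.l a (e x)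
  map_r : ∀ x b, e (X.r x b) = Y.r (e x) b

/-- The identity isomorphism. -/
def Iso.refl (X : FinBiset A B) : Iso X X := ⟨Equiv.refl _, fun _ _ => rfl, fun _ _ => rfl⟩

/-- The inverse isomorphism. -/
def Iso.symm {X Y : FinBiset A B} (f : Iso X Y) : Iso Y X :=
  ⟨f.e.symm, fun a y => by rw [Equiv.symm_apply_eq, f.map_l, Equiv.apply_symm_apply],
    fun y b => by rw [Equiv.symm_apply_eq, f.map_r, Equiv.apply_symm_apply]⟩

/-- The composite isomorphism. -/
def Iso.trans {X Y Z : FinBiset A B} (f : Iso X Y) (g : Iso Y Z) : Iso X Z :=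
  ⟨f.e.trans g.e, fun a x => by simp [f.map_l, g.map_l], fun x b => by simp [f.map_r, g.map_r]⟩

instance setoid (A B : Type u) [Group A] [Group B] : Setoid (FinBiset A B) where
  r X Y := Nonempty (Iso X Y)
  iseqv := ⟨fun X => ⟨Iso.refl X⟩, fun ⟨f⟩ => ⟨f.symm⟩, fun ⟨f⟩ ⟨g⟩ => ⟨f.trans g⟩⟩

/-- The empty biset. -/
def empty (A B : Type u) [Group A] [Group B] : FinBiset A B where
  carrier := PEmpty
  finite := inferInstance
  l _ x := x
  r x _ := x
  one_l _ := rfl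
  mul_l _ _ _ := rfl
  r_one _ := rfl
  r_mul _ _ _ := rfl
  l_r _ _ _ := rfl

/-- The disjoint union of two bisets. -/
def sum (X Y : FinBiset A B) : FinBiset A B where
  carrier := X.carrier ⊕ Y.carrier
  finite := by
    have := X.finite
    have := Y.finite
    infer_instance
  l a := Sum.map (X.l a) (Y.l a)
  r s b := Sum.map (fun x => X.r x b) (fun y => Y.r y b) s
  one_l s := by cases s <;> simp [X.one_l, Y.one_l]
  mul_l a a' s := by cases s <;> simp [X.mul_l, Y.mul_l]
  r_one s := by cases s <;> simp [X.r_one, Y.r_one]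
  r_mul s b b' := by cases s <;> simp [X.r_mul, Y.r_mul]
  l_r a s b := by cases s <;> simp [X.l_r, Y.l_r]

/-- The relation `(x · b, y) ∼ (x, b · y)` on `X × Y`. -/
def compSetoid (X : FinBiset A B) (Y : FinBiset B C) : Setoid (X.carrier × Y.carrier) where
  r p q := ∃ b : B, p.1 = X.r q.1 b ∧ Y.l b p.2 = q.2
  iseqv := by
    refine ⟨fun p => ⟨1, (X.r_one _).symm, Y.one_l _⟩, ?_, ?_⟩
    · rintro ⟨x, y⟩ ⟨x', y'⟩ ⟨b, h1, h2⟩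
      refine ⟨b⁻¹, ?_, ?_⟩
      · dsimp only at h1 ⊢
        rw [h1, ← X.r_mul, mul_inv_cancel, X.r_one]
      · dsimp only at h2 ⊢
        rw [← h2, ← Y.mul_l, inv_mul_cancel, Y.one_l]
    · rintro ⟨x, y⟩ ⟨x', y'⟩ ⟨x'', y''⟩ ⟨b, h1, h2⟩ ⟨c, h3, h4⟩
      refine ⟨c * b, ?_, ?_⟩
      · dsimp only at h1 h3 ⊢
        rw [h1, h3, X.r_mul]
      · dsimp only at h2 h4 ⊢
        rw [Y.mul_l, h2, h4]

/-- The product `X ×_B Y` of bisets: the quotient of `X × Y` by `(x · b, y) ∼ (x, b · y)`. -/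
def comp (X : FinBiset A B) (Y : FinBiset B C) : FinBiset A C where
  carrier := Quotient (compSetoid X Y)
  finite := by
    have := X.finite
    have := Y.finite
    infer_instance
  l a := Quotient.map (fun p => (X.l a p.1, p.2)) (by
    rintro ⟨x, y⟩ ⟨x', y'⟩ ⟨b, h1, h2⟩
    refine ⟨b, ?_, h2⟩
    dsimp only at h1 ⊢
    rw [h1, X.l_r])
  r q c := Quotient.map (fun p => (p.1, Y.r p.2 c)) (by
    rintro ⟨x, y⟩ ⟨x', y'⟩ ⟨b, h1, h2⟩
    refine ⟨b, h1, ?_⟩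
    dsimp only at h2 ⊢
    rw [← h2, Y.l_r]) q
  one_l q := by
    induction q using Quotient.inductionOn with | _ p => simp [Quotient.map_mk, X.one_l]
  mul_l a a' q := by
    induction q using Quotient.inductionOn with | _ p => simp [Quotient.map_mk, X.mul_l]
  r_one q := by
    induction q using Quotient.inductionOn with | _ p => simp [Quotient.map_mk, Y.r_one]
  r_mul q b b' := by
    induction q using Quotient.inductionOn with | _ p => simp [Quotient.map_mk, Y.r_mul]
  l_r a q b := by
    induction q using Quotient.inductionOn with | _ p => simp [Quotient.map_mk]

/-- The class of a pair in `X ×_B Y`. -/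
def comp.mk (X : FinBiset A B) (Y : FinBiset B C) (x : X.carrier) (y : Y.carrier) :
    (comp X Y).carrier := Quotient.mk (compSetoid X Y) (x, y)

theorem comp.mk_r_l (X : FinBiset A B) (Y : FinBiset B C) (x : X.carrier) (b : B)
    (y : Y.carrier) : comp.mk X Y (X.r x b) y = comp.mk X Y x (Y.l b y) :=
  Quotient.sound ⟨b, rfl, rfl⟩

/-- A map out of `X ×_B Y`. -/
def comp.lift {X : FinBiset A B} {Y : FinBiset B C} {T : Type*} (f : X.carrier → Y.carrier → T)
    (h : ∀ x b y, f (X.r x b) y = f x (Y.l b y)) : (comp X Y).carrier → T :=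
  Quotient.lift (fun p => f p.1 p.2) (by
    rintro ⟨x, y⟩ ⟨x', y'⟩ ⟨b, h1, h2⟩
    dsimp only at h1 h2 ⊢
    rw [h1, ← h2, h])

@[simp] theorem comp.lift_mk {X : FinBiset A B} {Y : FinBiset B C} {T : Type*}
    (f : X.carrier → Y.carrier → T) (h : ∀ x b y, f (X.r x b) y = f x (Y.l b y)) (x y) :
    comp.lift f h (comp.mk X Y x y) = f x y := rfl

@[elab_as_elim] theorem comp.ind {X : FinBiset A B} {Y : FinBiset B C} {p : (comp X Y).carrier → Prop}
    (h : ∀ x y, p (comp.mk X Y x y)) (q) : p q :=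
  Quotient.inductionOn q fun z => h z.1 z.2

/-- Build an isomorphism out of mutually inverse maps. -/
def Iso.mk' {X Y : FinBiset A B} (f : X.carrier → Y.carrier) (g : Y.carrier → X.carrier)
    (gf : ∀ x, g (f x) = x) (fg : ∀ y, f (g y) = y) (hl : ∀ a x, f (X.l a x) = Y.l a (f x))
    (hr : ∀ x b, f (X.r x b) = Y.r (f x) b) : Iso X Y :=
  ⟨⟨f, g, gf, fg⟩, hl, hr⟩

/-- Functoriality of the product of bisets. -/
def Iso.comp {X X' : FinBiset A B} {Y Y' : FinBiset B C} (f : Iso X X') (g : Iso Y Y') :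
    Iso (X.comp Y) (X'.comp Y') :=
  Iso.mk'
    (comp.lift (fun x y => comp.mk X' Y' (f.e x) (g.e y)) (fun x b y => by
      rw [f.map_r, g.map_l, comp.mk_r_l]))
    (comp.lift (fun x y => comp.mk X Y (f.symm.e x) (g.symm.e y)) (fun x b y => by
      rw [f.symm.map_r, g.symm.map_l, comp.mk_r_l]))
    (by intro q; induction q using comp.ind with | h x y => simp [Iso.symm])
    (by intro q; induction q using comp.ind with | h x y => simp [Iso.symm])
    (by
      intro a q
      induction q using comp.ind with
      | h x y => exact congrArg (fun t => comp.mk X' Y' t (g.e y)) (f.map_l a x))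
    (by
      intro q b
      induction q using comp.ind with
      | h x y => exact congrArg (fun t => comp.mk X' Y' (f.e x) t) (g.map_r y b))

/-- Functoriality of the disjoint union. -/
def Iso.sum {X X' Y Y' : FinBiset A B} (f : Iso X X') (g : Iso Y Y') :
    Iso (X.sum Y) (X'.sum Y') :=
  ⟨Equiv.sumCongr f.e g.e,
    by
      rintro a (x | x)
      · exact congrArg Sum.inl (f.map_l a x)
      · exact congrArg Sum.inr (g.map_l a x),
    by
      rintro (x | x) b
      · exact congrArg Sum.inl (f.map_r x b)
      · exact congrArg Sum.inr (g.map_r x b)⟩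

/-- The product of bisets is associative. -/
def compAssoc (X : FinBiset A B) (Y : FinBiset B C) (Z : FinBiset C D) :
    Iso ((X.comp Y).comp Z) (X.comp (Y.comp Z)) :=
  Iso.mk'
    (comp.lift (fun q z => comp.lift (fun x y => comp.mk X (Y.comp Z) x (comp.mk Y Z y z))
      (fun x b y => comp.mk_r_l X (Y.comp Z) x b (comp.mk Y Z y z)) q)
      (by
        intro q c z
        induction q using comp.ind with
        | h x y => exact congrArg (comp.mk X (Y.comp Z) x) (comp.mk_r_l Y Z y c z)))
    (comp.lift (fun x q => comp.lift (fun y z => comp.mk (X.comp Y) Z (comp.mk X Y x y) z)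
      (fun y c z => comp.mk_r_l (X.comp Y) Z (comp.mk X Y x y) c z) q)
      (by
        intro x b q
        induction q using comp.ind with
        | h y z => exact congrArg (fun t => comp.mk (X.comp Y) Z t z) (comp.mk_r_l X Y x b y)))
    (by
      intro q
      induction q using comp.ind with
      | h q z => induction q using comp.ind with | h x y => rfl)
    (by
      intro q
      induction q using comp.ind with
      | h x q => induction q using comp.ind with | h y z => rfl)
    (by
      intro a q
      induction q using comp.ind with
      | h q z => induction q using comp.ind with | h x y => rfl)
    (by
      intro q d
      induction q using comp.ind with
      | h q z => induction q using comp.ind with | h x y => rfl)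

/-- The product of bisets distributes over disjoint unions in the first factor. -/
def sumComp (X X' : FinBiset A B) (Y : FinBiset B C) :
    Iso ((X.sum X').comp Y) ((X.comp Y).sum (X'.comp Y)) :=
  Iso.mk'
    (comp.lift (fun s y => Sum.map (fun x => comp.mk X Y x y) (fun x => comp.mk X' Y x y) s)
      (by
        rintro (x | x) b y
        · exact congrArg Sum.inl (comp.mk_r_l X Y x b y)
        · exact congrArg Sum.inr (comp.mk_r_l X' Y x b y)))
    (Sum.elim
      (comp.lift (fun x y => comp.mk (X.sum X') Y (Sum.inl x) y)
        (fun x b y => comp.mk_r_l (X.sum X') Y (Sum.inl x) b y))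
      (comp.lift (fun x y => comp.mk (X.sum X') Y (Sum.inr x) y)
        (fun x b y => comp.mk_r_l (X.sum X') Y (Sum.inr x) b y)))
    (by
      intro q
      induction q using comp.ind with | h s y => rcases s with x | x <;> rfl)
    (by rintro (q | q) <;> induction q using comp.ind with | h x y => rfl)
    (by
      intro a q
      induction q using comp.ind with | h s y => rcases s with x | x <;> rfl)
    (by
      intro q b
      induction q using comp.ind with | h s y => rcases s with x | x <;> rfl)

/-- The product of bisets distributes over disjoint unions in the second factor. -/
def compSum (X : FinBiset A B) (Y Y' : FinBiset B C) :
    Iso (X.comp (Y.sum Y')) ((X.comp Y).sum (X.comp Y')) :=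
  Iso.mk'
    (comp.lift (fun x s => Sum.map (fun y => comp.mk X Y x y) (fun y => comp.mk X Y' x y) s)
      (by
        rintro x b (y | y)
        · exact congrArg Sum.inl (comp.mk_r_l X Y x b y)
        · exact congrArg Sum.inr (comp.mk_r_l X Y' x b y)))
    (Sum.elim
      (comp.lift (fun x y => comp.mk X (Y.sum Y') x (Sum.inl y))
        (fun x b y => comp.mk_r_l X (Y.sum Y') x b (Sum.inl y)))
      (comp.lift (fun x y => comp.mk X (Y.sum Y') x (Sum.inr y))
        (fun x b y => comp.mk_r_l X (Y.sum Y') x b (Sum.inr y))))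
    (by
      intro q
      induction q using comp.ind with | h x s => rcases s with y | y <;> rfl)
    (by rintro (q | q) <;> induction q using comp.ind with | h x y => rfl)
    (by
      intro a q
      induction q using comp.ind with | h x s => rcases s with y | y <;> rfl)
    (by
      intro q b
      induction q using comp.ind with | h x s => rcases s with y | y <;> rfl)

/-- The `(A, B)`-biset `(A × B) / U`, with `a · (x, y)U · b = (a x, b⁻¹ y)U`. -/
def coset [Finite A] [Finite B] (U : Subgroup (A × B)) : FinBiset A B where
  carrier := (A × B) ⧸ U
  finite := inferInstance
  l a x := ((a, 1) : A × B) • x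
  r x b := ((1, b⁻¹) : A × B) • x
  one_l x := one_smul (A × B) x
  mul_l a a' x := by rw [smul_smul]; simp
  r_one x := by
    rw [inv_one]
    exact one_smul (A × B) x
  r_mul x b b' := by rw [smul_smul]; simp
  l_r a x b := by rw [smul_smul, smul_smul]; simp

/-- For group homomorphisms `f : L → A` and `g : L → B`, the biset
`(A × B) / {(f x, g x) : x ∈ L}`. -/
def ofHoms [Finite A] [Finite B] {L : Type*} [Group L] (f : L →* A) (g : L →* B) :
    FinBiset A B := coset (f.prod g).range

/-- Transport of an `(A, B)`-biset along group isomorphisms `A ≃ A'` and `B ≃ B'`. -/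
def push {A' B' : Type u} [Group A'] [Group B'] (e : A ≃* A') (f : B ≃* B')
    (X : FinBiset A B) : FinBiset A' B' where
  carrier := X.carrier
  finite := X.finite
  l a x := X.l (e.symm a) x
  r x b := X.r x (f.symm b)
  one_l x := by rw [map_one, X.one_l]
  mul_l a a' x := by rw [map_mul, X.mul_l]
  r_one x := by rw [map_one, X.r_one]
  r_mul x b b' := by rw [map_mul, X.r_mul]
  l_r a x b := X.l_r _ _ _

/-- Transport respects isomorphisms. -/
def Iso.push {A' B' : Type u} [Group A'] [Group B'] (e : A ≃* A') (f : B ≃* B')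
    {X Y : FinBiset A B} (i : Iso X Y) : Iso (X.push e f) (Y.push e f) :=
  ⟨i.e, fun _ _ => i.map_l _ _, fun _ _ => i.map_r _ _⟩

/-- Transport respects products. -/
def pushComp {A' B' C' : Type u} [Group A'] [Group B'] [Group C'] (e : A ≃* A') (f : B ≃* B')
    (g : C ≃* C') (X : FinBiset A B) (Y : FinBiset B C) :
    Iso ((X.comp Y).push e g) ((X.push e f).comp (Y.push f g)) :=
  Iso.mk'
    (comp.lift (fun x y => comp.mk (X.push e f) (Y.push f g) x y) (fun x b y => by
      have h := comp.mk_r_l (X.push e f) (Y.push f g) x (f b) y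
      simpa [FinBiset.push] using h))
    (comp.lift (fun x y => comp.mk X Y x y) (fun x b y => comp.mk_r_l X Y x (f.symm b) y))
    (by intro q; induction q using comp.ind with | h x y => rfl)
    (by intro q; induction q using comp.ind with | h x y => rfl)
    (by intro a q; induction q using comp.ind with | h x y => rfl)
    (by intro q b; induction q using comp.ind with | h x y => rfl)

/-- Transport of `(A × B) / {(f x, g x) : x ∈ L}`. -/
def pushOfHoms [Finite A] [Finite B] {A' B' : Type u} {L L' : Type*} [Group A'] [Group B']
    [Group L] [Group L'] [Finite A'] [Finite B'] (e : A ≃* A') (e' : B ≃* B') (f : L →* A)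
    (g : L →* B) (f' : L' →* A') (g' : L' →* B') (i : L ≃* L') (hf : ∀ x, f' (i x) = e (f x))
    (hg : ∀ x, g' (i x) = e' (g x)) :
    Iso ((ofHoms f g).push e e') (ofHoms f' g') where
  e := Quotient.congr (ra := QuotientGroup.leftRel (f.prod g).range)
    (rb := QuotientGroup.leftRel (f'.prod g').range) (MulEquiv.prodCongr e e').toEquiv (by
      rintro ⟨a, b⟩ ⟨a', b'⟩
      rw [QuotientGroup.leftRel_apply, QuotientGroup.leftRel_apply]
      constructor
      · rintro ⟨x, hx⟩
        have h1 : f x = a⁻¹ * a' := congrArg Prod.fst hx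
        have h2 : g x = b⁻¹ * b' := congrArg Prod.snd hx
        refine ⟨i x, Prod.ext ?_ ?_⟩
        · change f' (i x) = (e a)⁻¹ * e a'
          rw [hf, h1, map_mul, map_inv]
        · change g' (i x) = (e' b)⁻¹ * e' b'
          rw [hg, h2, map_mul, map_inv]
      · rintro ⟨y, hy⟩
        obtain ⟨x, rfl⟩ := i.surjective y
        have h1 : f' (i x) = (e a)⁻¹ * e a' := congrArg Prod.fst hy
        have h2 : g' (i x) = (e' b)⁻¹ * e' b' := congrArg Prod.snd hy
        rw [hf, ← map_inv, ← map_mul] at h1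
        rw [hg, ← map_inv, ← map_mul] at h2
        exact ⟨x, Prod.ext (e.injective h1) (e'.injective h2)⟩)
  map_l a q := by
    induction q using Quotient.inductionOn' with
    | _ p =>
      refine congrArg (QuotientGroup.mk (s := (f'.prod g').range)) (Prod.ext ?_ ?_)
      · change e (e.symm a * p.1) = a * e p.1
        simp
      · change e' (1 * p.2) = 1 * e' p.2
        simp
  map_r q b := by
    induction q using Quotient.inductionOn' with
    | _ p =>
      refine congrArg (QuotientGroup.mk (s := (f'.prod g').range)) (Prod.ext ?_ ?_)
      · change e (1 * p.1) = 1 * e p.1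
        simp
      · change e' ((e'.symm b)⁻¹ * p.2) = b⁻¹ * e' p.2
        simp

/-- `(A × A) / Δ(A)` is a left unit. -/
def idComp [Finite A] (X : FinBiset A B) :
    Iso ((ofHoms (MonoidHom.id A) (MonoidHom.id A)).comp X) X :=
  have key : ∀ (p q : A × A) (x : X.carrier),
      QuotientGroup.leftRel ((MonoidHom.id A).prod (MonoidHom.id A)).range p q →
      X.l (p.1 * p.2⁻¹) x = X.l (q.1 * q.2⁻¹) x := by
    rintro ⟨a, b⟩ ⟨a', b'⟩ x h
    rw [QuotientGroup.leftRel_apply] at h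
    obtain ⟨c, hc⟩ := h
    have h1 : c = a⁻¹ * a' := congrArg Prod.fst hc
    have h2 : c = b⁻¹ * b' := congrArg Prod.snd hc
    have ha : a' = a * c := by rw [h1]; group
    have hb : b' = b * c := by rw [h2]; group
    simp only [ha, hb]
    congr 1
    group
  Iso.mk'
    (comp.lift (fun q x => Quotient.liftOn' q (fun p => X.l (p.1 * p.2⁻¹) x)
      (fun p q h => key p q x h)) (by
        intro q b x
        induction q using Quotient.inductionOn' with
        | _ p =>
          change X.l (1 * p.1 * (b⁻¹ * p.2)⁻¹) x = X.l (p.1 * p.2⁻¹) (X.l b x)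
          rw [← X.mul_l]
          congr 1
          group))
    (fun x => comp.mk (ofHoms (MonoidHom.id A) (MonoidHom.id A)) X
      (QuotientGroup.mk (1 : A × A)) x)
    (by
      intro q
      induction q using comp.ind with
      | h q x =>
        induction q using Quotient.inductionOn' with
        | _ p =>
          refine (comp.mk_r_l (ofHoms (MonoidHom.id A) (MonoidHom.id A)) X
            (QuotientGroup.mk (1 : A × A)) (p.1 * p.2⁻¹) x).symm.trans ?_
          refine congrArg (fun t => comp.mk (ofHoms (MonoidHom.id A) (MonoidHom.id A)) X t x) ?_
          refine QuotientGroup.eq.2 ⟨p.1, ?_⟩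
          ext <;> simp)
    (by
      intro x
      change X.l (1 * 1⁻¹) x = x
      rw [inv_one, mul_one, X.one_l])
    (by
      intro a q
      induction q using comp.ind with
      | h q x =>
        induction q using Quotient.inductionOn' with
        | _ p =>
          change X.l (a * p.1 * (1 * p.2)⁻¹) x = X.l a (X.l (p.1 * p.2⁻¹) x)
          rw [← X.mul_l]
          congr 1
          group)
    (by
      intro q b
      induction q using comp.ind with
      | h q x =>
        induction q using Quotient.inductionOn' with
        | _ p => exact (X.l_r _ _ _).symm)

/-- `(B × B) / Δ(B)` is a right unit. -/
def compId [Finite B] (X : FinBiset A B) :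
    Iso (X.comp (ofHoms (MonoidHom.id B) (MonoidHom.id B))) X :=
  have key : ∀ (p q : B × B) (x : X.carrier),
      QuotientGroup.leftRel ((MonoidHom.id B).prod (MonoidHom.id B)).range p q →
      X.r x (p.1 * p.2⁻¹) = X.r x (q.1 * q.2⁻¹) := by
    rintro ⟨a, b⟩ ⟨a', b'⟩ x h
    rw [QuotientGroup.leftRel_apply] at h
    obtain ⟨c, hc⟩ := h
    have h1 : c = a⁻¹ * a' := congrArg Prod.fst hc
    have h2 : c = b⁻¹ * b' := congrArg Prod.snd hc
    have ha : a' = a * c := by rw [h1]; group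
    have hb : b' = b * c := by rw [h2]; group
    simp only [ha, hb]
    congr 1
    group
  Iso.mk'
    (comp.lift (fun x q => Quotient.liftOn' q (fun p => X.r x (p.1 * p.2⁻¹))
      (fun p q h => key p q x h)) (by
        intro x b q
        induction q using Quotient.inductionOn' with
        | _ p =>
          change X.r (X.r x b) (p.1 * p.2⁻¹) = X.r x (b * p.1 * (1 * p.2)⁻¹)
          rw [← X.r_mul]
          congr 1
          group))
    (fun x => comp.mk X (ofHoms (MonoidHom.id B) (MonoidHom.id B)) x
      (QuotientGroup.mk (1 : B × B)))
    (by
      intro q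
      induction q using comp.ind with
      | h x q =>
        induction q using Quotient.inductionOn' with
        | _ p =>
          refine (comp.mk_r_l X (ofHoms (MonoidHom.id B) (MonoidHom.id B)) x (p.1 * p.2⁻¹)
            (QuotientGroup.mk (1 : B × B))).trans ?_
          refine congrArg (fun t => comp.mk X (ofHoms (MonoidHom.id B) (MonoidHom.id B)) x t) ?_
          refine QuotientGroup.eq.2 ⟨p.2, ?_⟩
          ext <;> simp)
    (by
      intro x
      change X.r x (1 * 1⁻¹) = x
      rw [inv_one, mul_one, X.r_one])
    (by
      intro a q
      induction q using comp.ind with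
      | h x q =>
        induction q using Quotient.inductionOn' with
        | _ p => exact X.l_r _ _ _)
    (by
      intro q b
      induction q using comp.ind with
      | h x q =>
        induction q using Quotient.inductionOn' with
        | _ p =>
          change X.r x (1 * p.1 * (b⁻¹ * p.2)⁻¹) = X.r (X.r x (p.1 * p.2⁻¹)) b
          rw [← X.r_mul]
          congr 1
          group)

end

end FinBiset

/-- Isomorphism classes of finite `(A, B)`-bisets. -/
def BisetClass (A B : Type u) [Group A] [Group B] : Type (u + 1) :=
  Quotient (FinBiset.setoid A B)

namespace BisetClass

variable {A B C D : Type u} [Group A] [Group B] [Group C] [Group D]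

/-- The isomorphism class of a finite biset. -/
def mk (X : FinBiset A B) : BisetClass A B := Quotient.mk _ X

theorem mk_eq {X Y : FinBiset A B} (f : FinBiset.Iso X Y) : mk X = mk Y := Quotient.sound ⟨f⟩

@[elab_as_elim] theorem ind {p : BisetClass A B → Prop} (h : ∀ X, p (mk X)) (x) : p x :=
  Quotient.inductionOn x h

instance : Zero (BisetClass A B) := ⟨mk (FinBiset.empty A B)⟩

/-- Addition is disjoint union. -/
instance : Add (BisetClass A B) where
  add x y := Quotient.liftOn₂ x y (fun X Y => mk (X.sum Y))
    (fun _ _ _ _ ⟨f⟩ ⟨g⟩ => mk_eq (f.sum g))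

theorem mk_add (X Y : FinBiset A B) : mk X + mk Y = mk (X.sum Y) := rfl

instance : AddCommMonoid (BisetClass A B) where
  add_assoc x y z := by
    induction x using ind with | h X => ?_
    induction y using ind with | h Y => ?_
    induction z using ind with | h Z => ?_
    exact mk_eq ⟨Equiv.sumAssoc _ _ _, by rintro a ((x | x) | x) <;> rfl,
      by rintro ((x | x) | x) b <;> rfl⟩
  zero_add x := by
    induction x using ind with | h X => ?_
    exact mk_eq ⟨Equiv.emptySum PEmpty X.carrier, by rintro a (x | x); exacts [x.elim, rfl],
      by rintro (x | x) b; exacts [x.elim, rfl]⟩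
  add_zero x := by
    induction x using ind with | h X => ?_
    exact mk_eq ⟨Equiv.sumEmpty X.carrier PEmpty, by rintro a (x | x); exacts [rfl, x.elim],
      by rintro (x | x) b; exacts [rfl, x.elim]⟩
  add_comm x y := by
    induction x using ind with | h X => ?_
    induction y using ind with | h Y => ?_
    exact mk_eq ⟨Equiv.sumComm _ _, by rintro a (x | x) <;> rfl, by rintro (x | x) b <;> rfl⟩
  nsmul := nsmulRec

/-- The product of isomorphism classes of bisets. -/
def mul (x : BisetClass A B) (y : BisetClass B C) : BisetClass A C :=
  Quotient.liftOn₂ x y (fun X Y => mk (X.comp Y)) (fun _ _ _ _ ⟨f⟩ ⟨g⟩ => mk_eq (f.comp g))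

theorem mk_mul (X : FinBiset A B) (Y : FinBiset B C) : (mk X).mul (mk Y) = mk (X.comp Y) := rfl

theorem mul_assoc' (x : BisetClass A B) (y : BisetClass B C) (z : BisetClass C D) :
    (x.mul y).mul z = x.mul (y.mul z) := by
  induction x using ind with | h X => ?_
  induction y using ind with | h Y => ?_
  induction z using ind with | h Z => ?_
  exact mk_eq (X.compAssoc Y Z)

theorem add_mul' (x x' : BisetClass A B) (y : BisetClass B C) :
    (x + x').mul y = x.mul y + x'.mul y := by
  induction x using ind with | h X => ?_
  induction x' using ind with | h X' => ?_
  induction y using ind with | h Y => ?_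
  exact mk_eq (X.sumComp X' Y)

theorem mul_add' (x : BisetClass A B) (y y' : BisetClass B C) :
    x.mul (y + y') = x.mul y + x.mul y' := by
  induction x using ind with | h X => ?_
  induction y using ind with | h Y => ?_
  induction y' using ind with | h Y' => ?_
  exact mk_eq (X.compSum Y Y')

theorem zero_mul' (y : BisetClass B C) : (0 : BisetClass A B).mul y = 0 := by
  induction y using ind with | h Y => ?_
  have h : IsEmpty ((FinBiset.empty A B).comp Y).carrier :=
    ⟨fun q => by induction q using FinBiset.comp.ind with | h x y => exact x.elim⟩
  exact mk_eq ⟨Equiv.equivOfIsEmpty _ PEmpty, fun _ x => h.elim x, fun x => h.elim x⟩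

theorem mul_zero' (x : BisetClass A B) : x.mul (0 : BisetClass B C) = 0 := by
  induction x using ind with | h X => ?_
  have h : IsEmpty (X.comp (FinBiset.empty B C)).carrier :=
    ⟨fun q => by induction q using FinBiset.comp.ind with | h x y => exact y.elim⟩
  exact mk_eq ⟨Equiv.equivOfIsEmpty _ PEmpty, fun _ x => h.elim x, fun x => h.elim x⟩

/-- The product of classes as a biadditive map. -/
def mulHom (A B C : Type u) [Group A] [Group B] [Group C] :
    BisetClass A B →+ BisetClass B C →+ BisetClass A C where
  toFun x := { toFun := x.mul, map_zero' := mul_zero' x, map_add' := mul_add' x }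
  map_zero' := by ext y; exact zero_mul' y
  map_add' x x' := by ext y; exact add_mul' x x' y

/-- The class of `(A × B) / {(f x, g x) : x ∈ L}`. -/
def ofHoms [Finite A] [Finite B] {L : Type*} [Group L] (f : L →* A) (g : L →* B) :
    BisetClass A B := mk (FinBiset.ofHoms f g)

theorem id_mul' [Finite A] (x : BisetClass A B) :
    (ofHoms (MonoidHom.id A) (MonoidHom.id A)).mul x = x := by
  induction x using ind with | h X => exact mk_eq X.idComp

theorem mul_id' [Finite B] (x : BisetClass A B) :
    x.mul (ofHoms (MonoidHom.id B) (MonoidHom.id B)) = x := by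
  induction x using ind with | h X => exact mk_eq X.compId

/-- Transport of biset classes along group isomorphisms. -/
def push {A' B' : Type u} [Group A'] [Group B'] (e : A ≃* A') (f : B ≃* B') :
    BisetClass A B →+ BisetClass A' B' where
  toFun x := Quotient.liftOn x (fun X => mk (X.push e f)) (fun _ _ ⟨i⟩ => mk_eq (i.push e f))
  map_zero' := mk_eq ⟨Equiv.refl _, fun _ _ => rfl, fun _ _ => rfl⟩
  map_add' x y := by
    induction x using ind with | h X => ?_
    induction y using ind with | h Y => ?_
    exact mk_eq ⟨Equiv.refl _, by rintro a (x | x) <;> rfl, by rintro (x | x) b <;> rfl⟩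

theorem push_mul {A' B' C' : Type u} [Group A'] [Group B'] [Group C'] (e : A ≃* A')
    (f : B ≃* B') (g : C ≃* C') (x : BisetClass A B) (y : BisetClass B C) :
    push e g (x.mul y) = (push e f x).mul (push f g y) := by
  induction x using ind with | h X => ?_
  induction y using ind with | h Y => ?_
  exact mk_eq (FinBiset.pushComp e f g X Y)

theorem push_ofHoms [Finite A] [Finite B] {A' B' : Type u} {L L' : Type*} [Group A'] [Group B']
    [Group L] [Group L'] [Finite A'] [Finite B'] (e : A ≃* A') (e' : B ≃* B') (f : L →* A)
    (g : L →* B) (f' : L' →* A') (g' : L' →* B') (i : L ≃* L') (hf : ∀ x, f' (i x) = e (f x))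
    (hg : ∀ x, g' (i x) = e' (g x)) : push e e' (ofHoms f g) = ofHoms f' g' :=
  mk_eq (FinBiset.pushOfHoms e e' f g f' g' i hf hg)

end BisetClass

/-! ### The semiring of biset classes between subgroups of a finite group -/

/-- The direct sum, over all pairs `(A, B)` of subgroups of the finite group `P`, of the monoids
of isomorphism classes of finite `(A, B)`-bisets. -/
def BisetSemiring (P : Type u) [Group P] : Type (u + 1) := (A B : Subgroup P) → BisetClass A B

namespace BisetSemiring

variable {P : Type u} [Group P]

instance : AddCommMonoid (BisetSemiring P) :=
  inferInstanceAs (AddCommMonoid ((A B : Subgroup P) → BisetClass A B))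

@[ext] theorem ext {x y : BisetSemiring P} (h : ∀ A B, x A B = y A B) : x = y :=
  funext fun A => funext fun B => h A B

theorem add_apply (x y : BisetSemiring P) (A B : Subgroup P) : (x + y) A B = x A B + y A B := rfl

theorem zero_apply (A B : Subgroup P) : (0 : BisetSemiring P) A B = 0 := rfl

open Classical in
/-- The element given by an `(A, B)`-biset class. -/
noncomputable def single (A B : Subgroup P) : BisetClass A B →+ BisetSemiring P where
  toFun x := Pi.single A (Pi.single B x)
  map_zero' := by rw [Pi.single_zero, Pi.single_zero]; rfl
  map_add' x y := by rw [Pi.single_add, Pi.single_add]; rfl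

theorem single_same (A B : Subgroup P) (x : BisetClass A B) : single A B x A B = x := by
  classical
  change (Pi.single A (Pi.single B x) : (A B : Subgroup P) → BisetClass A B) A B = x
  rw [Pi.single_eq_same, Pi.single_eq_same]

theorem single_ne_left {A A' : Subgroup P} (B B' : Subgroup P) (h : A' ≠ A) (x : BisetClass A B) :
    single A B x A' B' = 0 := by
  classical
  change (Pi.single A (Pi.single B x) : (A B : Subgroup P) → BisetClass A B) A' B' = 0
  rw [Pi.single_eq_of_ne h]
  rfl

theorem single_ne_right (A A' : Subgroup P) {B B' : Subgroup P} (h : B' ≠ B)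
    (x : BisetClass A B) : single A B x A' B' = 0 := by
  classical
  by_cases hA : A' = A
  · subst hA
    change (Pi.single A' (Pi.single B x) : (A B : Subgroup P) → BisetClass A B) A' B' = 0
    rw [Pi.single_eq_same, Pi.single_eq_of_ne h]
  · exact single_ne_left B B' hA x

variable [Finite P]

/-- The finite set of all subgroups. -/
noncomputable def subgroups (P : Type u) [Group P] [Finite P] : Finset (Subgroup P) :=
  (Set.finite_univ (α := Subgroup P)).toFinset

theorem mem_subgroups (A : Subgroup P) : A ∈ subgroups P := by simp [subgroups]

/-- The product of an `(A, B)`-biset and a `(B', C)`-biset is their product as bisets if `B = B'`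
and zero otherwise, extended biadditively. -/
noncomputable instance : Mul (BisetSemiring P) :=
  ⟨fun x y A C => ∑ B ∈ subgroups P, (x A B).mul (y B C)⟩

theorem mul_apply (x y : BisetSemiring P) (A C : Subgroup P) :
    (x * y) A C = ∑ B ∈ subgroups P, (x A B).mul (y B C) := rfl

noncomputable instance : NonUnitalSemiring (BisetSemiring P) where
  left_distrib x y z := by
    ext A C
    simp only [mul_apply, add_apply, BisetClass.mul_add', Finset.sum_add_distrib]
  right_distrib x y z := by
    ext A C
    simp only [mul_apply, add_apply, BisetClass.add_mul', Finset.sum_add_distrib]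
  zero_mul x := by
    ext A C
    simp only [mul_apply, zero_apply, BisetClass.zero_mul', Finset.sum_const_zero]
  mul_zero x := by
    ext A C
    simp only [mul_apply, zero_apply, BisetClass.mul_zero', Finset.sum_const_zero]
  mul_assoc x y z := by
    ext A D
    simp only [mul_apply]
    have h1 : ∀ C, (∑ B ∈ subgroups P, (x A B).mul (y B C)).mul (z C D) =
        ∑ B ∈ subgroups P, ((x A B).mul (y B C)).mul (z C D) := fun C =>
      map_sum ((BisetClass.mulHom A C D).flip (z C D)) (fun B => (x A B).mul (y B C)) _
    have h2 : ∀ B, (x A B).mul (∑ C ∈ subgroups P, (y B C).mul (z C D)) =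
        ∑ C ∈ subgroups P, (x A B).mul ((y B C).mul (z C D)) := fun B =>
      map_sum (BisetClass.mulHom A B D (x A B)) _ _
    simp only [h1, h2, BisetClass.mul_assoc']
    exact Finset.sum_comm

theorem single_mul_single (A B C : Subgroup P) (x : BisetClass A B) (y : BisetClass B C) :
    single A B x * single B C y = single A C (x.mul y) := by
  ext A' C'
  rw [mul_apply, Finset.sum_eq_single B]
  · by_cases hA : A' = A
    · by_cases hC : C' = C
      · subst hA hC
        simp only [single_same]
      · rw [single_ne_right _ _ hC, single_ne_right _ _ hC, BisetClass.mul_zero']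
    · rw [single_ne_left _ _ hA, single_ne_left _ _ hA, BisetClass.zero_mul']
  · intro B' _ hB
    rw [single_ne_left _ _ hB, BisetClass.mul_zero']
  · exact fun h => (h (mem_subgroups B)).elim

theorem single_mul_single_ne (A C : Subgroup P) {B B' : Subgroup P} (h : B ≠ B')
    (x : BisetClass A B) (y : BisetClass B' C) : single A B x * single B' C y = 0 := by
  ext A' C'
  rw [mul_apply, zero_apply]
  refine Finset.sum_eq_zero fun D _ => ?_
  by_cases hD : D = B
  · subst hD
    rw [single_ne_left _ _ h, BisetClass.mul_zero']
  · rw [single_ne_right _ _ hD, BisetClass.zero_mul']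

end BisetSemiring

/-! ### Grothendieck rings -/

/-- The Grothendieck group of the additive monoid of a semiring, with its induced ring
structure. -/
def GrothendieckRing (N : Type u) [Semiring N] : Type u := Algebra.GrothendieckAddGroup N

namespace GrothendieckRing

variable {N N' : Type u} [Semiring N] [Semiring N']

noncomputable instance : AddCommGroup (GrothendieckRing N) :=
  inferInstanceAs (AddCommGroup (Algebra.GrothendieckAddGroup N))

/-- The canonical map into the Grothendieck group. -/
noncomputable def of : N →+ GrothendieckRing N := Algebra.GrothendieckAddGroup.of

/-- The universal property of the Grothendieck group. -/
noncomputable def lift {T : Type*} [AddCommGroup T] (f : N →+ T) : GrothendieckRing N →+ T :=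
  Algebra.GrothendieckAddGroup.lift f

@[simp] theorem lift_of {T : Type*} [AddCommGroup T] (f : N →+ T) (n : N) :
    lift f (of n) = f n :=
  DFunLike.congr_fun (Algebra.GrothendieckAddGroup.lift.symm_apply_apply f) n

theorem hom_ext {T : Type*} [AddCommGroup T] {f g : GrothendieckRing N →+ T}
    (h : ∀ n, f (of n) = g (of n)) : f = g :=
  Algebra.GrothendieckAddGroup.lift.symm.injective (AddMonoidHom.ext h)

/-- The multiplication, as a biadditive map extending that of `N`. -/
noncomputable def mulHom :
    GrothendieckRing N →+ GrothendieckRing N →+ GrothendieckRing N :=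
  lift
    { toFun := fun n => lift (of.comp (AddMonoidHom.mulLeft n))
      map_zero' := hom_ext fun m => by simp
      map_add' := fun n n' => hom_ext fun m => by simp [add_mul] }

noncomputable instance : Mul (GrothendieckRing N) := ⟨fun x y => mulHom x y⟩

theorem mul_def (x y : GrothendieckRing N) : x * y = mulHom x y := rfl

noncomputable instance : One (GrothendieckRing N) := ⟨of 1⟩

theorem one_def : (1 : GrothendieckRing N) = of 1 := rfl

theorem of_mul (n m : N) : of (n * m) = of n * of m := by simp [mul_def, mulHom]

theorem of_mul_assoc (n m k : N) : of n * of m * of k = of n * (of m * of k) := by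
  rw [← of_mul, ← of_mul, ← of_mul, ← of_mul, mul_assoc]

theorem mul_assoc' (x y z : GrothendieckRing N) : x * y * z = x * (y * z) := by
  have h3 (n m : N) (z : GrothendieckRing N) : of n * of m * z = of n * (of m * z) :=
    DFunLike.congr_fun (hom_ext (f := mulHom (of n * of m))
      (g := (mulHom (of n)).comp (mulHom (of m))) (of_mul_assoc n m)) z
  have h2 (n : N) (y : GrothendieckRing N) : of n * y * z = of n * (y * z) :=
    DFunLike.congr_fun (hom_ext (f := (mulHom.flip z).comp (mulHom (of n)))
      (g := (mulHom (of n)).comp (mulHom.flip z)) (fun m => h3 n m z)) y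
  exact DFunLike.congr_fun (hom_ext (f := (mulHom.flip z).comp (mulHom.flip y))
    (g := mulHom.flip (y * z)) (fun n => h2 n y)) x

noncomputable instance : Ring (GrothendieckRing N) :=
  { (inferInstance : AddCommGroup (GrothendieckRing N)) with
    mul := (· * ·)
    one := 1
    left_distrib := fun x y z => map_add (mulHom x) y z
    right_distrib := fun x y z => map_add (mulHom.flip z) x y
    zero_mul := fun x => map_zero (mulHom.flip x)
    mul_zero := fun x => map_zero (mulHom x)
    mul_assoc := mul_assoc'
    one_mul := fun x => by
      have h : mulHom (of (1 : N)) = AddMonoidHom.id _ :=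
        hom_ext fun m => by rw [← mul_def, ← of_mul, one_mul, AddMonoidHom.id_apply]
      exact DFunLike.congr_fun h x
    mul_one := fun x => by
      have h : mulHom.flip (of (1 : N)) = AddMonoidHom.id _ :=
        hom_ext fun m => by
          rw [AddMonoidHom.flip_apply, ← mul_def, ← of_mul, mul_one, AddMonoidHom.id_apply]
      exact DFunLike.congr_fun h x }

/-- The map of Grothendieck rings induced by a multiplicative and additive map. It need not
preserve the unit. -/
noncomputable def map (f : N →ₙ+* N') : GrothendieckRing N →ₙ+* GrothendieckRing N' :=
  { lift (of.comp f.toAddMonoidHom) with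
    map_mul' := fun x y => by
      have h2 (n : N) (y : GrothendieckRing N) :
          lift (of.comp f.toAddMonoidHom) (of n * y) =
            of (f n) * lift (of.comp f.toAddMonoidHom) y :=
        DFunLike.congr_fun (hom_ext (f := (lift (of.comp f.toAddMonoidHom)).comp (mulHom (of n)))
          (g := (mulHom (of (f n))).comp (lift (of.comp f.toAddMonoidHom))) (fun m => by
            simp only [AddMonoidHom.comp_apply, ← mul_def, ← of_mul, lift_of]
            exact congrArg of (map_mul f n m))) y
      exact DFunLike.congr_fun (hom_ext
        (f := (lift (of.comp f.toAddMonoidHom)).comp (mulHom.flip y))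
        (g := (mulHom.flip (lift (of.comp f.toAddMonoidHom) y)).comp
          (lift (of.comp f.toAddMonoidHom))) (fun n => by
            simp only [AddMonoidHom.comp_apply, AddMonoidHom.flip_apply, ← mul_def, lift_of]
            exact h2 n y)) x }

@[simp] theorem map_of (f : N →ₙ+* N') (n : N) : map f (of n) = of (f n) :=
  lift_of (of.comp f.toAddMonoidHom) n

end GrothendieckRing

/-- Extension of scalars of a multiplicative and additive map of rings (not necessarily preserving
the unit) from `ℤ` to a commutative ring `R`. -/
noncomputable def baseChangeMap (R : Type v) [CommRing R] {A B : Type u} [Ring A] [Ring B]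
    (f : A →ₙ+* B) : TensorProduct ℤ R A →ₙ+* TensorProduct ℤ R B :=
  { (LinearMap.lTensor R f.toAddMonoidHom.toIntLinearMap).toAddMonoidHom with
    map_mul' := fun x y => by
      change LinearMap.lTensor R f.toAddMonoidHom.toIntLinearMap (x * y) =
        LinearMap.lTensor R f.toAddMonoidHom.toIntLinearMap x *
          LinearMap.lTensor R f.toAddMonoidHom.toIntLinearMap y
      induction x using TensorProduct.induction_on with
      | zero => simp
      | add x x' hx hx' => rw [add_mul, map_add, map_add, hx, hx', add_mul]
      | tmul r a =>
        induction y using TensorProduct.induction_on with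
        | zero => simp
        | add y y' hy hy' => rw [mul_add, map_add, map_add, hy, hy', mul_add]
        | tmul s b => simp }

theorem baseChangeMap_tmul (R : Type v) [CommRing R] {A B : Type u} [Ring A] [Ring B]
    (f : A →ₙ+* B) (r : R) (a : A) :
    baseChangeMap R f (TensorProduct.tmul ℤ r a) = TensorProduct.tmul ℤ r (f a) := rfl

/-! ### Fusion systems -/

section Image

variable {P : Type u} [Group P]

/-- The image `φ(A)` of a homomorphism `φ : A → B` between subgroups of `P`, as a subgroup
of `P`. -/
def imageOf {A B : Subgroup P} (φ : A →* B) : Subgroup P := (B.subtype.comp φ).range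

theorem imageOf_le {A B : Subgroup P} (φ : A →* B) : imageOf φ ≤ B := by
  rintro _ ⟨a, rfl⟩
  exact (φ a).2

theorem mem_imageOf {A B : Subgroup P} (φ : A →* B) (a : A) : (φ a : P) ∈ imageOf φ := ⟨a, rfl⟩

/-- An injective homomorphism `φ : A → B`, viewed as an isomorphism `A ≃ φ(A)`. -/
noncomputable def imageIso {A B : Subgroup P} (φ : A →* B) (h : Function.Injective φ) :
    A ≃* imageOf φ :=
  MonoidHom.ofInjective (f := B.subtype.comp φ) (B.subtype_injective.comp h)

@[simp] theorem coe_imageIso {A B : Subgroup P} (φ : A →* B) (h : Function.Injective φ) (a : A) :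
    (imageIso φ h a : P) = φ a := rfl

end Image

/-- A (not necessarily saturated) fusion system over a finite `p`-group `S`, where `S` is a subgroup
of an ambient group `P`. The objects are the subgroups of `S`. -/
structure FusionSystem {P : Type u} [Group P] (S : Subgroup P) where
  Hom : (A B : Subgroup P) → Set (A →* B)
  left_le : ∀ {A B : Subgroup P} {φ : A →* B}, φ ∈ Hom A B → A ≤ S
  right_le : ∀ {A B : Subgroup P} {φ : A →* B}, φ ∈ Hom A B → B ≤ S
  injective : ∀ {A B : Subgroup P} {φ : A →* B}, φ ∈ Hom A B → Function.Injective φ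
  comp_mem : ∀ {A B C : Subgroup P} {ψ : B →* C} {φ : A →* B},
    ψ ∈ Hom B C → φ ∈ Hom A B → ψ.comp φ ∈ Hom A C
  conj_mem : ∀ {A B : Subgroup P} (φ : A →* B) (s : P), A ≤ S → B ≤ S → s ∈ S →
    (∀ a : A, (φ a : P) = s * a * s⁻¹) → φ ∈ Hom A B
  imageIso_mem : ∀ {A B : Subgroup P} {φ : A →* B} (h : φ ∈ Hom A B),
    (imageIso φ (injective h)).toMonoidHom ∈ Hom A (imageOf φ)
  imageIso_symm_mem : ∀ {A B : Subgroup P} {φ : A →* B} (h : φ ∈ Hom A B),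
    (imageIso φ (injective h)).symm.toMonoidHom ∈ Hom (imageOf φ) A

namespace FusionSystem

section Basic

variable {P : Type u} [Group P]

/-- The fusion system `F_H(H)` over `H`: its morphisms are the conjugations by elements
of `H`. -/
def inner (H : Subgroup P) : FusionSystem H where
  Hom A B := {φ | A ≤ H ∧ B ≤ H ∧ ∃ h ∈ H, ∀ a : A, (φ a : P) = h * a * h⁻¹}
  left_le h := h.1
  right_le h := h.2.1
  injective := by
    rintro A B φ ⟨_, _, h, _, hφ⟩ a a' e
    have e' : (φ a : P) = φ a' := congrArg Subtype.val e
    rw [hφ, hφ] at e'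
    exact Subtype.ext (mul_left_cancel (mul_right_cancel e'))
  comp_mem := by
    rintro A B C ψ φ ⟨_, hC, h, hh, hψ⟩ ⟨hA, _, k, hk, hφ⟩
    refine ⟨hA, hC, h * k, H.mul_mem hh hk, fun a => ?_⟩
    rw [MonoidHom.comp_apply, hψ, hφ]
    group
  conj_mem φ s hA hB hs hφ := ⟨hA, hB, s, hs, hφ⟩
  imageIso_mem := by
    rintro A B φ ⟨hA, hB, h, hh, hφ⟩
    exact ⟨hA, (imageOf_le φ).trans hB, h, hh, hφ⟩
  imageIso_symm_mem := by
    rintro A B φ ⟨hA, hB, h, hh, hφ⟩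
    refine ⟨(imageOf_le φ).trans hB, hA, h⁻¹, H.inv_mem hh, fun b => ?_⟩
    have key : ∀ (hi : Function.Injective φ) (b : imageOf φ),
        ((imageIso φ hi).symm b : P) = h⁻¹ * b * h⁻¹⁻¹ := by
      intro hi b
      obtain ⟨a, rfl⟩ := (imageIso φ hi).surjective b
      rw [MulEquiv.symm_apply_apply, coe_imageIso, hφ]
      group
    exact key _ b

variable {S S' : Subgroup P} (F : FusionSystem S) (F' : FusionSystem S')

/-- Containment of fusion systems: `F` is a fusion system over a subgroup of the group of `F'`, and
every morphism of `F` is a morphism of `F'`. -/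
structure Le : Prop where
  le : S ≤ S'
  hom_subset : ∀ A B, F.Hom A B ⊆ F'.Hom A B

variable {F F'} in
theorem inner_le {H : Subgroup P} (hH : H ≤ S) : (inner H).Le F :=
  ⟨hH, fun _ _ φ ⟨hA, hB, h, hh, hφ⟩ => F.conj_mem φ h (hA.trans hH) (hB.trans hH) (hH hh) hφ⟩

theorem inclusion_mem {A B : Subgroup P} (h : A ≤ B) (hB : B ≤ S) :
    Subgroup.inclusion h ∈ F.Hom A B :=
  F.conj_mem _ 1 (h.trans hB) hB S.one_mem fun a => by simp

/-- The subgroups `H` and `K` are isomorphic in `F`. -/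
def IsIsomorphic (H K : Subgroup P) : Prop :=
  ∃ e : H ≃* K, e.toMonoidHom ∈ F.Hom H K ∧ e.symm.toMonoidHom ∈ F.Hom K H

/-- `H` is `F`-centric: `H ≤ S`, and `C_S(K) ≤ K` for every `K` isomorphic to `H` in `F`. -/
def IsCentric (H : Subgroup P) : Prop :=
  H ≤ S ∧ ∀ K, F.IsIsomorphic H K → S ⊓ Subgroup.centralizer (K : Set P) ≤ K

/-- `H` is fully `F`-normalized: `H ≤ S`, and `|N_S(K)| ≤ |N_S(H)|` for every `K` isomorphic to `H`
in `F`. -/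
def IsFullyNormalized (H : Subgroup P) : Prop :=
  H ≤ S ∧ ∀ K, F.IsIsomorphic H K →
    Nat.card ↥(S ⊓ Subgroup.normalizer (K : Set P)) ≤
      Nat.card ↥(S ⊓ Subgroup.normalizer (H : Set P))

/-- `Aut_F(S)` as a group of automorphisms of `S`. -/
def autSelf : Subgroup (MulAut S) where
  carrier := {e | e.toMonoidHom ∈ F.Hom S S ∧ e.symm.toMonoidHom ∈ F.Hom S S}
  mul_mem' := fun ⟨h1, h2⟩ ⟨h3, h4⟩ => ⟨F.comp_mem h1 h3, F.comp_mem h4 h2⟩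
  one_mem' := ⟨F.inclusion_mem le_rfl le_rfl, F.inclusion_mem le_rfl le_rfl⟩
  inv_mem' := fun ⟨h1, h2⟩ => ⟨h2, h1⟩

/-- The normalizer `N_φ` of a homomorphism `φ : H → S`: the elements `x` of `N_S(H)` for which there
is `z ∈ N_S(φ(H))` with `φ(x h x⁻¹) = z φ(h) z⁻¹` for all `h ∈ H`. -/
def homNormalizer {S H : Subgroup P} (φ : H →* S) : Subgroup P where
  carrier := {x | x ∈ S ⊓ Subgroup.normalizer (H : Set P) ∧
    ∃ z ∈ S ⊓ Subgroup.normalizer (imageOf φ : Set P),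
      ∀ (h : H) (hx : x * h * x⁻¹ ∈ H), (φ ⟨x * h * x⁻¹, hx⟩ : P) = z * φ h * z⁻¹}
  mul_mem' := by
    rintro x y ⟨hx, z, hz, hφ⟩ ⟨hy, w, hw, hψ⟩
    refine ⟨mul_mem hx hy, z * w, mul_mem hz hw, fun h hh => ?_⟩
    have h1 : y * h * y⁻¹ ∈ H := (Subgroup.mem_normalizer_iff.1 hy.2 h).1 h.2
    have h2 : x * (y * h * y⁻¹) * x⁻¹ ∈ H := (Subgroup.mem_normalizer_iff.1 hx.2 _).1 h1
    have e : (⟨x * y * h * (x * y)⁻¹, hh⟩ : H) = ⟨x * (y * h * y⁻¹) * x⁻¹, h2⟩ :=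
      Subtype.ext (by group)
    rw [e, hφ ⟨_, h1⟩ h2, hψ h h1]
    group
  one_mem' := ⟨one_mem _, 1, one_mem _, fun h hx => by simp⟩
  inv_mem' := by
    rintro x ⟨hx, z, hz, hφ⟩
    refine ⟨inv_mem hx, z⁻¹, inv_mem hz, fun h hh => ?_⟩
    have e : x * (x⁻¹ * h * x⁻¹⁻¹) * x⁻¹ = h := by group
    have h1 := hφ ⟨_, hh⟩ (by rw [e]; exact h.2)
    have e' : (⟨x * (x⁻¹ * h * x⁻¹⁻¹) * x⁻¹, by rw [e]; exact h.2⟩ : H) = h := Subtype.ext e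
    rw [e'] at h1
    rw [h1]
    group

/-- A saturated fusion system over a finite `p`-group. -/
structure IsSaturated (p : ℕ) : Prop where
  /-- `Aut_S(S)` is a Sylow `p`-subgroup of `Aut_F(S)`. -/
  sylow : ∃ Q : Sylow p F.autSelf,
    (Q : Subgroup F.autSelf) = (MulAut.conj (G := S)).range.subgroupOf F.autSelf
  /-- Every `φ : H → S` with `φ(H)` fully normalized extends to `N_φ`. -/
  extend : ∀ (H : Subgroup P), ∀ φ ∈ F.Hom H S, F.IsFullyNormalized (imageOf φ) →
    ∃ ψ ∈ F.Hom (homNormalizer φ) S,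
      ∀ (x : homNormalizer φ) (hx : (x : P) ∈ H), ψ x = φ ⟨x, hx⟩

/-! ### The orbit category and the products `[H × K]` -/

/-- Two morphisms `A → B` are equivalent if they differ by conjugation by an element of `B`. -/
def orbitSetoid (A B : Subgroup P) : Setoid (F.Hom A B) where
  r φ ψ := ∃ b : B, ∀ a : A, ψ.1 a = b * φ.1 a * b⁻¹
  iseqv := by
    refine ⟨fun φ => ⟨1, by simp⟩, ?_, ?_⟩
    · rintro φ ψ ⟨b, h⟩
      refine ⟨b⁻¹, fun a => ?_⟩
      rw [h]
      group
    · rintro φ ψ χ ⟨b, h⟩ ⟨c, h'⟩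
      refine ⟨c * b, fun a => ?_⟩
      rw [h', h]
      group

/-- The morphisms `A → B` of the orbit category of `F`. -/
def OrbitHom (A B : Subgroup P) : Type u := Quotient (F.orbitSetoid A B)

variable {F}

/-- The morphism of the orbit category represented by a morphism of `F`. -/
def OrbitHom.mk {A B : Subgroup P} (φ : A →* B) (h : φ ∈ F.Hom A B) : F.OrbitHom A B :=
  Quotient.mk _ ⟨φ, h⟩

/-- Composition in the orbit category. -/
def OrbitHom.comp {A B C : Subgroup P} (ψ : F.OrbitHom B C) (φ : F.OrbitHom A B) :
    F.OrbitHom A C :=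
  Quotient.map₂ (fun ψ φ => ⟨ψ.1.comp φ.1, F.comp_mem ψ.2 φ.2⟩) (by
    rintro ψ ψ' ⟨c, h⟩ φ φ' ⟨b, h'⟩
    refine ⟨c * ψ.1 b, fun a => ?_⟩
    simp only [MonoidHom.comp_apply, h, h', map_mul, map_inv]
    group) ψ φ

/-- The conjugate `A^h = h⁻¹ A h`. -/
def conjBy (A : Subgroup P) (h : P) : Subgroup P := A.map (MulAut.conj h⁻¹).toMonoidHom

/-- The conjugation `c_h : A^h → A`, `x ↦ h x h⁻¹`. -/
def conjHom (A : Subgroup P) (h : P) : conjBy A h →* A where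
  toFun x := ⟨h * x * h⁻¹, by
    obtain ⟨_, a, ha, rfl⟩ := x
    simpa [mul_assoc] using ha⟩
  map_one' := Subtype.ext (by simp)
  map_mul' x y := Subtype.ext (by simp [mul_assoc])

theorem conjBy_le {A H : Subgroup P} (hA : A ≤ H) {h : P} (hh : h ∈ H) : conjBy A h ≤ H := by
  rintro _ ⟨a, ha, rfl⟩
  exact H.mul_mem (H.mul_mem (H.inv_mem hh) (hA ha)) (H.inv_mem (H.inv_mem hh))

theorem conjHom_mem {A : Subgroup P} (hA : A ≤ S) {h : P} (hh : h ∈ S) :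
    conjHom A h ∈ F.Hom (conjBy A h) A :=
  F.conj_mem _ h (conjBy_le hA hh) hA hh fun _ => rfl

variable (F)

/-- A pair `(A, φ̄)` of an `F`-centric subgroup `A ≤ H` and a morphism `φ̄ : A → K` of the orbit
category of `F`. -/
structure ProdPair (H K : Subgroup P) where
  A : Subgroup P
  le : A ≤ H
  centric : F.IsCentric A
  hom : F.OrbitHom A K

variable {F}

/-- The preorder `(A, φ̄) ≾ (B, ψ̄)`: there is `h ∈ H` with `A^h ≤ B` and `φ̄ c̄_h = ψ̄ ῑ`. -/
def ProdPair.Precedes {H K : Subgroup P} (hH : H ≤ S) (x y : F.ProdPair H K) : Prop :=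
  ∃ (h : P) (hh : h ∈ H) (hle : conjBy x.A h ≤ y.A),
    x.hom.comp (OrbitHom.mk (conjHom x.A h) (conjHom_mem x.centric.1 (hH hh))) =
      y.hom.comp (OrbitHom.mk (Subgroup.inclusion hle) (F.inclusion_mem hle y.centric.1))

/-- `(A, φ̄)` is maximal for the preorder. -/
def ProdPair.IsMaximal {H K : Subgroup P} (hH : H ≤ S) (x : F.ProdPair H K) : Prop :=
  ∀ y, x.Precedes hH y → y.Precedes hH x

variable (F) in
/-- `Q` is a choice of the set `[H ×_F K]`: it consists of maximal pairs, and contains exactly one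
representative of each equivalence class of maximal pairs. -/
def IsProduct {H K : Subgroup P} (hH : H ≤ S) (Q : Set (F.ProdPair H K)) : Prop :=
  (∀ x ∈ Q, x.IsMaximal hH) ∧
    ∀ y : F.ProdPair H K, y.IsMaximal hH → ∃! x, x ∈ Q ∧ x.Precedes hH y ∧ y.Precedes hH x

end Basic

end FusionSystem

/-! ### The Mackey algebra of a fusion system -/

section MapSub

variable {P : Type u} [Group P] {H K : Subgroup P} (φ : H ≃* K)

/-- The restriction of `φ : H ≃ K` to a subgroup `A ≤ H`. -/
def restrictTo (A : {A : Subgroup P // A ≤ H}) : A.1 →* K :=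
  φ.toMonoidHom.comp (Subgroup.inclusion A.2)

theorem restrictTo_injective (A : {A : Subgroup P // A ≤ H}) :
    Function.Injective (restrictTo φ A) :=
  φ.injective.comp (Subgroup.inclusion_injective A.2)

/-- The subgroup `φ(A)` of `P`. -/
def mapSub (A : {A : Subgroup P // A ≤ H}) : Subgroup P := imageOf (restrictTo φ A)

/-- The isomorphism `A ≃ φ(A)`. -/
noncomputable def mapSubIso (A : {A : Subgroup P // A ≤ H}) : A.1 ≃* mapSub φ A :=
  imageIso (restrictTo φ A) (restrictTo_injective φ A)

theorem coe_mapSubIso (A : {A : Subgroup P // A ≤ H}) (a : A.1) :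
    (mapSubIso φ A a : P) = φ ⟨a, A.2 a.2⟩ := rfl

theorem mapSub_le (A : {A : Subgroup P // A ≤ H}) : mapSub φ A ≤ K := imageOf_le _

theorem mapSub_mono {A B : {A : Subgroup P // A ≤ H}} (h : A.1 ≤ B.1) :
    mapSub φ A ≤ mapSub φ B := by
  rintro _ ⟨a, rfl⟩
  exact ⟨⟨a, h a.2⟩, rfl⟩

theorem mapSub_injective : Function.Injective (mapSub φ) := by
  have key : ∀ A B, mapSub φ A ≤ mapSub φ B → A.1 ≤ B.1 := by
    intro A B h a ha
    obtain ⟨b, hb⟩ := h ⟨⟨a, ha⟩, rfl⟩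
    have h1 : φ ⟨b, B.2 b.2⟩ = φ ⟨a, A.2 ha⟩ := Subtype.ext hb
    have h2 := congrArg Subtype.val (φ.injective h1)
    change (b : P) = a at h2
    rw [← h2]
    exact b.2
  exact fun A B h => Subtype.ext (le_antisymm (key A B h.le) (key B A h.ge))

theorem mapSub_surjective {B : Subgroup P} (hB : B ≤ K) : ∃ A, mapSub φ A = B := by
  refine ⟨⟨mapSub φ.symm ⟨B, hB⟩, mapSub_le _ _⟩, ?_⟩
  apply le_antisymm
  · rintro _ ⟨⟨_, b, rfl⟩, rfl⟩
    change (φ (φ.symm ⟨b, hB b.2⟩) : P) ∈ B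
    rw [MulEquiv.apply_symm_apply]
    exact b.2
  · intro b hb
    refine ⟨⟨φ.symm ⟨b, hB hb⟩, ⟨b, hb⟩, rfl⟩, ?_⟩
    change (φ (φ.symm ⟨b, hB hb⟩) : P) = b
    rw [MulEquiv.apply_symm_apply]

end MapSub

section Mackey

variable {P : Type u} [Group P] [Finite P]

/-- The finite set of subgroups of `H`. -/
noncomputable def subgroupsLe (H : Subgroup P) : Finset {A : Subgroup P // A ≤ H} :=
  (Set.toFinite (Set.univ : Set {A : Subgroup P // A ≤ H})).toFinset

theorem mem_subgroupsLe {H : Subgroup P} (A : {A : Subgroup P // A ≤ H}) :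
    A ∈ subgroupsLe H := by
  simp [subgroupsLe]

/-- The class of the restriction biset `R_H^K = (H × K) / Δ(H, Id)`. -/
noncomputable def resClass {H K : Subgroup P} (h : H ≤ K) : BisetClass H K :=
  BisetClass.ofHoms (MonoidHom.id H) (Subgroup.inclusion h)

/-- The class of the induction biset `I_H^K = (K × H) / Δ(H, Id)`. -/
noncomputable def indClass {H K : Subgroup P} (h : H ≤ K) : BisetClass K H :=
  BisetClass.ofHoms (Subgroup.inclusion h) (MonoidHom.id H)

/-- The class of the conjugation biset `c_φ = (K × H) / Δ(H, φ)` of an isomorphism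
`φ : H ≃ K`. -/
noncomputable def conjClass {H K : Subgroup P} (φ : H ≃* K) : BisetClass K H :=
  BisetClass.ofHoms φ.toMonoidHom (MonoidHom.id H)

namespace FusionSystem

variable {S S' : Subgroup P} (F : FusionSystem S) (F' : FusionSystem S')

/-- The biset classes `I_H^K`, `R_H^K` (for `H ≤ K ≤ S`) and `c_φ` (for `φ` an isomorphism
in `F`). -/
inductive MackeyGenerator : BisetSemiring P → Prop
  | ind {H K : Subgroup P} (h : H ≤ K) (hK : K ≤ S) :
    MackeyGenerator (BisetSemiring.single K H (indClass h))
  | res {H K : Subgroup P} (h : H ≤ K) (hK : K ≤ S) :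
    MackeyGenerator (BisetSemiring.single H K (resClass h))
  | conj {H K : Subgroup P} (φ : H ≃* K) (hφ : φ.toMonoidHom ∈ F.Hom H K) :
    MackeyGenerator (BisetSemiring.single K H (conjClass φ))

/-- The semiring generated by the classes `I_H^K`, `R_H^K` and `c_φ`. -/
noncomputable def mackeySemiring : NonUnitalSubsemiring (BisetSemiring P) :=
  NonUnitalSubsemiring.closure {x | F.MackeyGenerator x}

/-- The unit `∑ I_A^A` over the subgroups `A ≤ S`. -/
noncomputable def unitElement (S : Subgroup P) : BisetSemiring P :=
  ∑ A ∈ subgroupsLe S, BisetSemiring.single A.1 A.1 (indClass (le_refl A.1))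

theorem indClass_self (A : Subgroup P) :
    indClass (le_refl A) = BisetClass.ofHoms (MonoidHom.id A) (MonoidHom.id A) := rfl

theorem unitElement_mul_single {A : Subgroup P} (hA : A ≤ S) (B : Subgroup P)
    (x : BisetClass A B) :
    unitElement S * BisetSemiring.single A B x = BisetSemiring.single A B x := by
  rw [unitElement, Finset.sum_mul, Finset.sum_eq_single ⟨A, hA⟩]
  · rw [BisetSemiring.single_mul_single, indClass_self, BisetClass.id_mul']
  · intro C _ hC
    exact BisetSemiring.single_mul_single_ne _ _ (fun e => hC (Subtype.ext e)) _ _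
  · exact fun h => (h (mem_subgroupsLe _)).elim

theorem single_mul_unitElement (A : Subgroup P) {B : Subgroup P} (hB : B ≤ S)
    (x : BisetClass A B) :
    BisetSemiring.single A B x * unitElement S = BisetSemiring.single A B x := by
  rw [unitElement, Finset.mul_sum, Finset.sum_eq_single ⟨B, hB⟩]
  · rw [BisetSemiring.single_mul_single, indClass_self, BisetClass.mul_id']
  · intro C _ hC
    exact BisetSemiring.single_mul_single_ne _ _ (fun e => hC (Subtype.ext e.symm)) _ _
  · exact fun h => (h (mem_subgroupsLe _)).elim

theorem unitElement_mem : unitElement S ∈ F.mackeySemiring :=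
  sum_mem fun A _ => NonUnitalSubsemiring.subset_closure (MackeyGenerator.ind le_rfl A.2)

variable {F} in
theorem unitElement_mul {x : BisetSemiring P} (hx : x ∈ F.mackeySemiring) :
    unitElement S * x = x := by
  induction hx using NonUnitalSubsemiring.closure_induction with
  | mem x hx =>
    cases hx with
    | ind h hK => exact unitElement_mul_single hK _ _
    | res h hK => exact unitElement_mul_single (h.trans hK) _ _
    | conj φ hφ => exact unitElement_mul_single (F.right_le hφ) _ _
  | zero => exact mul_zero _
  | add x y _ _ hx hy => rw [mul_add, hx, hy]
  | mul x y _ _ hx hy => rw [← mul_assoc, hx]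

variable {F} in
theorem mul_unitElement {x : BisetSemiring P} (hx : x ∈ F.mackeySemiring) :
    x * unitElement S = x := by
  induction hx using NonUnitalSubsemiring.closure_induction with
  | mem x hx =>
    cases hx with
    | ind h hK => exact single_mul_unitElement _ (h.trans hK) _
    | res h hK => exact single_mul_unitElement _ hK _
    | conj φ hφ => exact single_mul_unitElement _ (F.left_le hφ) _
  | zero => exact zero_mul _
  | add x y _ _ hx hy => rw [add_mul, hx, hy]
  | mul x y _ _ hx hy => rw [mul_assoc, hy]

noncomputable instance : Semiring F.mackeySemiring :=
  { (inferInstance : NonUnitalSemiring F.mackeySemiring) with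
    one := ⟨unitElement S, F.unitElement_mem⟩
    one_mul := fun x => Subtype.ext (unitElement_mul x.2)
    mul_one := fun x => Subtype.ext (mul_unitElement x.2) }

theorem coe_one_mackeySemiring : ((1 : F.mackeySemiring) : BisetSemiring P) = unitElement S := rfl

variable {F F'} in
theorem mackeySemiring_mono (h : F.Le F') : F.mackeySemiring ≤ F'.mackeySemiring := by
  refine NonUnitalSubsemiring.closure_mono ?_
  intro x hx
  cases hx with
  | ind h' hK => exact .ind h' (hK.trans h.le)
  | res h' hK => exact .res h' (hK.trans h.le)
  | conj φ hφ => exact .conj φ (h.hom_subset _ _ hφ)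

/-! #### Conjugation by a group isomorphism -/

section Twist

variable {H K : Subgroup P} (φ : H ≃* K)

/-- Transport along `φ : H ≃ K`: an `(A, B)`-biset with `A, B ≤ H` is sent to the
`(φ(A), φ(B))`-biset with the same underlying set. -/
noncomputable def twist : BisetSemiring P →+ BisetSemiring P where
  toFun x := ∑ A ∈ subgroupsLe H, ∑ B ∈ subgroupsLe H,
    BisetSemiring.single (mapSub φ A) (mapSub φ B)
      (BisetClass.push (mapSubIso φ A) (mapSubIso φ B) (x A.1 B.1))
  map_zero' := by simp [BisetSemiring.zero_apply]
  map_add' x y := by simp [BisetSemiring.add_apply, Finset.sum_add_distrib]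

theorem twist_apply (x : BisetSemiring P) :
    twist φ x = ∑ A ∈ subgroupsLe H, ∑ B ∈ subgroupsLe H,
      BisetSemiring.single (mapSub φ A) (mapSub φ B)
        (BisetClass.push (mapSubIso φ A) (mapSubIso φ B) (x A.1 B.1)) := rfl

theorem twist_single (A B : {A : Subgroup P // A ≤ H}) (x : BisetClass A.1 B.1) :
    twist φ (BisetSemiring.single A.1 B.1 x) =
      BisetSemiring.single (mapSub φ A) (mapSub φ B)
        (BisetClass.push (mapSubIso φ A) (mapSubIso φ B) x) := by
  rw [twist_apply, Finset.sum_eq_single A, Finset.sum_eq_single B, BisetSemiring.single_same]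
  · intro B' _ hB
    rw [BisetSemiring.single_ne_right _ _ (fun e => hB (Subtype.ext e)), map_zero, map_zero]
  · exact fun h => (h (mem_subgroupsLe B)).elim
  · intro A' _ hA
    refine Finset.sum_eq_zero fun B' _ => ?_
    rw [BisetSemiring.single_ne_left _ _ (fun e => hA (Subtype.ext e)), map_zero, map_zero]
  · exact fun h => (h (mem_subgroupsLe A)).elim

theorem twist_mul_of (x y : BisetSemiring P) (hx : ∀ A B, ¬ B ≤ H → x A B = 0) :
    twist φ (x * y) = twist φ x * twist φ y := by
  have h1 : ∀ A C : {A : Subgroup P // A ≤ H}, (x * y) A.1 C.1 =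
      ∑ B ∈ subgroupsLe H, (x A.1 B.1).mul (y B.1 C.1) := by
    intro A C
    rw [BisetSemiring.mul_apply]
    symm
    refine Finset.sum_of_injOn (fun B => B.1) Subtype.val_injective.injOn
      (fun B _ => BisetSemiring.mem_subgroups _) ?_ (fun _ _ => rfl)
    intro B _ hB
    rw [hx, BisetClass.zero_mul']
    exact fun h => hB ⟨⟨B, h⟩, mem_subgroupsLe _, rfl⟩
  have h2 : ∀ A C : {A : Subgroup P // A ≤ H},
      ∑ B ∈ subgroupsLe H, ∑ B' ∈ subgroupsLe H,
        BisetSemiring.single (mapSub φ A) (mapSub φ B)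
          (BisetClass.push (mapSubIso φ A) (mapSubIso φ B) (x A.1 B.1)) *
        BisetSemiring.single (mapSub φ B') (mapSub φ C)
          (BisetClass.push (mapSubIso φ B') (mapSubIso φ C) (y B'.1 C.1)) =
      BisetSemiring.single (mapSub φ A) (mapSub φ C)
        (BisetClass.push (mapSubIso φ A) (mapSubIso φ C) ((x * y) A.1 C.1)) := by
    intro A C
    rw [h1, map_sum, map_sum]
    refine Finset.sum_congr rfl fun B _ => ?_
    rw [Finset.sum_eq_single B]
    · rw [BisetSemiring.single_mul_single, BisetClass.push_mul _ (mapSubIso φ B)]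
    · intro B' _ hB
      exact BisetSemiring.single_mul_single_ne _ _ (fun e => hB (mapSub_injective φ e.symm)) _ _
    · exact fun h => (h (mem_subgroupsLe _)).elim
  rw [twist_apply φ x, twist_apply φ y, twist_apply, Finset.sum_mul]
  refine Finset.sum_congr rfl fun A _ => ?_
  simp only [← h2]
  rw [Finset.sum_mul, Finset.sum_comm]
  refine Finset.sum_congr rfl fun B _ => ?_
  rw [Finset.mul_sum, Finset.sum_comm]
  refine Finset.sum_congr rfl fun B' _ => ?_
  rw [Finset.mul_sum]

theorem twist_unitElement : twist φ (unitElement H) = unitElement K := by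
  rw [unitElement, map_sum, unitElement]
  refine Finset.sum_bij (fun A _ => ⟨mapSub φ A, mapSub_le φ A⟩) (fun _ _ => mem_subgroupsLe _)
    (fun A _ B _ e => mapSub_injective φ (congrArg Subtype.val e)) ?_ ?_
  · rintro ⟨B, hB⟩ _
    obtain ⟨A, rfl⟩ := mapSub_surjective φ hB
    exact ⟨A, mem_subgroupsLe _, rfl⟩
  · intro A _
    rw [twist_single]
    congr 1
    exact BisetClass.push_ofHoms _ _ _ _ _ _ (mapSubIso φ A) (fun _ => rfl) (fun _ => rfl)

variable {F} in
theorem apply_eq_zero_of_mem {x : BisetSemiring P} (hx : x ∈ F.mackeySemiring) (A : Subgroup P)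
    {B : Subgroup P} (hB : ¬ B ≤ S) : x A B = 0 := by
  induction hx using NonUnitalSubsemiring.closure_induction generalizing A with
  | mem x hx =>
    cases hx with
    | @ind C D h hD =>
      exact BisetSemiring.single_ne_right _ _ (fun e => hB (e.le.trans (h.trans hD))) _
    | @res C D h hD => exact BisetSemiring.single_ne_right _ _ (fun e => hB (e.le.trans hD)) _
    | conj ψ hψ =>
      exact BisetSemiring.single_ne_right _ _ (fun e => hB (e.le.trans (F.left_le hψ))) _
  | zero => rfl
  | add x y _ _ hx hy => rw [BisetSemiring.add_apply, hx, hy, add_zero]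
  | mul x y _ _ _ hy =>
    rw [BisetSemiring.mul_apply]
    exact Finset.sum_eq_zero fun C _ => by rw [hy, BisetClass.mul_zero']

theorem twist_mem {x : BisetSemiring P} (hx : x ∈ (inner H).mackeySemiring) :
    twist φ x ∈ (inner K).mackeySemiring := by
  induction hx using NonUnitalSubsemiring.closure_induction with
  | mem x hx =>
    refine NonUnitalSubsemiring.subset_closure ?_
    cases hx with
    | @ind A B h hB =>
      have e : twist φ (BisetSemiring.single B A (indClass h)) =
          BisetSemiring.single (mapSub φ ⟨B, hB⟩) (mapSub φ ⟨A, h.trans hB⟩)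
            (indClass (mapSub_mono φ h)) := by
        refine (twist_single φ ⟨B, hB⟩ ⟨A, h.trans hB⟩ _).trans ?_
        congr 1
        exact BisetClass.push_ofHoms _ _ _ _ _ _ (mapSubIso φ ⟨A, h.trans hB⟩) (fun _ => rfl)
          (fun _ => rfl)
      rw [e]
      exact .ind _ (mapSub_le φ _)
    | @res A B h hB =>
      have e : twist φ (BisetSemiring.single A B (resClass h)) =
          BisetSemiring.single (mapSub φ ⟨A, h.trans hB⟩) (mapSub φ ⟨B, hB⟩)
            (resClass (mapSub_mono φ h)) := by
        refine (twist_single φ ⟨A, h.trans hB⟩ ⟨B, hB⟩ _).trans ?_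
        congr 1
        exact BisetClass.push_ofHoms _ _ _ _ _ _ (mapSubIso φ ⟨A, h.trans hB⟩) (fun _ => rfl)
          (fun _ => rfl)
      rw [e]
      exact .res _ (mapSub_le φ _)
    | @conj A B ψ hψ =>
      have hA : A ≤ H := (inner H).left_le hψ
      have hB : B ≤ H := (inner H).right_le hψ
      let ψ' : mapSub φ ⟨A, hA⟩ ≃* mapSub φ ⟨B, hB⟩ :=
        ((mapSubIso φ ⟨A, hA⟩).symm.trans ψ).trans (mapSubIso φ ⟨B, hB⟩)
      have e : twist φ (BisetSemiring.single B A (conjClass ψ)) =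
          BisetSemiring.single (mapSub φ ⟨B, hB⟩) (mapSub φ ⟨A, hA⟩) (conjClass ψ') := by
        refine (twist_single φ ⟨B, hB⟩ ⟨A, hA⟩ _).trans ?_
        congr 1
        refine BisetClass.push_ofHoms _ _ _ _ _ _ (mapSubIso φ ⟨A, hA⟩) (fun x => ?_)
          (fun _ => rfl)
        change mapSubIso φ ⟨B, hB⟩ (ψ ((mapSubIso φ ⟨A, hA⟩).symm (mapSubIso φ ⟨A, hA⟩ x))) = _
        rw [MulEquiv.symm_apply_apply]
        rfl
      rw [e]
      refine .conj ψ' ?_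
      obtain ⟨_, _, h, hh, hψ⟩ := hψ
      refine ⟨mapSub_le φ _, mapSub_le φ _, φ ⟨h, hh⟩, (φ ⟨h, hh⟩).2, fun a => ?_⟩
      obtain ⟨a, rfl⟩ := (mapSubIso φ ⟨A, hA⟩).surjective a
      change (mapSubIso φ ⟨B, hB⟩ (ψ ((mapSubIso φ ⟨A, hA⟩).symm
        (mapSubIso φ ⟨A, hA⟩ a))) : P) = _
      rw [MulEquiv.symm_apply_apply, coe_mapSubIso, coe_mapSubIso]
      have e1 : (⟨ψ a, hB (ψ a).2⟩ : H) = ⟨h, hh⟩ * ⟨a, hA a.2⟩ * (⟨h, hh⟩)⁻¹ :=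
        Subtype.ext (hψ a)
      rw [e1, map_mul, map_mul, map_inv]
      rfl
  | zero => rw [map_zero]; exact zero_mem _
  | add x y _ _ hx hy => rw [map_add]; exact add_mem hx hy
  | mul x y hx' hy' hx hy =>
    rw [twist_mul_of φ x y (fun A B hB => apply_eq_zero_of_mem hx' A hB)]
    exact mul_mem hx hy

/-- The homomorphism from the Mackey semiring of `F_H(H)` to that of `F_K(K)` given by transport
along an isomorphism `φ : H ≃ K` of groups. -/
noncomputable def twistHom : (inner H).mackeySemiring →+* (inner K).mackeySemiring where
  toFun x := ⟨twist φ x.1, twist_mem φ x.2⟩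
  map_one' := Subtype.ext (twist_unitElement φ)
  map_mul' x y := Subtype.ext
    (twist_mul_of φ x.1 y.1 (fun A _ hB => apply_eq_zero_of_mem x.2 A hB))
  map_zero' := Subtype.ext (map_zero (twist φ))
  map_add' x y := Subtype.ext (map_add (twist φ) x.1 y.1)

end Twist

end FusionSystem

end Mackey

/-! ### Restriction and induction along a map of rings that need not preserve the unit -/

section Corner

variable {A : Type v} {B : Type w} [Ring A] [Ring B]

/-- For `f : A → B` additive and multiplicative, the restriction of a `B`-module `M` is the
`A`-module `f(1) M`. -/
def CornerRes (f : A →ₙ+* B) (M : Type*) [AddCommGroup M] [Module B M] : Type _ :=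
  (DistribSMul.toAddMonoidHom M (f 1)).range

namespace CornerRes

variable (f : A →ₙ+* B) (M : Type*) [AddCommGroup M] [Module B M]

instance : AddCommGroup (CornerRes f M) :=
  inferInstanceAs (AddCommGroup (DistribSMul.toAddMonoidHom M (f 1)).range)

variable {f M}

/-- The inclusion of `f(1) M` in `M`. -/
def val (x : CornerRes f M) : M := Subtype.val x

theorem ext {x y : CornerRes f M} (h : x.val = y.val) : x = y := Subtype.ext h

theorem map_one_smul_val (x : CornerRes f M) : f 1 • x.val = x.val := by
  obtain ⟨_, m, rfl⟩ := x
  change f 1 • f 1 • m = f 1 • m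
  rw [smul_smul, ← map_mul, one_mul]

instance : SMul A (CornerRes f M) :=
  ⟨fun a x => ⟨f a • x.val, f a • x.val, by
    change f 1 • f a • x.val = _
    rw [smul_smul, ← map_mul, one_mul]⟩⟩

theorem val_smul (a : A) (x : CornerRes f M) : (a • x).val = f a • x.val := rfl

theorem val_add (x y : CornerRes f M) : (x + y).val = x.val + y.val := rfl

theorem val_zero : (0 : CornerRes f M).val = 0 := rfl

instance : Module A (CornerRes f M) where
  one_smul x := ext (map_one_smul_val x)
  mul_smul a b x := ext (by rw [val_smul, val_smul, val_smul, map_mul, mul_smul])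
  smul_zero a := ext (by rw [val_smul, val_zero, smul_zero])
  smul_add a x y := ext (by
    rw [val_smul, val_add, val_add, val_smul, val_smul, smul_add])
  add_smul a b x := ext (by
    rw [val_smul, val_add, val_smul, val_smul, map_add, add_smul])
  zero_smul x := ext (by rw [val_smul, val_zero, map_zero, zero_smul])

end CornerRes

/-- The left ideal `B f(1)`. -/
def cornerIdeal (f : A →ₙ+* B) : Ideal B := Ideal.span {f 1}

theorem mul_map_mem_cornerIdeal (f : A →ₙ+* B) (b : B) (a : A) : b * f a ∈ cornerIdeal f := by
  rw [cornerIdeal, Ideal.mem_span_singleton']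
  exact ⟨b * f a, by rw [mul_assoc, ← map_mul, mul_one]⟩

/-- The right action of `a : A` on `B f(1)`. -/
def cornerMul (f : A →ₙ+* B) (x : cornerIdeal f) (a : A) : cornerIdeal f :=
  ⟨x * f a, mul_map_mem_cornerIdeal f x a⟩

/-- The relations `x a ⊗ n - x ⊗ a n` on `B f(1) ⊗_ℤ N`. -/
def balancedRel (f : A →ₙ+* B) (N : Type*) [AddCommGroup N] [Module A N] :
    Submodule B (TensorProduct ℤ (cornerIdeal f) N) :=
  Submodule.span B {t | ∃ (x : cornerIdeal f) (a : A) (n : N),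
    t = TensorProduct.tmul ℤ (cornerMul f x a) n - TensorProduct.tmul ℤ x (a • n)}

/-- For `f : A → B` additive and multiplicative, the induction of an `A`-module `N` is the
`B`-module `B f(1) ⊗_A N`. -/
def CornerInd (f : A →ₙ+* B) (N : Type*) [AddCommGroup N] [Module A N] : Type _ :=
  TensorProduct ℤ (cornerIdeal f) N ⧸ balancedRel f N

namespace CornerInd

variable (f : A →ₙ+* B) (N : Type*) [AddCommGroup N] [Module A N]

noncomputable instance : AddCommGroup (CornerInd f N) :=
  inferInstanceAs (AddCommGroup (TensorProduct ℤ (cornerIdeal f) N ⧸ balancedRel f N))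

noncomputable instance : Module B (CornerInd f N) :=
  inferInstanceAs (Module B (TensorProduct ℤ (cornerIdeal f) N ⧸ balancedRel f N))

variable {N}

/-- The element `b f(1) ⊗ n` of `B f(1) ⊗_A N`; it is `b ⊗ n` if `b ∈ B f(1)`. -/
noncomputable def tmul (b : B) (n : N) : CornerInd f N :=
  (balancedRel f N).mkQ
    (TensorProduct.tmul ℤ (⟨b * f 1, mul_map_mem_cornerIdeal f b 1⟩ : cornerIdeal f) n)

end CornerInd

end Corner

/-! ### Mackey functors over fusion systems -/

section MackeyFunctor

variable (R : Type v) [CommRing R] {P : Type u} [Group P] [Finite P]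

open FusionSystem

/-- The Mackey algebra `μ_R(F)` of the fusion system `F` over the commutative ring `R`. -/
def MackeyAlgebra {S : Subgroup P} (F : FusionSystem S) : Type (max v (u + 1)) :=
  TensorProduct ℤ R (GrothendieckRing F.mackeySemiring)

namespace MackeyAlgebra

variable {S S' : Subgroup P} (F : FusionSystem S)

noncomputable instance : Ring (MackeyAlgebra R F) :=
  inferInstanceAs (Ring (TensorProduct ℤ R (GrothendieckRing F.mackeySemiring)))

noncomputable instance : Algebra R (MackeyAlgebra R F) :=
  inferInstanceAs (Algebra R (TensorProduct ℤ R (GrothendieckRing F.mackeySemiring)))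

/-- The element of the Mackey algebra given by an element of the Mackey semiring. -/
noncomputable def of (x : F.mackeySemiring) : MackeyAlgebra R F :=
  TensorProduct.tmul ℤ (1 : R) (GrothendieckRing.of x)

/-- The element `I_H^K` of the Mackey algebra, for `H ≤ K ≤ S`. -/
noncomputable def ind {H K : Subgroup P} (h : H ≤ K) (hK : K ≤ S) : MackeyAlgebra R F :=
  of R F ⟨_, NonUnitalSubsemiring.subset_closure (.ind h hK)⟩

/-- The element `R_H^K` of the Mackey algebra, for `H ≤ K ≤ S`. -/
noncomputable def res {H K : Subgroup P} (h : H ≤ K) (hK : K ≤ S) : MackeyAlgebra R F :=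
  of R F ⟨_, NonUnitalSubsemiring.subset_closure (.res h hK)⟩

/-- The element `c_φ` of the Mackey algebra, for an isomorphism `φ : H ≃ K` in `F`. -/
noncomputable def conj {H K : Subgroup P} (φ : H ≃* K) (hφ : φ.toMonoidHom ∈ F.Hom H K) :
    MackeyAlgebra R F :=
  of R F ⟨_, NonUnitalSubsemiring.subset_closure (.conj φ hφ)⟩

/-- The element `I_{θ(C)}^J c_θ` of the Mackey algebra, for a morphism `θ : C → J` in `F`. -/
noncomputable def indConj {C J : Subgroup P} (θ : C →* J) (hθ : θ ∈ F.Hom C J) :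
    MackeyAlgebra R F :=
  ind R F (imageOf_le θ) (F.right_le hθ) *
    conj R F (imageIso θ (F.injective hθ)) (F.imageIso_mem hθ)

variable {F} {F' : FusionSystem S'}

/-- The natural map `μ_R(F) → μ_R(F')` for a fusion system `F` contained in `F'`. -/
noncomputable def incl (h : F.Le F') : MackeyAlgebra R F →ₙ+* MackeyAlgebra R F' :=
  baseChangeMap R (GrothendieckRing.map (NonUnitalSubsemiring.inclusion (mackeySemiring_mono h)))

/-- The ring homomorphism `φ̂ : μ_R(F_H(H)) → μ_R(F_K(K))` induced by an isomorphism of groups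
`φ : H ≃ K`. It sends the class of an `(A, B)`-biset to its transport to a
`(φ(A), φ(B))`-biset. -/
noncomputable def hat {H K : Subgroup P} (φ : H ≃* K) :
    MackeyAlgebra R (inner H) →+* MackeyAlgebra R (inner K) :=
  { baseChangeMap R (GrothendieckRing.map ((twistHom φ : (inner H).mackeySemiring →+*
      (inner K).mackeySemiring) : (inner H).mackeySemiring →ₙ+* (inner K).mackeySemiring)) with
    map_one' := by
      refine (baseChangeMap_tmul R _ 1 1).trans ?_
      rw [GrothendieckRing.one_def, GrothendieckRing.map_of]
      exact congrArg (fun x => TensorProduct.tmul ℤ (1 : R) (GrothendieckRing.of x))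
        (map_one (twistHom φ)) }

end MackeyAlgebra

variable {S S' T : Subgroup P} {F : FusionSystem S} {F' : FusionSystem S'}

/-- The restriction `M↓` of a module over `μ_R(F')` to a fusion system `F` contained in `F'`. -/
abbrev MackeyRestrict (h : F.Le F') (M : Type*) [AddCommGroup M] [Module (MackeyAlgebra R F') M] :
    Type _ := CornerRes (MackeyAlgebra.incl R h) M

/-- The induction `N↑` of a module over `μ_R(F)` to a fusion system `F'` containing `F`. -/
abbrev MackeyInduce (h : F.Le F') (N : Type*) [AddCommGroup N] [Module (MackeyAlgebra R F) N] :
    Type _ := CornerInd (MackeyAlgebra.incl R h) N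

/-- The conjugate `^φ L` of a module `L` over `μ_R(F_H(H))` by an isomorphism of groups `φ : H ≃ K`:
the same abelian group, on which `μ_R(F_K(K))` acts through the homomorphism induced by `φ⁻¹`. -/
@[nolint unusedArguments]
def MackeyConj {H K : Subgroup P} (_φ : H ≃* K) (L : Type w) : Type w := L

namespace MackeyConj

variable {H K : Subgroup P} (φ : H ≃* K) (L : Type w) [AddCommGroup L]

instance : AddCommGroup (MackeyConj φ L) := inferInstanceAs (AddCommGroup L)

noncomputable instance [Module (MackeyAlgebra R (inner H)) L] :
    Module (MackeyAlgebra R (inner K)) (MackeyConj φ L) :=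
  Module.compHom L (MackeyAlgebra.hat R φ.symm)

variable {φ L}

/-- An element of `^φ L`, seen as an element of `L`. -/
def val (x : MackeyConj φ L) : L := x

end MackeyConj

/-- For `M` a module over `μ_R(F_H(H))`, a subgroup `A ≤ H` and an injective homomorphism
`φ : A → K`, the module `^φ(M↓_{F_A(A)})` over `μ_R(F_{φ(A)}(φ(A)))`. -/
abbrev MackeyConjRestrict {A H K : Subgroup P} (hA : A ≤ H) (φ : A →* K)
    (hφ : Function.Injective φ) (M : Type w) [AddCommGroup M]
    [Module (MackeyAlgebra R (inner H)) M] : Type w :=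
  MackeyConj (imageIso φ hφ) (MackeyRestrict R (inner_le (F := inner H) hA) M)

/-- `M` is a `G`-centric Mackey functor over `F` on `R`: it is finitely generated over `μ_R(F)`, and
`I_J^J M = 0` for every `J ≤ S` that is not `G`-centric. -/
structure IsCentricMackeyFunctor (F : FusionSystem S) (G : FusionSystem T) (M : Type*)
    [AddCommGroup M] [Module (MackeyAlgebra R F) M] : Prop where
  finite : Module.Finite (MackeyAlgebra R F) M
  ind_smul_eq_zero : ∀ (J : Subgroup P) (hJ : J ≤ S), ¬ G.IsCentric J →
    ∀ x : M, MackeyAlgebra.ind R F (le_refl J) hJ • x = 0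

/-- The preimage `φ⁻¹(C)` of `C ≤ P` under `φ : A → K`, as a subgroup of `P`. -/
def preimageOf {P : Type u} [Group P] {A K : Subgroup P} (φ : A →* K) (C : Subgroup P) :
    Subgroup P :=
  (C.comap (K.subtype.comp φ)).map A.subtype

section CompRestrict

variable {P : Type u} [Group P] {A K C J : Subgroup P}

theorem preimageOf_le (φ : A →* K) (C : Subgroup P) : preimageOf φ C ≤ A := by
  rintro _ ⟨a, _, rfl⟩
  exact a.2

/-- The restriction `φ⁻¹(C) → C` of `φ : A → K`. -/
def restrictPreimage (φ : A →* K) (C : Subgroup P) : preimageOf φ C →* C :=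
  ((K.subtype.comp φ).comp (Subgroup.inclusion (preimageOf_le φ C))).codRestrict C (by
    rintro ⟨_, a, ha, rfl⟩
    exact ha)

theorem restrictPreimage_mem {S : Subgroup P} {F : FusionSystem S} {φ : A →* K}
    (hφ : φ ∈ F.Hom A K) (hC : C ≤ S) : restrictPreimage φ C ∈ F.Hom (preimageOf φ C) C := by
  have h1 := F.comp_mem hφ (F.inclusion_mem (preimageOf_le φ C) (F.left_le hφ))
  have h2 := F.imageIso_mem h1
  have h3 : imageOf (φ.comp (Subgroup.inclusion (preimageOf_le φ C))) ≤ C := by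
    rintro _ ⟨⟨_, a, ha, rfl⟩, rfl⟩
    exact ha
  exact F.comp_mem (F.inclusion_mem h3 hC) h2

end CompRestrict

end MackeyFunctor

/-! The formula is a module version of the fact that `[H ×_F K]` represents the product of `H` and
`K` in the orbit category of `F`-centric subgroups: a morphism `f : D → K` of `F` with `D ≤ H`
centric factors as `c_k φ c_h` with `h ∈ H`, `k ∈ K`, for exactly one `(A, φ̄)` in `[H ×_F K]`, and
the coset `A h` is determined (`IsProduct.exists_prec`, `IsProduct.unique_factorization`).

Existence comes from extending `f` to a subgroup of `H` of largest order. Uniqueness rests on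
saturation. A fully normalized `B` has `Aut_S(B)` Sylow in `Aut_F(B)` (`IsFullyNormalized.sylowAt`).
Hence two morphisms that agree on a centric subgroup differ by conjugation by an element of its
center (`IsCentric.exists_eq_conj`). A morphism `A → K` with `A ≤ H` centric extends, with values in
`K`, to the part of `N_H(A)` that acts on the image like `K` (`IsCentric.exists_extend`), and so
maximal extensions of one morphism have the same source (`IsCentric.eq_of_isMaxMor`).

On the algebraic side, every element of the Mackey semiring is a sum of transitive bisets whose
stabilizers are graphs of morphisms, that is, of products `c_f R_D^B` (`mackeySemiring_induction`);
here `c_f`, in the file `cls J D f`, stands for `I_{f(D)}^J c_f`. The module induced from `F_H(H)`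
to `F` is therefore presented, as an abelian group, by symbols `c_f ⊗ m` with `D ≤ H` and `f : D →
J`, subject to conjugation of `f` by elements of `J` and to moving `c_g`, for `g` in `F_H(H)`,
across the tensor sign: `MackeyInduce.induction_on` gives generation, and
`IsInductionFamily.exists_addHom` says that maps respecting these relations define a homomorphism.

The map `Γ` is right multiplication by the sum of the isomorphisms `φ⁻¹(D) → D` induced by `φ`. This
element intertwines the actions of `F_{φ(A)}(φ(A))` and `F_A(A)`, so `Γ` is a well-defined linear
map (`exists_conjRestrict_hom`). In the other direction `c_f ⊗ m` is sent to `c_k ⊗ c_h m` in the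
summand of the factorization `f = c_k φ c_h`, and to zero when `D` is not `F`-centric or `J` is not
in `K`. Unique factorization and the vanishing of `M` off the `G`-centric subgroups make this
respect the relations (`isInductionFamily_productFamily`). On generators it is a left inverse of
`Γ`, and every generator of the target is visibly hit, so `Γ` is bijective (`exists_productEquiv`).
The prescribed values determine `Γ` because factoring in `[φ(A) ×_{F_K(K)} J]` rewrites each nonzero
generator in the prescribed form (`exists_tmul_eq_of_isProduct`).

Morphisms are handled as functions `P → P` restricted to subgroups (`IsMor`), which makes
composition, restriction and change of target free of coercions. -/

namespace FusionSystem

/-! ### Morphisms as functions on the ambient group; centric subgroups -/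

section Mor

variable {P : Type u} [Group P] {S S' : Subgroup P}

/-- The function `f` restricts to a morphism `A → B` of `F`. -/
def IsMor (F : FusionSystem S) (A B : Subgroup P) (f : P → P) : Prop :=
  ∃ ψ ∈ F.Hom A B, ∀ a : A, (ψ a : P) = f a

/-- The subgroup generated by the image of `A` under the function `f`. -/
def img (A : Subgroup P) (f : P → P) : Subgroup P := Subgroup.closure (f '' A)

open Classical in
/-- A homomorphism between subgroups of `P`, extended by `1` to a function on `P`. -/
noncomputable def extFun {A B : Subgroup P} (φ : A →* B) (x : P) : P :=
  if h : x ∈ A then φ ⟨x, h⟩ else 1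

theorem extFun_coe {A B : Subgroup P} (φ : A →* B) (a : A) : extFun φ a = φ a := by
  simp [extFun]

theorem extFun_mk {A B : Subgroup P} (φ : A →* B) {a : P} (h : a ∈ A) :
    extFun φ a = φ ⟨a, h⟩ := extFun_coe φ ⟨a, h⟩

variable {F : FusionSystem S} {F' : FusionSystem S'} {A B C : Subgroup P} {f g : P → P}

theorem isMor_extFun {φ : A →* B} (h : φ ∈ F.Hom A B) : F.IsMor A B (extFun φ) :=
  ⟨φ, h, fun a => (extFun_coe φ a).symm⟩

namespace IsMor

theorem left_le (h : F.IsMor A B f) : A ≤ S := by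
  obtain ⟨ψ, hψ, _⟩ := h
  exact F.left_le hψ

theorem right_le (h : F.IsMor A B f) : B ≤ S := by
  obtain ⟨ψ, hψ, _⟩ := h
  exact F.right_le hψ

theorem mem (h : F.IsMor A B f) {a : P} (ha : a ∈ A) : f a ∈ B := by
  obtain ⟨ψ, _, hf⟩ := h
  rw [← hf ⟨a, ha⟩]
  exact (ψ _).2

theorem map_mul (h : F.IsMor A B f) {a b : P} (ha : a ∈ A) (hb : b ∈ A) :
    f (a * b) = f a * f b := by
  obtain ⟨ψ, _, hf⟩ := h
  rw [← hf ⟨a, ha⟩, ← hf ⟨b, hb⟩, ← hf ⟨a * b, A.mul_mem ha hb⟩, ← Subgroup.coe_mul, ← _root_.map_mul]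
  rfl

theorem map_one (h : F.IsMor A B f) : f 1 = 1 := by
  have h1 := h.map_mul A.one_mem A.one_mem
  rw [mul_one] at h1
  exact left_eq_mul.1 h1

theorem map_inv (h : F.IsMor A B f) {a : P} (ha : a ∈ A) : f a⁻¹ = (f a)⁻¹ := by
  rw [eq_inv_iff_mul_eq_one, ← h.map_mul (A.inv_mem ha) ha, inv_mul_cancel, h.map_one]

theorem map_conj (h : F.IsMor A B f) {a b : P} (ha : a ∈ A) (hb : b ∈ A) :
    f (a * b * a⁻¹) = f a * f b * (f a)⁻¹ := by
  rw [h.map_mul (A.mul_mem ha hb) (A.inv_mem ha), h.map_mul ha hb, h.map_inv ha]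

theorem inj (h : F.IsMor A B f) {a b : P} (ha : a ∈ A) (hb : b ∈ A) (e : f a = f b) : a = b := by
  obtain ⟨ψ, hψ, hf⟩ := h
  rw [← hf ⟨a, ha⟩, ← hf ⟨b, hb⟩] at e
  exact congrArg Subtype.val (F.injective hψ (Subtype.ext e))

theorem congr (h : F.IsMor A B f) (e : ∀ a ∈ A, f a = g a) : F.IsMor A B g := by
  obtain ⟨ψ, hψ, hf⟩ := h
  exact ⟨ψ, hψ, fun a => (hf a).trans (e a a.2)⟩

theorem comp (hg : F.IsMor B C g) (hf : F.IsMor A B f) : F.IsMor A C (g ∘ f) := by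
  obtain ⟨ψ, hψ, hg⟩ := hg
  obtain ⟨φ, hφ, hf⟩ := hf
  refine ⟨ψ.comp φ, F.comp_mem hψ hφ, fun a => ?_⟩
  rw [MonoidHom.comp_apply, hg, hf]
  rfl

theorem of_le (h : F.Le F') (hf : F.IsMor A B f) : F'.IsMor A B f := by
  obtain ⟨ψ, hψ, hf⟩ := hf
  exact ⟨ψ, h.hom_subset _ _ hψ, hf⟩

end IsMor

theorem isMor_conj (F : FusionSystem S) {s : P} (hs : s ∈ S) (hA : A ≤ S) (hB : B ≤ S)
    (h : ∀ a ∈ A, s * a * s⁻¹ ∈ B) : F.IsMor A B (fun x => s * x * s⁻¹) :=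
  ⟨(((MulAut.conj s).toMonoidHom).comp A.subtype).codRestrict B fun a => h a a.2,
    F.conj_mem _ s hA hB hs fun _ => rfl, fun _ => rfl⟩

theorem isMor_id (F : FusionSystem S) (h : A ≤ B) (hB : B ≤ S) : F.IsMor A B id :=
  ⟨_, F.inclusion_mem h hB, fun _ => rfl⟩

namespace IsMor

theorem mono (h : F.IsMor A B f) (h' : C ≤ A) : F.IsMor C B f :=
  h.comp (F.isMor_id h' h.left_le)

theorem mono_right (h : F.IsMor A B f) (h' : B ≤ C) (hC : C ≤ S) : F.IsMor A C f :=
  (F.isMor_id h' hC).comp h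

theorem mem_img (h : F.IsMor A B f) {x : P} : x ∈ img A f ↔ ∃ a ∈ A, f a = x := by
  constructor
  · intro hx
    induction hx using Subgroup.closure_induction with
    | mem x hx => exact hx
    | one => exact ⟨1, A.one_mem, h.map_one⟩
    | mul x y _ _ hx hy =>
      obtain ⟨a, ha, rfl⟩ := hx
      obtain ⟨b, hb, rfl⟩ := hy
      exact ⟨a * b, A.mul_mem ha hb, h.map_mul ha hb⟩
    | inv x _ hx =>
      obtain ⟨a, ha, rfl⟩ := hx
      exact ⟨a⁻¹, A.inv_mem ha, h.map_inv ha⟩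
  · rintro ⟨a, ha, rfl⟩
    exact Subgroup.subset_closure ⟨a, ha, rfl⟩

theorem apply_mem_img {a : P} (ha : a ∈ A) : f a ∈ img A f :=
  Subgroup.subset_closure ⟨a, ha, rfl⟩

theorem img_le (h : F.IsMor A B f) : img A f ≤ B := by
  intro x hx
  obtain ⟨a, ha, rfl⟩ := h.mem_img.1 hx
  exact h.mem ha

theorem imageOf_eq {φ : A →* B} (e : ∀ a : A, (φ a : P) = f a) : imageOf φ = img A f := by
  have h0 : f '' A = (imageOf φ : Set P) := by
    ext x
    constructor
    · rintro ⟨a, ha, rfl⟩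
      exact ⟨⟨a, ha⟩, e _⟩
    · rintro ⟨a, rfl⟩
      exact ⟨a, a.2, (e a).symm⟩
  rw [img, h0, Subgroup.closure_eq]

theorem to_img (h : F.IsMor A B f) : F.IsMor A (img A f) f := by
  obtain ⟨φ, hφ, e⟩ := h
  rw [← imageOf_eq e]
  exact ⟨_, F.imageIso_mem hφ, e⟩

theorem cod (h : F.IsMor A B f) (hC : C ≤ S) (hf : ∀ a ∈ A, f a ∈ C) : F.IsMor A C f := by
  refine h.to_img.mono_right ?_ hC
  intro x hx
  obtain ⟨a, ha, rfl⟩ := h.mem_img.1 hx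
  exact hf a ha

theorem exists_inv (h : F.IsMor A B f) : ∃ g, F.IsMor (img A f) A g ∧ (∀ a ∈ A, g (f a) = a) ∧
    ∀ b ∈ img A f, f (g b) = b := by
  obtain ⟨φ, hφ, e⟩ := id h
  have h1 := isMor_extFun (F.imageIso_symm_mem hφ)
  have key : ∀ a ∈ A, extFun (imageIso φ (F.injective hφ)).symm.toMonoidHom (f a) = a := by
    intro a ha
    have h2 : f a = imageIso φ (F.injective hφ) ⟨a, ha⟩ := (e ⟨a, ha⟩).symm
    rw [h2, extFun_coe]
    exact congrArg Subtype.val ((imageIso φ (F.injective hφ)).symm_apply_apply ⟨a, ha⟩)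
  generalize extFun (imageIso φ (F.injective hφ)).symm.toMonoidHom = g at h1 key
  rw [imageOf_eq e] at h1
  refine ⟨g, h1, key, ?_⟩
  intro b hb
  obtain ⟨a, ha, rfl⟩ := h.mem_img.1 hb
  rw [key a ha]

theorem isIsomorphic (h : F.IsMor A B f) : F.IsIsomorphic A (img A f) := by
  obtain ⟨φ, hφ, e⟩ := h
  rw [← imageOf_eq e]
  exact ⟨_, F.imageIso_mem hφ, F.imageIso_symm_mem hφ⟩

theorem card_img (h : F.IsMor A B f) : Nat.card (img A f) = Nat.card A := by
  obtain ⟨e, _⟩ := h.isIsomorphic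
  exact (Nat.card_congr e.toEquiv).symm

theorem img_comp (hf : F.IsMor A B f) (hg : F.IsMor B C g) :
    img A (g ∘ f) = img (img A f) g := by
  have hg' := hg.mono hf.img_le
  ext x
  rw [(hg.comp hf).mem_img, hg'.mem_img]
  constructor
  · rintro ⟨a, ha, rfl⟩
    exact ⟨f a, apply_mem_img ha, rfl⟩
  · rintro ⟨b, hb, rfl⟩
    obtain ⟨a, ha, rfl⟩ := hf.mem_img.1 hb
    exact ⟨a, ha, rfl⟩

end IsMor

theorem IsIsomorphic.exists_isMor (h : F.IsIsomorphic A B) : ∃ f, F.IsMor A B f ∧ img A f = B := by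
  obtain ⟨e, he, _⟩ := h
  refine ⟨extFun e.toMonoidHom, isMor_extFun he, ?_⟩
  ext x
  rw [(isMor_extFun he).mem_img]
  constructor
  · rintro ⟨a, ha, rfl⟩
    exact (isMor_extFun he).mem ha
  · intro hx
    refine ⟨e.symm ⟨x, hx⟩, (e.symm ⟨x, hx⟩).2, ?_⟩
    rw [extFun_coe]
    exact congrArg Subtype.val (e.apply_symm_apply ⟨x, hx⟩)

/-- The form in which centricity is used below: `f(A)` is `F`-isomorphic to `A`, so it contains its
own centralizer in `S`. -/
theorem IsCentric.mem_img (hA : F.IsCentric A) (hf : F.IsMor A B f) {s : P} (hs : s ∈ S)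
    (h : ∀ a ∈ A, s * f a = f a * s) : s ∈ img A f := by
  refine hA.2 _ hf.isIsomorphic ⟨hs, Subgroup.mem_centralizer_iff.2 fun x hx => ?_⟩
  obtain ⟨a, ha, rfl⟩ := hf.mem_img.1 hx
  exact (h a ha).symm

theorem IsCentric.mem (hA : F.IsCentric A) {s : P} (hs : s ∈ S)
    (h : ∀ a ∈ A, s * a = a * s) : s ∈ A := by
  have h1 := hA.mem_img (F.isMor_id le_rfl hA.1) hs h
  exact (F.isMor_id le_rfl hA.1).img_le h1

theorem isCentric_iff : F.IsCentric A ↔ A ≤ S ∧ ∀ f, F.IsMor A S f → ∀ s ∈ S,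
    (∀ a ∈ A, s * f a = f a * s) → s ∈ img A f := by
  constructor
  · exact fun h => ⟨h.1, fun f hf s hs hc => h.mem_img hf hs hc⟩
  · rintro ⟨hA, h⟩
    refine ⟨hA, fun B hB s hs => ?_⟩
    obtain ⟨f, hf, rfl⟩ := hB.exists_isMor
    refine h f (hf.mono_right hf.right_le le_rfl) s hs.1 fun a ha => ?_
    exact (Subgroup.mem_centralizer_iff.1 hs.2 _ (IsMor.apply_mem_img ha)).symm

protected theorem IsCentric.img (hA : F.IsCentric A) (hf : F.IsMor A B f) : F.IsCentric (img A f) := by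
  refine isCentric_iff.2 ⟨hf.img_le.trans hf.right_le, fun g hg s hs h => ?_⟩
  rw [← hf.to_img.img_comp hg]
  exact hA.mem_img (hg.comp hf.to_img) hs fun a ha => h _ (IsMor.apply_mem_img ha)

/-- Whatever centralizes `f(B)` centralizes `f(A)`, hence lies in `f(A) ≤ f(B)`. -/
theorem IsCentric.mono (hA : F.IsCentric A) (h : A ≤ B) (hB : B ≤ S) : F.IsCentric B := by
  refine isCentric_iff.2 ⟨hB, fun f hf s hs hc => ?_⟩
  have h1 := hA.mem_img (hf.mono h) hs fun a ha => hc a (h ha)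
  exact Subgroup.closure_mono (Set.image_mono h) h1

/-- The target of a morphism from a centric subgroup is centric. -/
theorem IsCentric.target (hA : F.IsCentric A) (hf : F.IsMor A B f) : F.IsCentric B :=
  (hA.img hf).mono hf.img_le hf.right_le

theorem IsCentric.of_img (hf : F.IsMor A B f) (h : F.IsCentric (FusionSystem.img A f)) :
    F.IsCentric A := by
  obtain ⟨g, hg, _, _⟩ := hf.exists_inv
  exact h.target hg

/-- The larger system has more conjugates and larger centralizers, so its condition is stronger.
This turns vanishing off the `G`-centric subgroups into vanishing off the `F`-centric ones. -/
theorem IsCentric.of_le (hFF : F.Le F') (h : F'.IsCentric A) (hA : A ≤ S) : F.IsCentric A := by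
  refine isCentric_iff.2 ⟨hA, fun f hf s hs hc => ?_⟩
  exact h.mem_img (hf.of_le hFF) (hFF.le hs) hc

end Mor

end FusionSystem

/-! ### Normalizers in `p`-groups and `p`-parts of elements -/

section GroupLemmas

theorem pow_eq_self_of_modEq {G : Type*} [Group G] {x : G} {p j n : ℕ} (hx : x ^ p ^ j = 1) (hn : n ≡ 1 [MOD p ^ j]) :
    x ^ n = x := by
  have h1 : n ≡ 1 [MOD orderOf x] := hn.of_dvd (orderOf_dvd_of_pow_eq_one hx)
  have h2 := (pow_eq_pow_iff_modEq (x := x)).2 h1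
  rwa [pow_one] at h2

variable {G : Type*} [Group G] [Finite G] {p : ℕ} [Fact p.Prime]

/-- A finite `p`-group is nilpotent, so its proper subgroups are strictly smaller than their
normalizers. -/
theorem IsPGroup.exists_normalizing_of_lt {I Q : Subgroup G} (hQ : IsPGroup p Q) (h : I < Q) :
    ∃ g ∈ Q, g ∉ I ∧ ∀ x, x ∈ I ↔ g * x * g⁻¹ ∈ I := by
  have hn : Group.IsNilpotent Q := hQ.isNilpotent
  have hlt : I.subgroupOf Q < ⊤ := by
    rw [lt_top_iff_ne_top]
    intro e
    exact h.not_ge (Subgroup.subgroupOf_eq_top.1 e)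
  obtain ⟨⟨g, hg⟩, h1, h2⟩ := SetLike.exists_of_lt (Group.normalizerCondition_of_isNilpotent _ hlt)
  refine ⟨g, hg, fun h3 => h2 h3, ?_⟩
  have key : ∀ y : Q, ∀ x : G, y ∈ Subgroup.normalizer (I.subgroupOf Q : Set Q) → x ∈ I →
      (y : G) * x * (y : G)⁻¹ ∈ I := by
    intro y x hy hx
    exact (Subgroup.mem_normalizer_iff.1 hy ⟨x, h.le hx⟩).1 hx
  intro x
  refine ⟨key ⟨g, hg⟩ x h1, fun hx => ?_⟩
  have h3 := key (⟨g, hg⟩⁻¹) _ (inv_mem h1) hx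
  simpa [mul_assoc] using h3

/-- A `p`-subgroup that contains all `p`-elements of its normalizer contains a conjugate of every
`p`-subgroup. -/
theorem IsPGroup.exists_conj_le {I : Subgroup G} (hI : IsPGroup p I)
    (h : ∀ g : G, (∃ k, g ^ p ^ k = 1) → (∀ x ∈ I, g * x * g⁻¹ ∈ I) → g ∈ I)
    {Q : Subgroup G} (hQ : IsPGroup p Q) : ∃ g : G, ∀ x ∈ Q, g * x * g⁻¹ ∈ I := by
  obtain ⟨T, hT⟩ := hI.exists_le_sylow
  -- If `I` were proper in a Sylow subgroup `T`, a `p`-element of `T` outside `I` would normalize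
  -- `I`. So `I` is itself Sylow, and Sylow's conjugacy theorem applies.
  have hIT : I = (T : Subgroup G) := by
    refine hT.eq_of_not_lt fun hlt => ?_
    obtain ⟨g, hg, hgI, hn⟩ := T.isPGroup'.exists_normalizing_of_lt hlt
    obtain ⟨k, hk⟩ := T.isPGroup' ⟨g, hg⟩
    exact hgI (h g ⟨k, congrArg Subtype.val hk⟩ fun x hx => (hn x).1 hx)
  obtain ⟨T', hT'⟩ := hQ.exists_le_sylow
  obtain ⟨g, rfl⟩ := MulAction.exists_smul_eq G T' T
  refine ⟨g, fun x hx => ?_⟩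
  rw [hIT, Sylow.coe_subgroup_smul]
  exact ⟨x, hT' hx, rfl⟩

/-- By the Chinese remainder theorem `n` can be chosen divisible by the `p'`-part of the order of
`x`. The congruence modulo `p ^ j` keeps a restriction of `x` of order dividing `p ^ j` unchanged
under the power. -/
theorem exists_pow_isPGroup_part (x : G) (j : ℕ) :
    ∃ n k, (x ^ n) ^ p ^ k = 1 ∧ n ≡ 1 [MOD p ^ j] := by
  have hp : p.Prime := Fact.out
  obtain ⟨a, m, hm, e⟩ := Nat.exists_eq_pow_mul_and_not_dvd (orderOf_pos x).ne' p hp.ne_one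
  have hc : Nat.Coprime (p ^ j) m := Nat.Coprime.pow_left j ((Nat.Prime.coprime_iff_not_dvd hp).2 hm)
  obtain ⟨n, h1, h2⟩ := Nat.chineseRemainder hc 1 0
  refine ⟨n, a, ?_, h1⟩
  rw [← pow_mul, ← orderOf_dvd_iff_pow_eq_one, e, mul_comm]
  exact Nat.mul_dvd_mul_right ((Nat.modEq_zero_iff_dvd).1 h2) _

end GroupLemmas

/-! ### Saturation: fully normalized subgroups and Sylow subgroups of `Aut_F(B)` -/

namespace FusionSystem

section Saturated

variable {P : Type u} [Group P] {S : Subgroup P} {F : FusionSystem S} {A B C : Subgroup P}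
  {f g : P → P}

variable (F) in
/-- The group `Aut_F(C)`. -/
def aut (C : Subgroup P) : Subgroup (MulAut C) where
  -- The identity is adjoined so that this is a subgroup of `MulAut C` even when `C` is not
  -- contained in `S`.
  carrier := {e | C ≤ S ∧ e.toMonoidHom ∈ F.Hom C C ∧ e.symm.toMonoidHom ∈ F.Hom C C} ∪ {1}
  mul_mem' := by
    rintro a b (⟨h, h1, h2⟩ | rfl) (⟨_, h3, h4⟩ | rfl)
    · exact Or.inl ⟨h, F.comp_mem h1 h3, F.comp_mem h4 h2⟩
    · exact Or.inl ⟨h, h1, h2⟩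
    · rw [one_mul]
      exact Or.inl ⟨‹_›, h3, h4⟩
    · exact Or.inr (one_mul 1)
  one_mem' := Or.inr rfl
  inv_mem' := by
    rintro a (⟨h, h1, h2⟩ | rfl)
    · exact Or.inl ⟨h, h2, h1⟩
    · exact Or.inr inv_one

theorem mem_aut (hC : C ≤ S) {e : MulAut C} :
    e ∈ F.aut C ↔ e.toMonoidHom ∈ F.Hom C C ∧ e.symm.toMonoidHom ∈ F.Hom C C := by
  constructor
  · rintro (⟨_, h⟩ | rfl)
    · exact h
    · exact ⟨F.inclusion_mem le_rfl hC, F.inclusion_mem le_rfl hC⟩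
  · exact fun h => Or.inl ⟨hC, h⟩

theorem isMor_of_mem_aut (hC : C ≤ S) {e : MulAut C} (he : e ∈ F.aut C) :
    F.IsMor C C (extFun e.toMonoidHom) :=
  isMor_extFun ((mem_aut hC).1 he).1

/-- The automorphisms of `C` induced by conjugation with elements of `S`. -/
def innAut (S C : Subgroup P) : Subgroup (MulAut C) where
  carrier := {e | ∃ s ∈ S, ∀ c : C, (e c : P) = s * c * s⁻¹}
  mul_mem' := by
    rintro a b ⟨s, hs, h⟩ ⟨t, ht, h'⟩
    refine ⟨s * t, mul_mem hs ht, fun c => ?_⟩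
    rw [MulAut.mul_apply, h, h']
    group
  one_mem' := ⟨1, one_mem _, fun c => by simp⟩
  inv_mem' := by
    rintro a ⟨s, hs, h⟩
    refine ⟨s⁻¹, inv_mem hs, fun c => ?_⟩
    have h1 := h (a⁻¹ c)
    rw [MulAut.apply_inv_self] at h1
    rw [h1]
    group

theorem isPGroup_innAut {p : ℕ} (hS : IsPGroup p S) (C : Subgroup P) :
    IsPGroup p (innAut S C) := by
  rintro ⟨e, s, hs, h⟩
  obtain ⟨k, hk⟩ := hS ⟨s, hs⟩
  have hk' : s ^ p ^ k = 1 := congrArg Subtype.val hk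
  have key : ∀ n : ℕ, ∀ c : C, ((e ^ n) c : P) = s ^ n * c * (s ^ n)⁻¹ := by
    intro n
    induction n with
    | zero => simp
    | succ n ih =>
      intro c
      rw [pow_succ, MulAut.mul_apply, ih, h]
      group
  refine ⟨k, Subtype.ext (MulEquiv.ext fun c => Subtype.ext ?_)⟩
  change ((e ^ p ^ k) c : P) = c
  rw [key, hk']
  simp

theorem innAut_le_aut (hC : C ≤ S) : innAut S C ≤ F.aut C := by
  have key : ∀ e ∈ innAut S C, e.toMonoidHom ∈ F.Hom C C := by
    rintro e ⟨s, hs, h⟩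
    exact F.conj_mem _ s hC hC hs h
  exact fun e he => (mem_aut hC).2 ⟨key e he, key _ (inv_mem he)⟩

/-- The extension axiom in terms of functions; `N` is `homNormalizer`, of which only a criterion for
membership is kept. -/
theorem IsMor.extend {p : ℕ} (hF : F.IsSaturated p) (hf : F.IsMor A S f)
    (hfn : F.IsFullyNormalized (img A f)) : ∃ N g, A ≤ N ∧ F.IsMor N S g ∧ (∀ a ∈ A, g a = f a) ∧
      ∀ x ∈ S, (∀ a, a ∈ A ↔ x * a * x⁻¹ ∈ A) → ∀ z ∈ S,
        (∀ a ∈ A, f (x * a * x⁻¹) = z * f a * z⁻¹) → x ∈ N := by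
  obtain ⟨φ, hφ, e⟩ := id hf
  rw [← IsMor.imageOf_eq e] at hfn
  obtain ⟨ψ, hψ, h⟩ := hF.extend A φ hφ hfn
  have hle : ∀ x ∈ S, (∀ a, a ∈ A ↔ x * a * x⁻¹ ∈ A) → ∀ z ∈ S,
        (∀ a ∈ A, f (x * a * x⁻¹) = z * f a * z⁻¹) → x ∈ homNormalizer φ := by
    intro x hx hn z hz hxz
    refine ⟨⟨hx, Subgroup.mem_normalizer_iff.2 hn⟩, z, ⟨hz, ?_⟩, ?_⟩
    · rw [IsMor.imageOf_eq e]
      refine Subgroup.mem_normalizer_iff.2 fun b => ⟨fun hb => ?_, fun hb => ?_⟩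
      · obtain ⟨a, ha, rfl⟩ := hf.mem_img.1 hb
        rw [← hxz a ha]
        exact IsMor.apply_mem_img ((hn a).1 ha)
      · obtain ⟨a, ha, h1⟩ := hf.mem_img.1 hb
        have h2 : x⁻¹ * a * x ∈ A := (hn _).2 (by group; exact ha)
        have h3 := hxz _ h2
        rw [show x * (x⁻¹ * a * x) * x⁻¹ = a by group, h1] at h3
        rw [mul_left_cancel (mul_right_cancel h3)]
        exact IsMor.apply_mem_img h2
    · intro a ha
      rw [e, e]
      exact hxz a a.2
  refine ⟨homNormalizer φ, extFun ψ, ?_, isMor_extFun hψ, ?_, hle⟩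
  · intro a ha
    refine hle a (hf.left_le ha) (fun b => ?_) (f a) (hf.mem ha) fun b hb => hf.map_conj ha hb
    rw [Subgroup.mul_mem_cancel_right _ (inv_mem ha), Subgroup.mul_mem_cancel_left _ ha]
  · intro a ha
    have hmem : a ∈ homNormalizer φ := by
      refine hle a (hf.left_le ha) (fun b => ?_) (f a) (hf.mem ha) fun b hb => hf.map_conj ha hb
      rw [Subgroup.mul_mem_cancel_right _ (inv_mem ha), Subgroup.mul_mem_cancel_left _ ha]
    rw [extFun_mk ψ hmem, h ⟨a, hmem⟩ ha, e]

variable [Finite P]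

/-- An endomorphism in `F` is an automorphism. -/
theorem IsMor.exists_aut (h : F.IsMor C C f) : ∃ e ∈ F.aut C, ∀ c : C, (e c : P) = f c := by
  have himg : img C f = C := by
    refine Subgroup.eq_of_le_of_card_ge h.img_le ?_
    rw [h.card_img]
  have h1 := h.isIsomorphic
  obtain ⟨g, hg, h2, h3⟩ := h.exists_inv
  rw [himg] at hg h3
  obtain ⟨φ, hφ, hf⟩ := h
  obtain ⟨ψ, hψ, hg⟩ := hg
  let e : MulAut C := MonoidHom.toMulEquiv φ ψ
    (MonoidHom.ext fun c => Subtype.ext (by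
      rw [MonoidHom.comp_apply, hg, hf, h2 c c.2]
      rfl))
    (MonoidHom.ext fun c => Subtype.ext (by
      rw [MonoidHom.comp_apply, hf, hg, h3 c c.2]
      rfl))
  exact ⟨e, (mem_aut (F.left_le hφ)).2 ⟨hφ, hψ⟩, hf⟩

variable (F) in
/-- Every `p`-subgroup of `Aut_F(B)` has an `Aut_F(B)`-conjugate in `Aut_S(B)`. -/
def SylowAt (p : ℕ) (B : Subgroup P) : Prop :=
  ∀ Q : Subgroup (MulAut B), Q ≤ F.aut B → IsPGroup p Q →
    ∃ e ∈ F.aut B, ∀ x ∈ Q, e * x * e⁻¹ ∈ innAut S B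

theorem exists_isFullyNormalized (hC : C ≤ S) :
    ∃ B, F.IsIsomorphic C B ∧ F.IsFullyNormalized B := by
  have hne : {B | F.IsIsomorphic C B}.Nonempty :=
    ⟨C, MulEquiv.refl _, F.inclusion_mem le_rfl hC, F.inclusion_mem le_rfl hC⟩
  obtain ⟨B, hB, hmax⟩ := Set.exists_max_image {B | F.IsIsomorphic C B}
    (fun B => Nat.card ↥(S ⊓ Subgroup.normalizer (B : Set P))) (Set.toFinite _) hne
  refine ⟨B, hB, ?_, fun K hK => hmax K ?_⟩
  · obtain ⟨e, he, _⟩ := hB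
    exact F.right_le he
  · obtain ⟨e, he, he'⟩ := hB
    obtain ⟨d, hd, hd'⟩ := hK
    exact ⟨e.trans d, F.comp_mem hd he, F.comp_mem he' hd'⟩

/-- Carry `Q` to a fully normalized conjugate `B` of `C`, conjugate it there into `Aut_S(B)`, and
absorb the conjugating automorphism into the isomorphism. The Sylow property is assumed only for `B`
of the order of `C`, so that the lemma can be used inside the induction that proves this property.
-/
theorem exists_fullyNormalized_conj {p : ℕ} (hC : C ≤ S)
    (h : ∀ B, F.IsFullyNormalized B → Nat.card B = Nat.card C → F.SylowAt p B)
    {Q : Subgroup (MulAut C)} (hQ : Q ≤ F.aut C) (hp : IsPGroup p Q) :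
    ∃ f, F.IsMor C S f ∧ F.IsFullyNormalized (img C f) ∧
      ∀ x ∈ Q, ∃ s ∈ S, ∀ c : C, f (x c) = s * f c * s⁻¹ := by
  obtain ⟨B, ⟨e, he, he'⟩, hB⟩ := F.exists_isFullyNormalized hC
  obtain ⟨g, hg, hgQ⟩ := h B hB (Nat.card_congr e.toEquiv).symm (Q.map (MulAut.congr e).toMonoidHom)
    (by
      rintro _ ⟨x, hx, rfl⟩
      have h1 := (mem_aut hC).1 (hQ hx)
      exact (mem_aut hB.1).2 ⟨F.comp_mem he (F.comp_mem h1.1 he'),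
        F.comp_mem he (F.comp_mem h1.2 he')⟩)
    (hp.map _)
  have hg' := (mem_aut hB.1).1 hg
  have hmor : F.IsMor C B (extFun (e.trans g).toMonoidHom) := isMor_extFun (F.comp_mem hg'.1 he)
  have himg : img C (extFun (e.trans g).toMonoidHom) = B := by
    refine Subgroup.eq_of_le_of_card_ge hmor.img_le ?_
    rw [hmor.card_img, Nat.card_congr e.toEquiv]
  refine ⟨_, hmor.mono_right hB.1 le_rfl, by rwa [himg], fun x hx => ?_⟩
  obtain ⟨s, hs, h1⟩ := hgQ _ ⟨x, hx, rfl⟩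
  refine ⟨s, hs, fun c => ?_⟩
  have h2 := h1 (g (e c))
  rw [extFun_coe, extFun_coe]
  refine Eq.trans ?_ h2
  simp [MulAut.congr]

variable {p : ℕ} [Fact p.Prime]

theorem sylowAt_self (hF : F.IsSaturated p) : F.SylowAt p S := by
  intro Q hQ hp
  obtain ⟨T, hT⟩ := hF.sylow
  have haut : F.aut S = F.autSelf := by
    ext e
    exact mem_aut le_rfl
  rw [haut] at hQ ⊢
  have hp' : IsPGroup p (Q.subgroupOf F.autSelf) :=
    hp.comap_of_injective F.autSelf.subtype F.autSelf.subtype_injective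
  obtain ⟨T', hT'⟩ := hp'.exists_le_sylow
  obtain ⟨g, hg⟩ := MulAction.exists_smul_eq F.autSelf T' T
  refine ⟨g, g.2, fun x hx => ?_⟩
  have h1 : g * ⟨x, hQ hx⟩ * g⁻¹ ∈ (T : Subgroup F.autSelf) := by
    rw [← hg, Sylow.coe_subgroup_smul]
    exact ⟨_, hT' (show ⟨x, hQ hx⟩ ∈ Q.subgroupOf F.autSelf from hx), rfl⟩
  rw [hT] at h1
  obtain ⟨s, hs⟩ := h1
  refine ⟨s, s.2, fun c => ?_⟩
  have h2 : (g * x * (g : MulAut S)⁻¹) = MulAut.conj s := hs.symm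
  rw [h2]
  rfl

/-- If `B` is fully normalized, then `Aut_S(B)` is a Sylow `p`-subgroup of `Aut_F(B)`. -/
theorem IsFullyNormalized.sylowAt (hS : IsPGroup p S) (hF : F.IsSaturated p) :
    ∀ (n : ℕ) (B : Subgroup P), Nat.card S - Nat.card B = n → F.IsFullyNormalized B →
      F.SylowAt p B := by
  intro n
  induction n using Nat.strong_induction_on with
  | _ n ih =>
    intro B hn hB
    rcases hB.1.eq_or_lt with rfl | hlt
    · exact sylowAt_self hF
    intro Q hQ hp
    have hI := (isPGroup_innAut hS B).comap_of_injective (F.aut B).subtype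
      (F.aut B).subtype_injective
    have hQ' := hp.comap_of_injective (F.aut B).subtype (F.aut B).subtype_injective
    -- It suffices that every `p`-element of `Aut_F(B)` normalizing `Aut_S(B)` lies in `Aut_S(B)`.
    suffices H : ∀ g : F.aut B, (∃ k, g ^ p ^ k = 1) →
        (∀ x ∈ (innAut S B).comap (F.aut B).subtype,
          g * x * g⁻¹ ∈ (innAut S B).comap (F.aut B).subtype) →
        g ∈ (innAut S B).comap (F.aut B).subtype by
      obtain ⟨g, hg⟩ := hI.exists_conj_le H hQ'
      exact ⟨g, g.2, fun x hx => hg ⟨x, hQ hx⟩ hx⟩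
    rintro ⟨γ, hγ⟩ ⟨k, hk⟩ hnorm
    change γ ∈ innAut S B
    replace hk : γ ^ p ^ k = 1 := congrArg Subtype.val hk
    replace hnorm : ∀ x ∈ innAut S B, γ * x * γ⁻¹ ∈ innAut S B := fun x hx =>
      hnorm ⟨x, innAut_le_aut hB.1 hx⟩ hx
    set N : Subgroup P := S ⊓ Subgroup.normalizer (B : Set P) with hN
    have hBN : B < N := by
      obtain ⟨s, hs, hsB, hs'⟩ := hS.exists_normalizing_of_lt hlt
      refine lt_of_le_of_ne (le_inf hB.1 Subgroup.le_normalizer) fun e => hsB ?_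
      rw [e]
      exact ⟨hs, Subgroup.mem_normalizer_iff.2 hs'⟩
    have hcard : Nat.card B < Nat.card N := by
      by_contra hcon
      exact hBN.ne (Subgroup.eq_of_le_of_card_ge hBN.le (not_lt.1 hcon))
    have hNS : N ≤ S := inf_le_left
    have hcardN : Nat.card N ≤ Nat.card S := Subgroup.card_le_of_le hNS
    have hγm := isMor_of_mem_aut hB.1 hγ
    have hγi : img B (extFun γ.toMonoidHom) = B := by
      refine Subgroup.eq_of_le_of_card_ge hγm.img_le ?_
      rw [hγm.card_img]
    -- Since `γ` normalizes `Aut_S(B)` and `B` is fully normalized, `γ` extends to all of `N =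
    -- N_S(B)`, and the extension maps `N` to itself.
    obtain ⟨N', f, hBN', hf, hfB, hN'⟩ := (hγm.mono_right hB.1 le_rfl).extend hF
      (by rwa [hγi])
    have hγB : ∀ (b : P) (hb : b ∈ B), f b = γ ⟨b, hb⟩ := fun b hb =>
      (hfB b hb).trans (extFun_mk _ hb)
    have hNN' : N ≤ N' := by
      intro x hx
      have hxn := Subgroup.mem_normalizer_iff.1 hx.2
      obtain ⟨e, he, hex⟩ : ∃ e ∈ innAut S B, ∀ b : B, (e b : P) = x * b * x⁻¹ := by
        obtain ⟨e, _, h2⟩ := (F.isMor_conj hx.1 hB.1 hB.1 fun b hb => (hxn b).1 hb).exists_aut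
        exact ⟨e, ⟨x, hx.1, h2⟩, h2⟩
      obtain ⟨z, hz, hez⟩ := hnorm e he
      refine hN' x hx.1 hxn z hz fun b hb => ?_
      have h2 := hez (γ ⟨b, hb⟩)
      rw [extFun_mk _ hb, extFun_mk _ ((hxn b).1 hb)]
      refine Eq.trans ?_ h2
      have h3 : e ⟨b, hb⟩ = ⟨x * b * x⁻¹, (hxn b).1 hb⟩ := Subtype.ext (hex ⟨b, hb⟩)
      change (γ _ : P) = (γ (e (γ⁻¹ (γ ⟨b, hb⟩))) : P)
      rw [MulAut.inv_apply_self, h3]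
    have hfN : F.IsMor N N f := by
      refine (hf.mono hNN').cod hNS fun x hx => ⟨hf.mem (hNN' hx), ?_⟩
      have hxn := Subgroup.mem_normalizer_iff.1 hx.2
      refine Subgroup.mem_normalizer_fintype fun b hb => ?_
      have h1 : b = f (γ⁻¹ ⟨b, hb⟩ : B) := by
        rw [hγB _ (γ⁻¹ ⟨b, hb⟩ : B).2]
        exact congrArg Subtype.val (MulAut.apply_inv_self _ γ ⟨b, hb⟩).symm
      have h2 := hf.map_conj (hNN' hx) (hBN' (γ⁻¹ ⟨b, hb⟩ : B).2)
      rw [← h1] at h2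
      change f x * b * (f x)⁻¹ ∈ B
      rw [← h2, hγB _ ((hxn _).1 (γ⁻¹ ⟨b, hb⟩ : B).2)]
      exact (γ _).2
    obtain ⟨Ψ, hΨ, hΨf⟩ := hfN.exists_aut
    -- The extension `Ψ` need not have `p`-power order. A suitable power of it does, and still
    -- restricts to `γ`.
    obtain ⟨m, j, hmj, hm⟩ := exists_pow_isPGroup_part (p := p) Ψ k
    have hres : ∀ (i : ℕ) (b : B), ((Ψ ^ i) ⟨b, hBN.le b.2⟩ : P) = (γ ^ i) b := by
      intro i
      induction i with
      | zero => exact fun _ => rfl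
      | succ i ih =>
        intro b
        rw [pow_succ, MulAut.mul_apply, pow_succ, MulAut.mul_apply, ← ih]
        have : Ψ ⟨b, hBN.le b.2⟩ = ⟨γ b, hBN.le (γ b).2⟩ :=
          Subtype.ext ((hΨf _).trans (hγB b b.2))
        rw [this]
    have hδ : ∀ b : B, ((Ψ ^ m) ⟨b, hBN.le b.2⟩ : P) = γ b := by
      intro b
      rw [hres, pow_eq_self_of_modEq hk hm]
    have hpz : IsPGroup p (Subgroup.zpowers (Ψ ^ m)) := by
      rintro ⟨_, i, rfl⟩
      refine ⟨j, Subtype.ext ?_⟩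
      change ((Ψ ^ m) ^ i) ^ p ^ j = 1
      rw [← zpow_natCast, ← zpow_mul, mul_comm, zpow_mul, zpow_natCast, hmj, one_zpow]
    -- The induction hypothesis applies because `N` is larger than `B`: after an embedding `τ : N →
    -- S` the automorphism `Ψ ^ m` becomes conjugation by some `s ∈ S`.
    obtain ⟨τ, hτ, hτn, hτs⟩ := exists_fullyNormalized_conj (p := p) hNS
      (fun B' hB' hc => ih (Nat.card S - Nat.card B') (by omega) B' rfl hB')
      (Q := Subgroup.zpowers (Ψ ^ m)) ((Subgroup.zpowers_le).2 (pow_mem hΨ m)) hpz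
    obtain ⟨s, hs, hsτ⟩ := hτs _ (Subgroup.mem_zpowers _)
    have hτB := hτ.mono hBN.le
    have hle : img N τ ≤ S ⊓ Subgroup.normalizer (img B τ : Set P) := by
      intro y hy
      obtain ⟨x, hx, rfl⟩ := hτ.mem_img.1 hy
      refine ⟨hτ.mem hx, Subgroup.mem_normalizer_fintype fun b' hb' => ?_⟩
      obtain ⟨b, hb, rfl⟩ := hτB.mem_img.1 hb'
      rw [← hτ.map_conj hx (hBN.le hb)]
      exact IsMor.apply_mem_img ((Subgroup.mem_normalizer_iff.1 hx.2 b).1 hb)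
    -- Here `B` fully normalized is used again: `N_S(τ(B))` is no larger than `N`. So `s`, which
    -- normalizes `τ(B)`, is `τ(y)` with `y ∈ N`, and `γ` is conjugation by `y`.
    have heq : img N τ = S ⊓ Subgroup.normalizer (img B τ : Set P) := by
      refine Subgroup.eq_of_le_of_card_ge hle ?_
      rw [hτ.card_img]
      exact hB.2 _ hτB.isIsomorphic
    have hsmem : s ∈ img N τ := by
      rw [heq]
      refine ⟨hs, Subgroup.mem_normalizer_fintype fun b' hb' => ?_⟩
      obtain ⟨b, hb, rfl⟩ := hτB.mem_img.1 hb'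
      have h1 := hsτ ⟨b, hBN.le hb⟩
      rw [hδ ⟨b, hb⟩] at h1
      change s * τ b * s⁻¹ ∈ _
      rw [← h1]
      exact IsMor.apply_mem_img (γ _).2
    obtain ⟨y, hy, rfl⟩ := hτ.mem_img.1 hsmem
    refine ⟨y, hNS hy, fun b => ?_⟩
    have h1 := hsτ ⟨b, hBN.le b.2⟩
    rw [hδ b, ← hτ.map_conj hy (hBN.le b.2)] at h1
    exact hτ.inj (hBN.le (γ b).2) (N.mul_mem (N.mul_mem hy (hBN.le b.2)) (N.inv_mem hy)) h1

theorem exists_isMor_innAut (hS : IsPGroup p S) (hF : F.IsSaturated p) (hC : C ≤ S)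
    {Q : Subgroup (MulAut C)} (hQ : Q ≤ F.aut C) (hp : IsPGroup p Q) :
    ∃ f, F.IsMor C S f ∧ F.IsFullyNormalized (img C f) ∧
      ∀ x ∈ Q, ∃ s ∈ S, ∀ c : C, f (x c) = s * f c * s⁻¹ :=
  exists_fullyNormalized_conj hC (fun B hB _ => IsFullyNormalized.sylowAt hS hF _ B rfl hB) hQ hp

end Saturated

end FusionSystem

/-! ### Extension of morphisms from centric subgroups -/

namespace FusionSystem

section Extension

variable {P : Type u} [Group P] {S : Subgroup P} {F : FusionSystem S}
  {A B C D H K : Subgroup P} {f g χ χ' : P → P}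

/-- There are `h ∈ H` and `k ∈ K` such that `A^h ≤ B` and `f (a) = k g (a^h) k⁻¹` for `a ∈ A`. -/
def PrecFn (H K A : Subgroup P) (f : P → P) (B : Subgroup P) (g : P → P) : Prop :=
  ∃ h ∈ H, ∃ k ∈ K, ∀ a ∈ A, h⁻¹ * a * h ∈ B ∧ f a = k * g (h⁻¹ * a * h) * k⁻¹

theorem PrecFn.of_eq (h : A ≤ B) (e : ∀ a ∈ A, f a = g a) : PrecFn H K A f B g :=
  ⟨1, one_mem _, 1, one_mem _, fun a ha => by simpa using ⟨h ha, e a ha⟩⟩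

theorem PrecFn.trans (h₁ : PrecFn H K A f B g) (h₂ : PrecFn H K B g C χ) :
    PrecFn H K A f C χ := by
  obtain ⟨h, hh, k, hk, e⟩ := h₁
  obtain ⟨h', hh', k', hk', e'⟩ := h₂
  refine ⟨h * h', mul_mem hh hh', k * k', mul_mem hk hk', fun a ha => ?_⟩
  obtain ⟨h3, h4⟩ := e a ha
  obtain ⟨h5, h6⟩ := e' _ h3
  rw [h4, h6, show (h * h')⁻¹ * a * (h * h') = h'⁻¹ * (h⁻¹ * a * h) * h' by group]
  exact ⟨h5, by group⟩

variable (F H K) in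
/-- No morphism to `K` from a larger `F`-centric subgroup of `H` lies above `f : A → K`. -/
def IsMaxMor (A : Subgroup P) (f : P → P) : Prop :=
  ∀ B g, B ≤ H → F.IsCentric B → F.IsMor B K g → PrecFn H K A f B g → Nat.card B ≤ Nat.card A

theorem IsMaxMor.of_prec (h : F.IsMaxMor H K A f) (hp : PrecFn H K A f B g)
    (hc : Nat.card A = Nat.card B) : F.IsMaxMor H K B g :=
  fun C χ hC hC' hχ h' => (h C χ hC hC' hχ (hp.trans h')).trans hc.le

/-- Undoes the conjugations in `PrecFn`: a morphism lying above `f` is replaced by a conjugate that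
extends `f`. -/
theorem IsMor.transport (hg : F.IsMor B K g) (hH : H ≤ S) (hB : B ≤ H) {h k : P} (hh : h ∈ H)
    (hk : k ∈ K) : ∃ C ≤ H, Nat.card C = Nat.card B ∧ (∀ x, x ∈ C ↔ h⁻¹ * x * h ∈ B) ∧
      F.IsMor C K (fun x => k * g (h⁻¹ * x * h) * k⁻¹) := by
  have hmem : ∀ x, x ∈ conjBy B h⁻¹ ↔ h⁻¹ * x * h ∈ B := by
    intro x
    constructor
    · rintro ⟨b, hb, rfl⟩
      simpa [mul_assoc] using hb
    · exact fun hx => ⟨_, hx, by simp [mul_assoc]⟩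
  have hle := conjBy_le hB (inv_mem hh)
  refine ⟨conjBy B h⁻¹, hle, ?_, hmem, ?_⟩
  · exact (Nat.card_congr (B.equivMapOfInjective _ (MulAut.conj h⁻¹⁻¹).injective).toEquiv).symm
  · have h1 : F.IsMor (conjBy B h⁻¹) B (fun x => h⁻¹ * x * h⁻¹⁻¹) :=
      F.isMor_conj (hH (inv_mem hh)) (hle.trans hH) (hB.trans hH) fun x hx => by
        rw [inv_inv]
        exact (hmem x).1 hx
    have h2 := (F.isMor_conj (hg.right_le hk) hg.right_le hg.right_le (fun x hx =>
      mul_mem (mul_mem hk hx) (inv_mem hk))).comp (hg.comp h1)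
    exact h2.congr fun x _ => by simp

variable [Finite P]

/-- An extension with source of largest order works: by `IsMor.transport`, anything above it is
conjugate to another extension, with source of the same order. -/
theorem IsMor.exists_isMaxMor (hH : H ≤ S) (hAH : A ≤ H)
    (hf : F.IsMor A K f) : ∃ B g, A ≤ B ∧ B ≤ H ∧ F.IsMor B K g ∧ (∀ a ∈ A, g a = f a) ∧
      F.IsMaxMor H K B g := by
  obtain ⟨B, ⟨hAB, hBH, g, hg, hgf⟩, hmax⟩ := Set.exists_max_image
    {B | A ≤ B ∧ B ≤ H ∧ ∃ g, F.IsMor B K g ∧ ∀ a ∈ A, g a = f a}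
    (fun B => Nat.card B) (Set.toFinite _) ⟨A, le_rfl, hAH, f, hf, fun _ _ => rfl⟩
  refine ⟨B, g, hAB, hBH, hg, hgf, ?_⟩
  rintro C χ hC hC' hχ ⟨h, hh, k, hk, e⟩
  obtain ⟨C', hC'H, hcard, hmem, hmor⟩ := hχ.transport hH hC hh hk
  rw [← hcard]
  refine hmax C' ⟨fun a ha => (hmem a).2 (e a (hAB ha)).1, hC'H, _, hmor, fun a ha => ?_⟩
  rw [← hgf a ha]
  exact (e a (hAB ha)).2.symm

variable {p : ℕ} [Fact p.Prime]

/-- The automorphism `γ = χ⁻¹ χ'` of `B` fixes `D` pointwise. It moves each `b` by an element of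
`D`, since `χ(b)⁻¹ χ'(b)` centralizes `χ(D)`. This forces `γ` to have `p`-power order, and the Sylow
property then realizes it as a conjugation. -/
theorem IsCentric.eq_conj_of_normal (hS : IsPGroup p S) (hF : F.IsSaturated p)
    (hD : F.IsCentric D) (hDB : D ≤ B) (hn : ∀ b ∈ B, ∀ d ∈ D, b * d * b⁻¹ ∈ D)
    (hχ : F.IsMor B S χ) (hχ' : F.IsMor B S χ') (e : ∀ d ∈ D, χ' d = χ d) :
    ∃ z ∈ D, (∀ d ∈ D, z * d = d * z) ∧ ∀ b ∈ B, χ' b = χ (z * b * z⁻¹) := by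
  have hζ : ∀ b ∈ B, ∃ c ∈ D, χ' b = χ (b * c) := by
    intro b hb
    have h1 : (χ b)⁻¹ * χ' b ∈ img D χ := by
      refine hD.mem_img (hχ.mono hDB) (mul_mem (inv_mem (hχ.mem hb)) (hχ'.mem hb)) fun d hd => ?_
      have h2 := hχ'.map_conj hb (hDB hd)
      rw [e _ (hn b hb d hd), e d hd, hχ.map_conj hb (hDB hd)] at h2
      rw [eq_mul_inv_iff_mul_eq] at h2
      have h3 : χ' b * χ d = χ b * χ d * ((χ b)⁻¹ * χ' b) := by rw [← h2]; group
      rw [mul_assoc, h3]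
      group
    obtain ⟨c, hc, h2⟩ := (hχ.mono hDB).mem_img.1 h1
    exact ⟨c, hc, by rw [hχ.map_mul hb (hDB hc), h2, mul_inv_cancel_left]⟩
  obtain ⟨g, hg, hgχ, _⟩ := hχ.exists_inv
  have hmor : F.IsMor B B (g ∘ χ') := by
    refine hg.comp (hχ'.cod hg.left_le fun b hb => ?_)
    obtain ⟨c, hc, h1⟩ := hζ b hb
    rw [h1]
    exact IsMor.apply_mem_img (mul_mem hb (hDB hc))
  obtain ⟨γ, hγ, hγe⟩ := hmor.exists_aut
  have hγb : ∀ b : B, ∃ c ∈ D, χ' b = χ (b * c) ∧ (γ b : P) = b * c := by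
    intro b
    obtain ⟨c, hc, h1⟩ := hζ b b.2
    refine ⟨c, hc, h1, ?_⟩
    rw [hγe, Function.comp_apply, h1, hgχ _ (mul_mem b.2 (hDB hc))]
  have hγd : ∀ d : B, (d : P) ∈ D → γ d = d := by
    intro d hd
    refine Subtype.ext ?_
    rw [hγe, Function.comp_apply, e d hd, hgχ _ d.2]
  obtain ⟨k, hk⟩ := IsPGroup.iff_card.1 hS
  -- As `γ` fixes `D` and `γ b = b c` with `c ∈ D`, its powers are `γ ^ n b = b c ^ n`; the exponent
  -- `p ^ k` is the order of `S`.
  have hpow : γ ^ p ^ k = 1 := by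
    refine MulEquiv.ext fun b => ?_
    obtain ⟨c, hc, _, h1⟩ := hγb b
    have h2 : γ b = b * ⟨c, hDB hc⟩ := Subtype.ext h1
    have h3 : ∀ n : ℕ, (γ ^ n) b = b * ⟨c, hDB hc⟩ ^ n := by
      intro n
      induction n with
      | zero => simp
      | succ n ih =>
        rw [pow_succ', MulAut.mul_apply, ih, map_mul, h2, map_pow, hγd _ hc, mul_assoc, pow_succ']
    have h4 : (⟨c, hDB hc⟩ : B) ^ p ^ k = 1 := by
      have h5 : (⟨c, hD.1 hc⟩ : S) ^ p ^ k = 1 := by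
        rw [← hk]
        exact pow_card_eq_one'
      have h6 : c ^ p ^ k = 1 := congrArg Subtype.val h5
      exact Subtype.ext h6
    rw [h3, h4, mul_one]
    rfl
  have hpz : IsPGroup p (Subgroup.zpowers γ) := by
    rintro ⟨_, i, rfl⟩
    refine ⟨k, Subtype.ext ?_⟩
    change (γ ^ i) ^ p ^ k = 1
    rw [← zpow_natCast, ← zpow_mul, mul_comm, zpow_mul, zpow_natCast, hpow, one_zpow]
  obtain ⟨f, hf, _, hfs⟩ := exists_isMor_innAut hS hF hχ.left_le
    (Subgroup.zpowers_le.2 hγ) hpz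
  obtain ⟨s, hs, hsf⟩ := hfs γ (Subgroup.mem_zpowers γ)
  -- Conjugation by `s` represents `γ`, which is trivial on `D`; so `s` centralizes `f(D)` and
  -- centricity gives `s = f(z)` with `z ∈ D`.
  have hsD : s ∈ img D f := by
    refine hD.mem_img (hf.mono hDB) hs fun d hd => ?_
    have h1 := hsf ⟨d, hDB hd⟩
    rw [hγd _ hd] at h1
    exact (eq_mul_inv_iff_mul_eq.1 h1).symm
  obtain ⟨z, hz, rfl⟩ := (hf.mono hDB).mem_img.1 hsD
  have hγz : ∀ b : B, (γ b : P) = z * b * z⁻¹ := by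
    intro b
    have h1 := hsf b
    rw [← hf.map_conj (hDB hz) b.2] at h1
    exact hf.inj (γ b).2 (mul_mem (mul_mem (hDB hz) b.2) (inv_mem (hDB hz))) h1
  refine ⟨z, hz, fun d hd => ?_, fun b hb => ?_⟩
  · have h1 := hγz ⟨d, hDB hd⟩
    rw [hγd _ hd] at h1
    exact (eq_mul_inv_iff_mul_eq.1 h1).symm
  · obtain ⟨c, _, h1, h2⟩ := hγb ⟨b, hb⟩
    rw [h1, ← h2, hγz]

theorem _root_.Subgroup.card_lt_of_lt {A B : Subgroup P} (h : A < B) :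
    Nat.card A < Nat.card B := by
  by_contra hcon
  exact h.ne (Subgroup.eq_of_le_of_card_ge h.le (not_lt.1 hcon))

theorem _root_.IsPGroup.lt_inf_normalizer {D B : Subgroup P} (hB : IsPGroup p B) (h : D < B) :
    D < B ⊓ Subgroup.normalizer (D : Set P) := by
  obtain ⟨s, hs, hsD, hs'⟩ := hB.exists_normalizing_of_lt h
  refine lt_of_le_of_ne (le_inf h.le Subgroup.le_normalizer) fun e => hsD ?_
  rw [e]
  exact ⟨hs, Subgroup.mem_normalizer_iff.2 hs'⟩

/-- Two morphisms that agree on a centric subgroup differ by conjugation by an element of its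
center. -/
theorem IsCentric.exists_eq_conj (hS : IsPGroup p S) (hF : F.IsSaturated p)
    (hD : F.IsCentric D) (hDB : D ≤ B) (hχ : F.IsMor B S χ) (hχ' : F.IsMor B S χ')
    (e : ∀ d ∈ D, χ' d = χ d) :
    ∃ z ∈ D, (∀ d ∈ D, z * d = d * z) ∧ ∀ b ∈ B, χ' b = χ (z * b * z⁻¹) := by
  induction hc : Nat.card B - Nat.card D using Nat.strong_induction_on generalizing D χ with
  | _ n ih =>
    rcases hDB.eq_or_lt with rfl | hlt
    · exact ⟨1, one_mem _, fun d _ => by simp, fun b hb => by simpa using e b hb⟩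
    have hN := (hS.to_le hχ.left_le).lt_inf_normalizer hlt
    have hNB : B ⊓ Subgroup.normalizer (D : Set P) ≤ B := inf_le_left
    -- The normal case handles `N_B(D)`. After replacing `χ` by `χ ∘ c_z` the two morphisms agree on
    -- this larger subgroup, and the induction proceeds from there.
    obtain ⟨z, hz, hzD, h1⟩ := hD.eq_conj_of_normal hS hF hN.le
      (fun b hb d hd => (Subgroup.mem_normalizer_iff.1 hb.2 d).1 hd) (hχ.mono hNB)
      (hχ'.mono hNB) e
    have hmem : ∀ b ∈ B, z * b * z⁻¹ ∈ B := fun b hb =>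
      mul_mem (mul_mem (hDB hz) hb) (inv_mem (hDB hz))
    have h2 : F.IsMor B S (χ ∘ fun b => z * b * z⁻¹) :=
      hχ.comp (F.isMor_conj (hD.1 hz) hχ.left_le hχ.left_le hmem)
    have h3 := Subgroup.card_lt_of_lt hN
    have h4 := Subgroup.card_le_of_le hNB
    obtain ⟨z', hz', hzD', h5⟩ := ih _ (by omega) (hD.mono hN.le (hNB.trans hχ.left_le)) hNB h2
      h1 rfl
    -- The second element is central in `N_B(D)`, so it centralizes `D` and lies in `D` by
    -- centricity.
    have hz'D : z' ∈ D := hD.mem (hχ.left_le (hNB hz')) fun d hd => hzD' d (hN.le hd)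
    refine ⟨z * z', mul_mem hz hz'D, fun d hd => ?_, fun b hb => ?_⟩
    · rw [mul_assoc, hzD' d (hN.le hd), ← mul_assoc, hzD d hd, mul_assoc]
    · rw [h5 b hb, Function.comp_apply]
      congr 1
      group

/-- A morphism `A → K` from a centric subgroup `A ≤ H` extends to the elements of `N_H(A)` that
act on its image like elements of `K`. -/
theorem IsCentric.exists_extend (hS : IsPGroup p S) (hF : F.IsSaturated p) (hH : H ≤ S)
    (hA : F.IsCentric A) (hAH : A ≤ H) (hf : F.IsMor A K f) :
    ∃ N χ, A ≤ N ∧ N ≤ H ∧ F.IsMor N K χ ∧ (∀ a ∈ A, χ a = f a) ∧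
      ∀ g ∈ H, (∀ a, a ∈ A ↔ g * a * g⁻¹ ∈ A) → ∀ k ∈ K,
        (∀ a ∈ A, f (g * a * g⁻¹) = k * f a * k⁻¹) → g ∈ N := by
  let N : Subgroup P :=
    { carrier := {g | g ∈ H ∧ (∀ a, a ∈ A ↔ g * a * g⁻¹ ∈ A) ∧
        ∃ k ∈ K, ∀ a ∈ A, f (g * a * g⁻¹) = k * f a * k⁻¹}
      one_mem' := ⟨one_mem _, fun a => by simp, 1, one_mem _, fun a _ => by simp⟩
      mul_mem' := by
        rintro x y ⟨hx, hxA, k, hk, ek⟩ ⟨hy, hyA, l, hl, el⟩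
        have e0 : ∀ a, x * y * a * (x * y)⁻¹ = x * (y * a * y⁻¹) * x⁻¹ := fun a => by group
        refine ⟨mul_mem hx hy, fun a => ?_, k * l, mul_mem hk hl, fun a ha => ?_⟩
        · rw [hyA, hxA, e0]
        · rw [e0, ek _ ((hyA a).1 ha), el a ha]
          group
      inv_mem' := by
        rintro x ⟨hx, hxA, k, hk, ek⟩
        have e0 : ∀ a, x * (x⁻¹ * a * x⁻¹⁻¹) * x⁻¹ = a := fun a => by group
        have e1 : ∀ a, a ∈ A ↔ x⁻¹ * a * x⁻¹⁻¹ ∈ A := fun a => by rw [hxA (x⁻¹ * a * x⁻¹⁻¹), e0]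
        refine ⟨inv_mem hx, e1, k⁻¹, inv_mem hk, fun a ha => ?_⟩
        have h1 := ek _ ((e1 a).1 ha)
        rw [e0] at h1
        rw [h1]
        group }
  have hNH : N ≤ H := fun g hg => hg.1
  have hAN : A ≤ N := by
    intro a ha
    refine ⟨hAH ha, fun b => ?_, f a, hf.mem ha, fun b hb => hf.map_conj ha hb⟩
    rw [Subgroup.mul_mem_cancel_right _ (inv_mem ha), Subgroup.mul_mem_cancel_left _ ha]
  set C := img A f with hC
  have hfC := hf.to_img
  have hCK : C ≤ K := hf.img_le
  have hCS : C ≤ S := hCK.trans hf.right_le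
  -- The image `C = f(A)` need not be fully normalized, so pass to a fully normalized copy `ψ(C)`,
  -- with `ψ` carrying `Aut_S(C)` into `Aut_S(ψ(C))`. Then `ψ` extends to a map `ψ₁` defined on all
  -- of `N_K(C)`, and `ψ ∘ f` extends to a map `χ` defined on `N`. The extension sought is `ψ₁⁻¹ ∘
  -- χ`.
  obtain ⟨ψ, hψ, hψn, hψQ⟩ := exists_isMor_innAut hS hF hCS (innAut_le_aut (F := F) hCS)
    (isPGroup_innAut hS C)
  obtain ⟨N₁, ψ₁, hCN₁, hψ₁, hψ₁e, hN₁⟩ := hψ.extend hF hψn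
  have himg : img A (ψ ∘ f) = img C ψ := hfC.img_comp hψ
  obtain ⟨N₂, χ, hAN₂, hχ, hχe, hN₂⟩ := (hψ.comp hfC).extend hF (by rwa [himg])
  have hkC : ∀ g k, (∀ a, a ∈ A ↔ g * a * g⁻¹ ∈ A) →
      (∀ a ∈ A, f (g * a * g⁻¹) = k * f a * k⁻¹) → ∀ c, c ∈ C ↔ k * c * k⁻¹ ∈ C := by
    intro g k hgA hk
    have h1 : ∀ c ∈ C, k * c * k⁻¹ ∈ C := by
      intro c hc
      obtain ⟨a, ha, rfl⟩ := hf.mem_img.1 hc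
      rw [← hk a ha]
      exact IsMor.apply_mem_img ((hgA a).1 ha)
    have h2 : k ∈ Subgroup.normalizer (C : Set P) :=
      Subgroup.mem_normalizer_fintype h1
    exact Subgroup.mem_normalizer_iff.1 h2
  have hkN₁ : ∀ k ∈ K, (∀ c, c ∈ C ↔ k * c * k⁻¹ ∈ C) → k ∈ N₁ := by
    intro k hk hkc
    obtain ⟨e, he, hek⟩ := (F.isMor_conj (hf.right_le hk) hCS hCS
      fun c hc => (hkc c).1 hc).exists_aut
    obtain ⟨s, hs, hse⟩ := hψQ e ⟨k, hf.right_le hk, hek⟩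
    refine hN₁ k (hf.right_le hk) hkc s hs fun c hc => ?_
    rw [← hse ⟨c, hc⟩, hek]
  have hψ₁k : ∀ k (hk : k ∈ N₁) (hkc : ∀ c, c ∈ C ↔ k * c * k⁻¹ ∈ C), ∀ c ∈ C,
      ψ (k * c * k⁻¹) = ψ₁ k * ψ c * (ψ₁ k)⁻¹ := by
    intro k hk hkc c hc
    rw [← hψ₁e _ ((hkc c).1 hc), hψ₁.map_conj hk (hCN₁ hc), hψ₁e c hc]
  have hNN₂ : N ≤ N₂ := by
    rintro g ⟨hg, hgA, k, hk, ek⟩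
    have hkc := hkC g k hgA ek
    refine hN₂ g (hH hg) hgA (ψ₁ k) (hψ₁.mem (hkN₁ k hk hkc)) fun a ha => ?_
    rw [Function.comp_apply, ek a ha,
      hψ₁k k (hkN₁ k hk hkc) hkc _ (IsMor.apply_mem_img ha)]
    rfl
  -- If `g ∈ N` acts on `C` like `k ∈ K`, then `ψ₁(k)⁻¹ χ(g)` centralizes `ψ(C)`, so it lies in
  -- `ψ(C)` because `A` is centric. Thus `χ(N)` lies in the image under `ψ₁` of `K ⊓ N₁`, and
  -- undoing `ψ₁` gives values in `K`.
  have hχN : ∀ n ∈ N, ∃ k ∈ K ⊓ N₁, ψ₁ k = χ n := by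
    rintro g ⟨hg, hgA, k, hk, ek⟩
    have hgN₂ : g ∈ N₂ := hNN₂ ⟨hg, hgA, k, hk, ek⟩
    have hkc := hkC g k hgA ek
    have hkN := hkN₁ k hk hkc
    have h1 : (ψ₁ k)⁻¹ * χ g ∈ img A (ψ ∘ f) := by
      refine hA.mem_img (hψ.comp hfC) (mul_mem (inv_mem (hψ₁.mem hkN)) (hχ.mem hgN₂))
        fun a ha => ?_
      have h2 := hχ.map_conj hgN₂ (hAN₂ ha)
      rw [hχe _ ((hgA a).1 ha), hχe a ha, Function.comp_apply, ek a ha,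
        hψ₁k k hkN hkc _ (IsMor.apply_mem_img ha)] at h2
      rw [eq_mul_inv_iff_mul_eq] at h2
      have h3 : χ g * (ψ ∘ f) a = ψ₁ k * (ψ ∘ f) a * ((ψ₁ k)⁻¹ * χ g) := by
        rw [← h2, Function.comp_apply]
        group
      rw [mul_assoc, h3]
      group
    rw [himg] at h1
    obtain ⟨c, hc, h2⟩ := hψ.mem_img.1 h1
    refine ⟨k * c, ⟨mul_mem hk (hCK hc), mul_mem hkN (hCN₁ hc)⟩, ?_⟩
    rw [hψ₁.map_mul hkN (hCN₁ hc), hψ₁e c hc, h2, mul_inv_cancel_left]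
  have hψ₂ : F.IsMor (K ⊓ N₁) S ψ₁ := hψ₁.mono inf_le_right
  obtain ⟨θ, hθ, hθe, _⟩ := hψ₂.exists_inv
  have hχ₂ : F.IsMor N (img (K ⊓ N₁) ψ₁) χ := by
    refine (hχ.mono hNN₂).cod hθ.left_le fun n hn => ?_
    obtain ⟨k, hk, h1⟩ := hχN n hn
    rw [← h1]
    exact IsMor.apply_mem_img hk
  refine ⟨N, θ ∘ χ, hAN, hNH, (hθ.comp hχ₂).mono_right inf_le_left hf.right_le, fun a ha => ?_,
    fun g hg hgA k hk ek => ⟨hg, hgA, k, hk, ek⟩⟩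
  have hfa : f a ∈ C := IsMor.apply_mem_img ha
  rw [Function.comp_apply, hχe a ha, Function.comp_apply, ← hψ₁e _ hfa,
    hθe _ ⟨hCK hfa, hCN₁ hfa⟩]

/-- Maximal extensions of a morphism from a centric subgroup have the same source. -/
theorem IsCentric.eq_of_isMaxMor (hS : IsPGroup p S) (hF : F.IsSaturated p) (hH : H ≤ S)
    (hD : F.IsCentric D) (hDA : D ≤ A) (hDB : D ≤ B) (hA : A ≤ H) (hB : B ≤ H)
    (hf : F.IsMor A K f) (hg : F.IsMor B K g) (e : ∀ d ∈ D, g d = f d)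
    (hfm : F.IsMaxMor H K A f) (hgm : F.IsMaxMor H K B g) : A = B := by
  induction hc : Nat.card S - Nat.card D using Nat.strong_induction_on
    generalizing D A B f g with
  | _ n ih =>
    rcases hDA.eq_or_lt with rfl | hltA
    · exact Subgroup.eq_of_le_of_card_ge hDB (hfm B g hB (hD.mono hDB hg.left_le) hg
        (PrecFn.of_eq hDB fun a ha => (e a ha).symm))
    rcases hDB.eq_or_lt with rfl | hltB
    · exact (Subgroup.eq_of_le_of_card_ge hDA (hgm A f hA (hD.mono hDA hf.left_le) hf
        (PrecFn.of_eq hDA e))).symm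
    -- The extension to `N` serves as an intermediary, since `N` contains both `N_A(D)` and
    -- `N_B(D)`. Each of `A` and `B` is shown equal to the source `C` of a maximal extension of `χ`.
    obtain ⟨N, χ, hDN, hNH, hχ, hχe, hN⟩ := hD.exists_extend hS hF hH (hDA.trans hA) (hf.mono hDA)
    obtain ⟨C, χ', hNC, hCH, hχ', hχχ, hmax⟩ := hχ.exists_isMaxMor hH hNH
    have key : ∀ (E : Subgroup P) (u : P → P), D < E → E ≤ H → F.IsMor E K u →
        (∀ d ∈ D, u d = f d) → F.IsMaxMor H K E u → E = C := by
      intro E u hlt hE hu hue hum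
      have hlt' := (hS.to_le hu.left_le).lt_inf_normalizer hlt
      have hEE : E ⊓ Subgroup.normalizer (D : Set P) ≤ E := inf_le_left
      have hEN : E ⊓ Subgroup.normalizer (D : Set P) ≤ N := by
        rintro x ⟨hx, hxD⟩
        have hxD' := Subgroup.mem_normalizer_iff.1 hxD
        refine hN x (hE hx) hxD' (u x) (hu.mem hx) fun d hd => ?_
        rw [← hue _ ((hxD' d).1 hd), ← hue d hd, hu.map_conj hx (hlt.le hd)]
      -- On `N_E(D)` the maps `u` and `χ'` differ by some `z ∈ D`. Replacing `χ'` by `χ' ∘ c_z`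
      -- amounts to conjugation by `χ'(z) ∈ K`, so maximality is kept; the maps now agree on a
      -- subgroup strictly larger than `D` and induction applies.
      obtain ⟨z, hz, _, hzu⟩ := hD.exists_eq_conj hS hF hlt'.le
        ((hχ'.mono (hEN.trans hNC)).mono_right hχ.right_le le_rfl)
        ((hu.mono hEE).mono_right hχ.right_le le_rfl)
        (fun d hd => by rw [hue d hd, hχχ d (hDN hd), hχe d hd])
      have hzC : z ∈ C := hNC (hDN hz)
      have hmor : F.IsMor C K (χ' ∘ fun b => z * b * z⁻¹) :=
        hχ'.comp (F.isMor_conj (hD.1 hz) hχ'.left_le hχ'.left_le fun b hb =>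
          mul_mem (mul_mem hzC hb) (inv_mem hzC))
      have hmax' : F.IsMaxMor H K C (χ' ∘ fun b => z * b * z⁻¹) := by
        refine hmax.of_prec ⟨1, one_mem _, (χ' z)⁻¹, inv_mem (hχ'.mem hzC), fun a ha => ?_⟩ rfl
        have h1 := hχ'.map_conj hzC ha
        simp only [Function.comp_apply, inv_one, one_mul, mul_one, h1]
        exact ⟨ha, by group⟩
      have h3 := Subgroup.card_lt_of_lt hlt'
      have h4 := Subgroup.card_le_of_le (hEE.trans hu.left_le)
      exact ih _ (by omega) (hD.mono hlt'.le (hEE.trans hu.left_le)) hEE (hEN.trans hNC) hE hCH hu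
        hmor (fun d hd => (hzu d hd).symm) hum hmax' rfl
    exact (key A f hltA hA hf (fun _ _ => rfl) hfm).trans (key B g hltB hB hg e hgm).symm

end Extension

end FusionSystem

/-! ### Unique factorization through `[H ×_F K]` -/

namespace FusionSystem

section Products

variable {P : Type u} [Group P] {S : Subgroup P} {F : FusionSystem S}
  {A B C D H K : Subgroup P} {f g : P → P}

theorem PrecFn.congr (h : PrecFn H K A f B g) {f' g' : P → P} (hf : ∀ a ∈ A, f a = f' a)
    (hg : ∀ b ∈ B, g b = g' b) : PrecFn H K A f' B g' :=
  ((PrecFn.of_eq le_rfl fun a ha => (hf a ha).symm).trans h).trans (PrecFn.of_eq le_rfl hg)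

/-- Equality of classes in the orbit category means equality up to conjugation by some `k ∈ K`, so
the preorder can be read on any representatives. -/
theorem ProdPair.precedes_iff {hH : H ≤ S} {x y : F.ProdPair H K} {φ : x.A →* K} {ψ : y.A →* K}
    {hφ : φ ∈ F.Hom x.A K} {hψ : ψ ∈ F.Hom y.A K} (ex : OrbitHom.mk φ hφ = x.hom)
    (ey : OrbitHom.mk ψ hψ = y.hom) :
    x.Precedes hH y ↔ PrecFn H K x.A (extFun φ) y.A (extFun ψ) := by
  have hmem : ∀ (h : P) (a : x.A), h⁻¹ * a * h ∈ conjBy x.A h := fun h a =>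
    ⟨a, a.2, by simp⟩
  have hconj : ∀ (h : P) (a : x.A), conjHom x.A h ⟨_, hmem h a⟩ = a := fun h a =>
    Subtype.ext (by simp [conjHom, mul_assoc])
  have hback : ∀ (h : P) (b : conjBy x.A h), (b : P) = h⁻¹ * conjHom x.A h b * h := fun h b => by
    simp [conjHom, mul_assoc]
  rw [ProdPair.Precedes, ← ex, ← ey]
  constructor
  · rintro ⟨h, hh, hle, e⟩
    obtain ⟨k, hk⟩ := Quotient.exact e
    refine ⟨h, hh, (k : P)⁻¹, inv_mem k.2, fun a ha => ⟨hle (hmem h ⟨a, ha⟩), ?_⟩⟩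
    have h1 := hk ⟨_, hmem h ⟨a, ha⟩⟩
    change ψ ⟨_, hle (hmem h ⟨a, ha⟩)⟩ = k * φ (conjHom x.A h ⟨_, hmem h ⟨a, ha⟩⟩) * k⁻¹ at h1
    rw [hconj] at h1
    rw [extFun_mk φ ha, extFun_mk ψ (hle (hmem h ⟨a, ha⟩)), h1]
    simp [mul_assoc]
  · rintro ⟨h, hh, k, hk, e⟩
    have hle : conjBy x.A h ≤ y.A := by
      intro b hb
      have h1 := hback h ⟨b, hb⟩
      dsimp only at h1
      rw [h1]
      exact (e _ (conjHom x.A h ⟨b, hb⟩).2).1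
    refine ⟨h, hh, hle, Quotient.sound ⟨⟨k, hk⟩⁻¹, fun b => ?_⟩⟩
    change ψ ⟨b, hle b.2⟩ = (⟨k, hk⟩ : K)⁻¹ * φ (conjHom x.A h b) * (⟨k, hk⟩ : K)⁻¹⁻¹
    have h1 := (e _ (conjHom x.A h b).2).2
    rw [← hback h b, extFun_coe, extFun_mk ψ (hle b.2)] at h1
    refine Subtype.ext ?_
    simp only [Subgroup.coe_mul, Subgroup.coe_inv, h1]
    group

theorem OrbitHom.exists_rep (x : F.OrbitHom A K) : ∃ φ, ∃ h : φ ∈ F.Hom A K, OrbitHom.mk φ h = x := by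
  induction x using Quotient.inductionOn with | _ φ => exact ⟨φ.1, φ.2, rfl⟩

theorem IsMor.exists_prodPair (hf : F.IsMor A K f) (hA : F.IsCentric A) (hAH : A ≤ H) :
    ∃ (x : F.ProdPair H K) (φ : x.A →* K) (h : φ ∈ F.Hom x.A K),
      x.A = A ∧ OrbitHom.mk φ h = x.hom ∧ ∀ a ∈ A, extFun φ a = f a := by
  obtain ⟨φ, hφ, e⟩ := hf
  refine ⟨⟨A, hAH, hA, OrbitHom.mk φ hφ⟩, φ, hφ, rfl, rfl, fun a ha => ?_⟩
  rw [extFun_mk φ ha]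
  exact e ⟨a, ha⟩

theorem PrecFn.exists_image (h : PrecFn H K A f B g) : ∃ h ∈ H, ∃ k ∈ K, ∃ C ≤ B,
    Nat.card C = Nat.card A ∧ (∀ b ∈ C, h * b * h⁻¹ ∈ A ∧ g b = k * f (h * b * h⁻¹) * k⁻¹) := by
  obtain ⟨h, hh, k, hk, e⟩ := h
  refine ⟨h, hh, k⁻¹, inv_mem hk, A.map (MulAut.conj h⁻¹).toMonoidHom, ?_, ?_, ?_⟩
  · rintro _ ⟨a, ha, rfl⟩
    simpa using (e a ha).1
  · exact (Nat.card_congr (A.equivMapOfInjective _ (MulAut.conj h⁻¹).injective).toEquiv).symm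
  · rintro _ ⟨a, ha, rfl⟩
    have h1 : h * (MulAut.conj h⁻¹).toMonoidHom a * h⁻¹ = a := by simp [mul_assoc]
    rw [h1]
    refine ⟨ha, ?_⟩
    have h2 := (e a ha).2
    simp only [MulEquiv.toMonoidHom_eq_coe, MonoidHom.coe_coe, MulAut.conj_apply, inv_inv]
    rw [h2]
    group

theorem IsProduct.eq_of_prec {hH : H ≤ S} {Q : Set (F.ProdPair H K)} (hQ : F.IsProduct hH Q) {q q' : F.ProdPair H K} (hq : q ∈ Q) (hq' : q' ∈ Q)
    (h : q.Precedes hH q') : q = q' := by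
  obtain ⟨φ, hφ, e⟩ := q'.hom.exists_rep
  have hrefl : q'.Precedes hH q' :=
    (ProdPair.precedes_iff e e).2 (PrecFn.of_eq le_rfl fun _ _ => rfl)
  exact (hQ.2 q' (hQ.1 q' hq')).unique ⟨hq, h, hQ.1 q hq q' h⟩ ⟨hq', hrefl, hrefl⟩

variable [Finite P]

theorem PrecFn.card_le (h : PrecFn H K A f B g) : Nat.card A ≤ Nat.card B := by
  obtain ⟨_, _, _, _, C, hC, hcard, _⟩ := h.exists_image
  rw [← hcard]
  exact Subgroup.card_le_of_le hC

/-- Conjugation embeds `A` in `B`; when the orders allow it, the embedding is onto and can be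
inverted. Maximality for the preorder thus becomes a statement about orders, as in `IsMaxMor`. -/
theorem PrecFn.symm_of_card_le (h : PrecFn H K A f B g) (hc : Nat.card B ≤ Nat.card A) :
    PrecFn H K B g A f := by
  obtain ⟨x, hx, k, hk, C, hC, hcard, e⟩ := h.exists_image
  obtain rfl := Subgroup.eq_of_le_of_card_ge hC (hcard ▸ hc)
  exact ⟨x⁻¹, inv_mem hx, k, hk, fun b hb => by simpa using e b hb⟩

theorem ProdPair.isMaximal_iff {hH : H ≤ S} {x : F.ProdPair H K} {φ : x.A →* K}
    {hφ : φ ∈ F.Hom x.A K} (ex : OrbitHom.mk φ hφ = x.hom) :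
    x.IsMaximal hH ↔ F.IsMaxMor H K x.A (extFun φ) := by
  constructor
  · intro h B g hB hBc hg hp
    obtain ⟨y, ψ, hψ, rfl, ey, e⟩ := hg.exists_prodPair hBc hB
    have h1 := h y ((ProdPair.precedes_iff ex ey).2
      (hp.congr (fun _ _ => rfl) fun b hb => (e b hb).symm))
    exact ((ProdPair.precedes_iff ey ex).1 h1).card_le
  · intro h y hy
    obtain ⟨ψ, hψ, ey⟩ := y.hom.exists_rep
    have h1 := (ProdPair.precedes_iff ex ey).1 hy
    exact (ProdPair.precedes_iff ey ex).2
      (h1.symm_of_card_le (h _ _ y.le y.centric (isMor_extFun hψ) h1))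

namespace IsProduct

variable {hH : H ≤ S} {Q : Set (F.ProdPair H K)}

theorem isMaxMor (hQ : F.IsProduct hH Q) {q : F.ProdPair H K} (hq : q ∈ Q) {φ : q.A →* K}
    {hφ : φ ∈ F.Hom q.A K} (e : OrbitHom.mk φ hφ = q.hom) : F.IsMaxMor H K q.A (extFun φ) :=
  (ProdPair.isMaximal_iff e).1 (hQ.1 q hq)

/-- A maximal extension of `f` gives a maximal pair, and this pair is equivalent to an element of
`Q`. -/
theorem exists_prec (hQ : F.IsProduct hH Q) (hA : F.IsCentric A) (hAH : A ≤ H)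
    (hf : F.IsMor A K f) : ∃ q ∈ Q, ∀ (φ : q.A →* K) (hφ : φ ∈ F.Hom q.A K),
      OrbitHom.mk φ hφ = q.hom → PrecFn H K A f q.A (extFun φ) := by
  obtain ⟨B, g, hAB, hBH, hg, hgf, hmax⟩ := hf.exists_isMaxMor hH hAH
  obtain ⟨y, ψ, hψ, rfl, ey, e⟩ := hg.exists_prodPair (hA.mono hAB hg.left_le) hBH
  have hymax : y.IsMaximal hH := (ProdPair.isMaximal_iff ey).2
    (hmax.of_prec (PrecFn.of_eq le_rfl fun a ha => (e a ha).symm) rfl)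
  obtain ⟨q, ⟨hq, _, hyq⟩, _⟩ := hQ.2 y hymax
  refine ⟨q, hq, fun φ hφ eq => ?_⟩
  refine (PrecFn.of_eq hAB fun a ha => ?_).trans ((ProdPair.precedes_iff ey eq).1 hyq)
  rw [e a (hAB ha), hgf a ha]

/-- A morphism `f : D → K` from a centric subgroup `D ≤ H` factors through a unique element of
`[H × K]`, in an essentially unique way. -/
theorem unique_factorization {p : ℕ} [Fact p.Prime] (hS : IsPGroup p S) (hF : F.IsSaturated p)
    (hQ : F.IsProduct hH Q) (hD : F.IsCentric D) {q q' : F.ProdPair H K} (hq : q ∈ Q)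
    (hq' : q' ∈ Q) {φ : q.A →* K} {φ' : q'.A →* K} {hφ : φ ∈ F.Hom q.A K}
    {hφ' : φ' ∈ F.Hom q'.A K} (e : OrbitHom.mk φ hφ = q.hom) (e' : OrbitHom.mk φ' hφ' = q'.hom)
    {h h' k k' : P} (hh : h ∈ H) (hh' : h' ∈ H) (hk : k ∈ K) (hk' : k' ∈ K)
    (hf : ∀ d ∈ D, h * d * h⁻¹ ∈ q.A ∧ f d = k * extFun φ (h * d * h⁻¹) * k⁻¹)
    (hf' : ∀ d ∈ D, h' * d * h'⁻¹ ∈ q'.A ∧ f d = k' * extFun φ' (h' * d * h'⁻¹) * k'⁻¹) :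
    q = q' ∧ h' * h⁻¹ ∈ q.A := by
  -- Each factorization yields an extension of `f` to `B = h⁻¹ q.A h`, and it is maximal because it
  -- is conjugate to the maximal `φ`.
  have key : ∀ {q : F.ProdPair H K} (_ : q ∈ Q) {φ : q.A →* K} {hφ : φ ∈ F.Hom q.A K}
      (_ : OrbitHom.mk φ hφ = q.hom) {h k : P} (_ : h ∈ H) (_ : k ∈ K)
      (_ : ∀ d ∈ D, h * d * h⁻¹ ∈ q.A ∧ f d = k * extFun φ (h * d * h⁻¹) * k⁻¹),
      ∃ B, D ≤ B ∧ B ≤ H ∧ (∀ x, x ∈ B ↔ h * x * h⁻¹ ∈ q.A) ∧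
        F.IsMor B K (fun x => k * extFun φ (h * x * h⁻¹) * k⁻¹) ∧
        F.IsMaxMor H K B (fun x => k * extFun φ (h * x * h⁻¹) * k⁻¹) := by
    intro q hq φ hφ e h k hh hk hf
    obtain ⟨B, hB, hcard, hmem, hmor⟩ :=
      (isMor_extFun hφ).transport hH q.le (inv_mem hh) hk
    simp only [inv_inv] at hmem hmor
    refine ⟨B, fun d hd => (hmem d).2 (hf d hd).1, hB, hmem, hmor, ?_⟩
    refine (hQ.isMaxMor hq e).of_prec ⟨h, hh, k⁻¹, inv_mem hk, fun a ha => ?_⟩ hcard.symm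
    rw [hmem, show h * (h⁻¹ * a * h) * h⁻¹ = a by group]
    exact ⟨ha, by group⟩
  obtain ⟨B, hDB, hBH, hB, hmor, hmax⟩ := key hq e hh hk hf
  obtain ⟨B', hDB', hBH', hB', hmor', hmax'⟩ := key hq' e' hh' hk' hf'
  have hef : ∀ d ∈ D, (fun x => k' * extFun φ' (h' * x * h'⁻¹) * k'⁻¹) d =
      (fun x => k * extFun φ (h * x * h⁻¹) * k⁻¹) d := fun d hd => by
    exact (hf' d hd).2.symm.trans (hf d hd).2
  obtain rfl := hD.eq_of_isMaxMor hS hF hH hDB hDB' hBH hBH' hmor hmor' hef hmax hmax'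
  -- The two extensions have the same source and agree on `D`, so they differ by some `z ∈ D`. Hence
  -- `φ` and `φ'` are conjugate through `h' h⁻¹ ∈ H` and an element of `K`, and `q = q'`.
  obtain ⟨z, hz, _, hzb⟩ := hD.exists_eq_conj hS hF hDB (hmor'.mono_right hmor.right_le le_rfl)
    (hmor.mono_right hmor.right_le le_rfl) fun d hd => (hef d hd).symm
  have hzB := hDB hz
  set χ' : P → P := fun x => k' * extFun φ' (h' * x * h'⁻¹) * k'⁻¹ with hχ'
  have hzb' : ∀ b ∈ B, k * extFun φ (h * b * h⁻¹) * k⁻¹ = χ' z * χ' b * (χ' z)⁻¹ := fun b hb =>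
    (hzb b hb).trans (hmor'.map_conj hzB hb)
  have hconj : ∀ a ∈ q.A, h⁻¹ * a * h ∈ B := fun a ha => by
    rw [hB, show h * (h⁻¹ * a * h) * h⁻¹ = a by group]
    exact ha
  have hval : ∀ a ∈ q.A, (h' * h⁻¹) * a * (h' * h⁻¹)⁻¹ ∈ q'.A ∧ extFun φ a =
      (k⁻¹ * χ' z * k') * extFun φ' ((h' * h⁻¹) * a * (h' * h⁻¹)⁻¹) * (k⁻¹ * χ' z * k')⁻¹ := by
    intro a ha
    have h1 := hconj a ha
    have h2 := hzb' _ h1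
    rw [show h * (h⁻¹ * a * h) * h⁻¹ = a by group] at h2
    have h3 : h' * (h⁻¹ * a * h) * h'⁻¹ = (h' * h⁻¹) * a * (h' * h⁻¹)⁻¹ := by group
    refine ⟨h3 ▸ (hB' _).1 h1, ?_⟩
    have h4 : extFun φ a = k⁻¹ * (k * extFun φ a * k⁻¹) * k := by group
    rw [h4, h2]
    simp only [hχ', h3]
    group
  have hkk : k⁻¹ * χ' z * k' ∈ K := mul_mem (mul_mem (inv_mem hk) (hmor'.mem hzB)) hk'
  have hqq : q = q' := by
    refine hQ.eq_of_prec hq hq' ((ProdPair.precedes_iff e e').2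
      ⟨(h' * h⁻¹)⁻¹, inv_mem (mul_mem hh' (inv_mem hh)), _, hkk, fun a ha => ?_⟩)
    rw [inv_inv]
    exact hval a ha
  subst hqq
  refine ⟨rfl, ?_⟩
  -- Even when `q = q'`, the maps `φ` and `φ'` may be different representatives of one class; `m`
  -- records the difference.
  obtain ⟨m, hm, hφφ⟩ : ∃ m ∈ K, ∀ a ∈ q.A, extFun φ a = m * extFun φ' a * m⁻¹ := by
    obtain ⟨c, hc⟩ := Quotient.exact (e'.trans e.symm)
    refine ⟨c, c.2, fun a ha => ?_⟩
    have h1 : φ ⟨a, ha⟩ = c * φ' ⟨a, ha⟩ * c⁻¹ := hc ⟨a, ha⟩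
    rw [extFun_mk φ ha, extFun_mk φ' ha, h1]
    rfl
  set g := h' * h⁻¹ with hg
  -- The element `g = h' h⁻¹` normalizes `q.A` and acts on its image like an element of `K`, so `φ`
  -- extends to a subgroup containing `g`. Maximality of `q` leaves no room beyond `q.A`.
  obtain ⟨N, χ, hAN, hNH, hχ, hχe, hN⟩ := q.centric.exists_extend hS hF hH q.le
    (isMor_extFun hφ)
  have hNA : q.A = N := Subgroup.eq_of_le_of_card_ge hAN
    ((hQ.isMaxMor hq e) N χ hNH (q.centric.mono hAN hχ.left_le) hχ
      (PrecFn.of_eq hAN fun a ha => (hχe a ha).symm))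
  rw [hNA]
  have hgn : g ∈ Subgroup.normalizer (q.A : Set P) :=
    Subgroup.mem_normalizer_fintype fun a ha => (hval a ha).1
  refine hN g (mul_mem hh' (inv_mem hh)) (Subgroup.mem_normalizer_iff.1 hgn)
    (m * (k⁻¹ * χ' z * k')⁻¹) (mul_mem hm (inv_mem hkk)) fun a ha => ?_
  have h1 := hval a ha
  rw [hφφ _ h1.1, h1.2]
  group

end IsProduct

end Products

end FusionSystem

/-! ### Transitive bisets, stabilizers and sums over orbits -/

namespace FinBiset

section

variable {A B C : Type u} [Group A] [Group B] [Group C] {X Y : FinBiset A B}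

/-- Every element of `X` is a translate of `x`. -/
def Generates (X : FinBiset A B) (x : X.carrier) : Prop := ∀ y, ∃ a b, y = X.l a (X.r x b)

theorem l_inv_l (X : FinBiset A B) (a : A) (x : X.carrier) : X.l a⁻¹ (X.l a x) = x := by
  rw [← X.mul_l, inv_mul_cancel, X.one_l]

theorem l_l_inv (X : FinBiset A B) (a : A) (x : X.carrier) : X.l a (X.l a⁻¹ x) = x := by
  rw [← X.mul_l, mul_inv_cancel, X.one_l]

theorem r_r_inv (X : FinBiset A B) (x : X.carrier) (b : B) : X.r (X.r x b) b⁻¹ = x := by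
  rw [← X.r_mul, mul_inv_cancel, X.r_one]

theorem r_inv_r (X : FinBiset A B) (x : X.carrier) (b : B) : X.r (X.r x b⁻¹) b = x := by
  rw [← X.r_mul, inv_mul_cancel, X.r_one]

theorem translate_eq_iff (X : FinBiset A B) (x : X.carrier) (a a' : A) (b b' : B) :
    X.l a (X.r x b) = X.l a' (X.r x b') ↔ X.l (a'⁻¹ * a) x = X.r x (b' * b⁻¹) := by
  rw [X.mul_l, X.r_mul]
  constructor
  · intro h
    have h1 := congrArg (fun y => X.r (X.l a'⁻¹ y) b⁻¹) h
    simp only [l_inv_l] at h1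
    rw [← X.l_r a, ← X.l_r a'⁻¹, r_r_inv] at h1
    exact h1
  · intro h
    have h1 := congrArg (fun y => X.r (X.l a' y) b) h
    simp only [l_l_inv] at h1
    rw [X.l_r, X.l_r, r_inv_r] at h1
    exact h1

/-- Two transitive bisets whose generators have the same stabilizer are isomorphic. -/
theorem nonempty_iso_of_generates {x : X.carrier} {y : Y.carrier} (hx : X.Generates x)
    (hy : Y.Generates y) (h : ∀ a b, X.l a x = X.r x b ↔ Y.l a y = Y.r y b) :
    Nonempty (Iso X Y) := by
  choose α β hαβ using hx
  have key : ∀ a b a' b', X.l a (X.r x b) = X.l a' (X.r x b') ↔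
      Y.l a (Y.r y b) = Y.l a' (Y.r y b') := fun a b a' b' => by
    rw [translate_eq_iff, translate_eq_iff, h]
  let f : X.carrier → Y.carrier := fun z => Y.l (α z) (Y.r y (β z))
  have hf : ∀ a b, f (X.l a (X.r x b)) = Y.l a (Y.r y b) := fun a b =>
    (key _ _ _ _).1 (hαβ _).symm
  have hbij : Function.Bijective f := by
    constructor
    · intro z z' e
      rw [hαβ z, hαβ z'] at e ⊢
      rw [hf, hf] at e
      exact (key _ _ _ _).2 e
    · intro z
      obtain ⟨a, b, rfl⟩ := hy z
      exact ⟨_, hf a b⟩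
  refine ⟨⟨Equiv.ofBijective f hbij, fun a z => ?_, fun z b => ?_⟩⟩
  · rw [hαβ z]
    change f (X.l a (X.l _ _)) = Y.l a (f _)
    rw [← X.mul_l, hf, hf, Y.mul_l]
  · rw [hαβ z]
    change f (X.r (X.l _ _) b) = Y.r (f _) b
    rw [X.l_r, ← X.r_mul, hf, hf, Y.r_mul, ← Y.l_r]

/-- By `h`, right translates of `x` are left translates, so the middle element of `B` can be
absorbed into `A` and the product has a single orbit. -/
theorem generates_comp {X : FinBiset A B} {Y : FinBiset B C} {x : X.carrier} {y : Y.carrier}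
    (hx : X.Generates x) (hy : Y.Generates y) (h : ∀ b, ∃ a, X.l a x = X.r x b) :
    (X.comp Y).Generates (comp.mk X Y x y) := by
  intro q
  induction q using comp.ind with
  | h x' y' =>
    obtain ⟨a, b, rfl⟩ := hx x'
    obtain ⟨b', c, rfl⟩ := hy y'
    obtain ⟨a', ha'⟩ := h (b * b')
    refine ⟨a * a', c, ?_⟩
    change comp.mk X Y _ _ = comp.mk X Y (X.l (a * a') x) (Y.r y c)
    rw [← comp.mk_r_l, X.mul_l, ha', X.l_r, X.r_mul]

/-- The stabilizer of a pair is the composite of the two stabilizers, seen as relations. -/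
theorem comp_l_eq_r_iff {X : FinBiset A B} {Y : FinBiset B C} (x : X.carrier) (y : Y.carrier)
    (a : A) (c : C) : (X.comp Y).l a (comp.mk X Y x y) = (X.comp Y).r (comp.mk X Y x y) c ↔
      ∃ b, X.l a x = X.r x b ∧ Y.l b y = Y.r y c :=
  Quotient.eq (r := compSetoid X Y) (x := (X.l a x, y)) (y := (x, Y.r y c))

section

variable [Finite A] [Finite B] {L L' : Type*} [Group L] [Group L']

/-- The base point of `(A × B) / {(f x, g x)}`. -/
def basePt (f : L →* A) (g : L →* B) : (ofHoms f g).carrier :=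
  QuotientGroup.mk (s := (f.prod g).range) 1

theorem generates_basePt (f : L →* A) (g : L →* B) : (ofHoms f g).Generates (basePt f g) := by
  intro y
  induction y using Quotient.inductionOn' with
  | _ q =>
    refine ⟨q.1, q.2⁻¹, ?_⟩
    refine congrArg (QuotientGroup.mk (s := (f.prod g).range)) ?_
    ext <;> simp

theorem basePt_l_eq_r_iff (f : L →* A) (g : L →* B) (a : A) (b : B) :
    (ofHoms f g).l a (basePt f g) = (ofHoms f g).r (basePt f g) b ↔ ∃ x, f x = a ∧ g x = b := by
  refine (QuotientGroup.eq (s := (f.prod g).range) (a := ((a, 1) : A × B) * 1)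
    (b := ((1, b⁻¹) : A × B) * 1)).trans ?_
  constructor
  · rintro ⟨x, hx⟩
    have h1 : f x = _ := congrArg Prod.fst hx
    have h2 : g x = _ := congrArg Prod.snd hx
    refine ⟨x⁻¹, ?_, ?_⟩
    · simp [h1]
    · simp [h2]
  · rintro ⟨x, rfl, rfl⟩
    refine ⟨x⁻¹, ?_⟩
    ext <;> simp

end

/-- A sub-biset. -/
def sub (X : FinBiset A B) (s : Set X.carrier) (hl : ∀ a, ∀ x ∈ s, X.l a x ∈ s)
    (hr : ∀ x ∈ s, ∀ b, X.r x b ∈ s) : FinBiset A B where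
  carrier := s
  finite := by
    have := X.finite
    infer_instance
  l a x := ⟨X.l a x, hl a x x.2⟩
  r x b := ⟨X.r x b, hr x x.2 b⟩
  one_l x := Subtype.ext (X.one_l _)
  mul_l _ _ _ := Subtype.ext (X.mul_l _ _ _)
  r_one x := Subtype.ext (X.r_one _)
  r_mul _ _ _ := Subtype.ext (X.r_mul _ _ _)
  l_r _ _ _ := Subtype.ext (X.l_r _ _ _)

/-- Two elements of a biset are related if they are translates of each other. -/
def orbitRel (X : FinBiset A B) : Setoid X.carrier where
  r x y := ∃ a b, y = X.l a (X.r x b)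
  iseqv := by
    refine ⟨fun x => ⟨1, 1, by rw [X.r_one, X.one_l]⟩, ?_, ?_⟩
    · rintro x _ ⟨a, b, rfl⟩
      exact ⟨a⁻¹, b⁻¹, by rw [X.l_r, r_r_inv, l_inv_l]⟩
    · rintro x _ _ ⟨a, b, rfl⟩ ⟨a', b', rfl⟩
      exact ⟨a' * a, b * b', by rw [X.l_r, X.mul_l, X.r_mul]⟩

/-- The set of pairs `(a, b)` with `a x = x b`. -/
def stab (X : FinBiset A B) (x : X.carrier) : Set (A × B) := {q | X.l q.1 x = X.r x q.2}

theorem mem_stab_translate (X : FinBiset A B) (x : X.carrier) (a a' : A) (b b' : B) :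
    (a, b) ∈ X.stab (X.l a' (X.r x b')) ↔ (a'⁻¹ * a * a', b' * b * b'⁻¹) ∈ X.stab x := by
  have h := X.translate_eq_iff x (a * a') a' b' (b' * b)
  rw [mul_assoc a'⁻¹, ← mul_assoc a'⁻¹, mul_assoc]
  refine Iff.trans ?_ h
  change X.l a _ = X.r _ b ↔ _
  rw [X.mul_l, X.l_r, X.r_mul]

/-- A function of stabilizers is invariant if it does not change under conjugation. -/
def Invariant {N : Type*} (v : Set (A × B) → N) : Prop :=
  ∀ s a b, v {q | (a⁻¹ * q.1 * a, b * q.2 * b⁻¹) ∈ s} = v s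

theorem Invariant.apply_translate {N : Type*} {v : Set (A × B) → N} (hv : Invariant v)
    (X : FinBiset A B) (x : X.carrier) (a : A) (b : B) :
    v (X.stab (X.l a (X.r x b))) = v (X.stab x) := by
  rw [← hv (X.stab x) a b]
  congr 1
  ext ⟨a', b'⟩
  exact X.mem_stab_translate x a' a b' b

theorem Iso.stab_apply (i : Iso X Y) (x : X.carrier) : Y.stab (i.e x) = X.stab x := by
  ext ⟨a, b⟩
  change Y.l a _ = Y.r _ b ↔ X.l a x = X.r x b
  rw [← i.map_l, ← i.map_r, i.e.injective.eq_iff]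

section OrbitSum

variable {N : Type*} [AddCommMonoid N] (v : Set (A × B) → N)

/-- The value at an orbit. -/
def orbitVal (hv : Invariant v) (X : FinBiset A B) : Quotient X.orbitRel → N :=
  Quotient.lift (fun x => v (X.stab x)) (by
    rintro x _ ⟨a, b, rfl⟩
    exact (hv.apply_translate X x a b).symm)

/-- The sum of the values of an invariant function at the orbits of a biset. -/
noncomputable def orbitSum (hv : Invariant v) (X : FinBiset A B) : N :=
  ∑ᶠ o, orbitVal v hv X o

variable {v} (hv : Invariant v)

theorem orbitSum_congr (i : Iso X Y) : orbitSum v hv X = orbitSum v hv Y := by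
  refine finsum_eq_of_bijective (Quotient.map i.e ?_) ?_ ?_
  · rintro x _ ⟨a, b, rfl⟩
    exact ⟨a, b, by rw [i.map_l, i.map_r]⟩
  · constructor
    · intro o o'
      induction o using Quotient.inductionOn
      induction o' using Quotient.inductionOn
      intro e
      obtain ⟨a, b, h⟩ := Quotient.exact e
      refine Quotient.sound ⟨a, b, i.e.injective ?_⟩
      rw [i.map_l, i.map_r, h]
    · intro o
      induction o using Quotient.inductionOn with
      | _ y => exact ⟨Quotient.mk _ (i.e.symm y), by simp [Quotient.map_mk]⟩
  · intro o
    induction o using Quotient.inductionOn with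
    | _ x => exact congrArg v (i.stab_apply x).symm

theorem orbitSum_empty : orbitSum v hv (empty A B) = 0 := by
  have : IsEmpty (Quotient (empty A B).orbitRel) :=
    ⟨fun o => by induction o using Quotient.inductionOn with | _ x => exact x.elim⟩
  exact finsum_of_isEmpty _

theorem orbitSum_sum (X Y : FinBiset A B) :
    orbitSum v hv (X.sum Y) = orbitSum v hv X + orbitSum v hv Y := by
  have := X.finite
  have := Y.finite
  have hl : ∀ x : X.carrier, (X.sum Y).stab (Sum.inl x) = X.stab x := fun x => by
    ext q
    exact Sum.inl_injective.eq_iff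
  have hr : ∀ y : Y.carrier, (X.sum Y).stab (Sum.inr y) = Y.stab y := fun x => by
    ext q
    exact Sum.inr_injective.eq_iff
  let F : Quotient X.orbitRel ⊕ Quotient Y.orbitRel → Quotient (X.sum Y).orbitRel :=
    Sum.elim (Quotient.map Sum.inl (by rintro x _ ⟨a, b, rfl⟩; exact ⟨a, b, rfl⟩))
      (Quotient.map Sum.inr (by rintro x _ ⟨a, b, rfl⟩; exact ⟨a, b, rfl⟩))
  have hF : Function.Bijective F := by
    constructor
    · rintro (o | o) (o' | o') <;> induction o using Quotient.inductionOn <;>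
        induction o' using Quotient.inductionOn <;> intro e <;>
        obtain ⟨a, b, h⟩ := Quotient.exact e
      · exact congrArg Sum.inl (Quotient.sound ⟨a, b, Sum.inl_injective h⟩)
      · cases h
      · cases h
      · exact congrArg Sum.inr (Quotient.sound ⟨a, b, Sum.inr_injective h⟩)
    · intro o
      induction o using Quotient.inductionOn with
      | _ s =>
        rcases s with x | y
        · exact ⟨Sum.inl (Quotient.mk _ x), rfl⟩
        · exact ⟨Sum.inr (Quotient.mk _ y), rfl⟩
  have e1 : orbitSum v hv (X.sum Y) = ∑ᶠ s, orbitVal v hv (X.sum Y) (F s) :=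
    (finsum_eq_of_bijective F hF fun _ => rfl).symm
  let _ := Fintype.ofFinite (Quotient X.orbitRel)
  let _ := Fintype.ofFinite (Quotient Y.orbitRel)
  rw [e1, orbitSum, orbitSum, finsum_eq_sum_of_fintype, finsum_eq_sum_of_fintype,
    finsum_eq_sum_of_fintype, Fintype.sum_sum_type]
  congr 1
  · refine Finset.sum_congr rfl fun o _ => ?_
    induction o using Quotient.inductionOn with | _ x => exact congrArg v (hl x)
  · refine Finset.sum_congr rfl fun o _ => ?_
    induction o using Quotient.inductionOn with | _ x => exact congrArg v (hr x)

theorem orbitSum_of_generates {x : X.carrier} (hx : X.Generates x) :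
    orbitSum v hv X = v (X.stab x) := by
  have hu : ∀ o : Quotient X.orbitRel, o = Quotient.mk _ x := by
    intro o
    induction o using Quotient.inductionOn with
    | _ y => exact (Quotient.sound (hx y)).symm
  exact (finsum_eq_single _ (Quotient.mk _ x) fun o ho => (ho (hu o)).elim)

end OrbitSum

end

end FinBiset

namespace BisetClass

section

variable {A B C : Type u} [Group A] [Group B] [Group C]

/-- The sum of the values of an invariant function at the orbits, as an additive map on classes
of bisets. -/
noncomputable def orbitSum {N : Type*} [AddCommMonoid N] (v : Set (A × B) → N)
    (hv : FinBiset.Invariant v) : BisetClass A B →+ N where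
  toFun x := Quotient.liftOn x (FinBiset.orbitSum v hv)
    (fun _ _ ⟨i⟩ => FinBiset.orbitSum_congr hv i)
  map_zero' := FinBiset.orbitSum_empty hv
  map_add' x y := by
    induction x using ind with | h X => ?_
    induction y using ind with | h Y => ?_
    exact FinBiset.orbitSum_sum hv X Y

theorem mk_eq_iff {X Y : FinBiset A B} : mk X = mk Y ↔ Nonempty (FinBiset.Iso X Y) :=
  Quotient.eq (r := FinBiset.setoid A B)

variable [Finite A] [Finite B] {L L' : Type*} [Group L] [Group L']

theorem orbitSum_ofHoms {N : Type*} [AddCommMonoid N] (v : Set (A × B) → N)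
    (hv : FinBiset.Invariant v) (f : L →* A) (g : L →* B) :
    orbitSum v hv (ofHoms f g) = v {q | ∃ x, f x = q.1 ∧ g x = q.2} := by
  refine (FinBiset.orbitSum_of_generates hv (FinBiset.generates_basePt f g)).trans ?_
  congr 1
  ext ⟨a, b⟩
  exact FinBiset.basePt_l_eq_r_iff f g a b

/-- Changing the base point of a transitive biset conjugates its stabilizer. -/
theorem ofHoms_eq {f : L →* A} {g : L →* B} {f' : L' →* A} {g' : L' →* B} (a₀ : A) (b₀ : B)
    (h : ∀ a b, (∃ x, f x = a ∧ g x = b) ↔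
      ∃ x, f' x = a₀⁻¹ * a * a₀ ∧ g' x = b₀ * b * b₀⁻¹) : ofHoms f g = ofHoms f' g' := by
  refine mk_eq_iff.2 (FinBiset.nonempty_iso_of_generates (FinBiset.generates_basePt f g)
    (y := (FinBiset.ofHoms f' g').l a₀ ((FinBiset.ofHoms f' g').r (FinBiset.basePt f' g') b₀))
    ?_ fun a b => ?_)
  · intro y
    obtain ⟨a, b, rfl⟩ := FinBiset.generates_basePt f' g' y
    refine ⟨a * a₀⁻¹, b₀⁻¹ * b, ?_⟩
    rw [FinBiset.l_r, ← FinBiset.r_mul, ← FinBiset.mul_l]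
    simp
  · rw [FinBiset.basePt_l_eq_r_iff, h, ← FinBiset.basePt_l_eq_r_iff]
    exact (FinBiset.mem_stab_translate _ _ a a₀ b b₀).symm

/-- The left factor is the biset of a homomorphism defined on all of `A`, so no double cosets occur.
-/
theorem ofHoms_mul [Finite C] (f : A →* C) (g : L →* A) (k : L →* B) :
    (ofHoms f (MonoidHom.id A)).mul (ofHoms g k) = ofHoms (f.comp g) k := by
  refine mk_eq_iff.2 (FinBiset.nonempty_iso_of_generates (FinBiset.generates_comp
    (FinBiset.generates_basePt _ _) (FinBiset.generates_basePt _ _) fun b => ⟨f b, ?_⟩)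
    (FinBiset.generates_basePt _ _) fun a b => ?_)
  · exact (FinBiset.basePt_l_eq_r_iff _ _ _ _).2 ⟨b, rfl, rfl⟩
  · rw [FinBiset.comp_l_eq_r_iff, FinBiset.basePt_l_eq_r_iff]
    simp only [FinBiset.basePt_l_eq_r_iff]
    constructor
    · rintro ⟨_, ⟨x, rfl, rfl⟩, y, hy, rfl⟩
      exact ⟨y, congrArg f hy, rfl⟩
    · rintro ⟨y, rfl, rfl⟩
      exact ⟨g y, ⟨g y, rfl, rfl⟩, y, rfl, rfl⟩

end

end BisetClass

/-! ### The classes of homomorphisms and restrictions in the biset semiring -/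

namespace BisetSemiring

theorem sum_apply {P : Type u} [Group P] {ι : Type*} (s : Finset ι) (x : ι → BisetSemiring P) (A B : Subgroup P) :
    (∑ i ∈ s, x i) A B = ∑ i ∈ s, x i A B := by
  classical
  induction s using Finset.induction_on with
  | empty => rfl
  | insert i s hi ih => rw [Finset.sum_insert hi, Finset.sum_insert hi, add_apply, ih]

section

variable {P : Type u} [Group P] [Finite P] {A B D E J : Subgroup P} {f g : P → P}

open Classical in
/-- The class of `(J × D) / {(f d, d)}` if `f` restricts to a homomorphism `D → J`. -/
noncomputable def cls (J D : Subgroup P) (f : P → P) : BisetSemiring P :=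
  if h : ∃ ψ : D →* J, ∀ d : D, (ψ d : P) = f d then
    single J D (BisetClass.ofHoms h.choose (MonoidHom.id D)) else 0

open Classical in
/-- The class `R_D^B` if `D ≤ B`. -/
noncomputable def resS (D B : Subgroup P) : BisetSemiring P :=
  if h : D ≤ B then single D B (resClass h) else 0

theorem cls_eq {ψ : D →* J} (e : ∀ d : D, (ψ d : P) = f d) :
    cls J D f = single J D (BisetClass.ofHoms ψ (MonoidHom.id D)) := by
  have h : ∃ ψ : D →* J, ∀ d : D, (ψ d : P) = f d := ⟨ψ, e⟩
  rw [cls, dif_pos h]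
  have : h.choose = ψ :=
    MonoidHom.ext fun d => Subtype.ext ((h.choose_spec d).trans (e d).symm)
  rw [this]

theorem cls_congr (e : ∀ d ∈ D, f d = g d) : cls J D f = cls J D g := by
  by_cases h : ∃ ψ : D →* J, ∀ d : D, (ψ d : P) = f d
  · obtain ⟨ψ, hψ⟩ := h
    rw [cls_eq hψ, cls_eq fun d => (hψ d).trans (e d d.2)]
  · rw [cls, cls, dif_neg h, dif_neg]
    rintro ⟨ψ, hψ⟩
    exact h ⟨ψ, fun d => (hψ d).trans (e d d.2).symm⟩

theorem resS_eq (h : D ≤ B) : resS D B = single D B (resClass h) := dif_pos h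

theorem exists_cls_eq_single (J D : Subgroup P) (f : P → P) : ∃ c, cls J D f = single J D c := by
  by_cases h : ∃ ψ : D →* J, ∀ d : D, (ψ d : P) = f d
  · exact ⟨_, dif_pos h⟩
  · exact ⟨0, by rw [map_zero, cls, dif_neg h]⟩

theorem cls_mul_cls_ne (h : D ≠ E) : cls J D f * cls E A g = 0 := by
  obtain ⟨c, hc⟩ := exists_cls_eq_single J D f
  obtain ⟨d, hd⟩ := exists_cls_eq_single E A g
  rw [hc, hd, single_mul_single_ne _ _ h]

theorem cls_mul_cls {ψ : D →* J} {φ : E →* D} (hf : ∀ d : D, (ψ d : P) = f d)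
    (hg : ∀ d : E, (φ d : P) = g d) : cls J D f * cls D E g = cls J E (f ∘ g) := by
  have hfg : ∀ d : E, (ψ.comp φ d : P) = (f ∘ g) d := fun d => by
    rw [MonoidHom.comp_apply, hf, hg]
    rfl
  rw [cls_eq hf, cls_eq hg, cls_eq hfg, single_mul_single, BisetClass.ofHoms_mul]

theorem cls_mul_resS {ψ : D →* J} (hf : ∀ d : D, (ψ d : P) = f d) (h : D ≤ B) :
    cls J D f * resS D B = single J B (BisetClass.ofHoms ψ (Subgroup.inclusion h)) := by
  rw [cls_eq hf, resS_eq h, single_mul_single, resClass, BisetClass.ofHoms_mul]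
  rfl

/-- Conjugation by `j ∈ J` only changes the base point. This is why morphisms matter only up to
inner automorphisms of their target. -/
theorem cls_conj {ψ : D →* J} (hf : ∀ d : D, (ψ d : P) = f d) {j : P} (hj : j ∈ J) :
    cls J D (fun x => j * f x * j⁻¹) = cls J D f := by
  have h1 : ∀ d : D, (((MulAut.conj (⟨j, hj⟩ : J)).toMonoidHom.comp ψ) d : P) =
      (fun x => j * f x * j⁻¹) d := fun d => by
    simp [← hf d]
  rw [cls_eq h1, cls_eq hf]
  congr 1
  refine BisetClass.ofHoms_eq ⟨j, hj⟩ 1 fun a b => ?_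
  simp only [MonoidHom.id_apply, exists_eq_right, one_mul, inv_one, mul_one]
  constructor
  · rintro rfl
    simp [mul_assoc]
  · intro h
    simp [h, mul_assoc]

/-- Conjugation by `b ∈ B` is absorbed by the right action of `B`, again a change of base point. -/
theorem cls_conj_mul_resS {b : P} (hD : D ≤ B) (hE : E ≤ B) (hb : b ∈ B)
    (h : ∀ x, x ∈ E ↔ b * x * b⁻¹ ∈ D) :
    cls D E (fun x => b * x * b⁻¹) * resS E B = resS D B := by
  let ψ : E →* D := ((MulAut.conj b).toMonoidHom.comp E.subtype).codRestrict D
    fun x => (h x).1 x.2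
  have hψ : ∀ x : E, (ψ x : P) = b * x * b⁻¹ := fun _ => rfl
  rw [cls_mul_resS (f := fun x => b * x * b⁻¹) hψ hE, resS_eq hD, resClass]
  congr 1
  refine BisetClass.ofHoms_eq 1 ⟨b, hb⟩ fun d c => ?_
  constructor
  · rintro ⟨x, rfl, rfl⟩
    exact ⟨ψ x, by simp, Subtype.ext (hψ x)⟩
  · rintro ⟨x, hx, hc⟩
    have h1 : (x : P) = b * c * b⁻¹ := congrArg Subtype.val hc
    have h2 : x = d := by simpa using hx
    subst h2
    have h3 : (c : P) ∈ E := (h c).2 (h1 ▸ x.2)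
    exact ⟨⟨c, h3⟩, Subtype.ext ((hψ _).trans h1.symm), rfl⟩

theorem cls_id (A : Subgroup P) : cls A A id = single A A (indClass (le_refl A)) :=
  cls_eq (ψ := MonoidHom.id A) fun _ => rfl

theorem eq_sum_single (x : BisetSemiring P) :
    x = ∑ A ∈ subgroups P, ∑ B ∈ subgroups P, single A B (x A B) := by
  ext A B
  rw [sum_apply, Finset.sum_eq_single A, sum_apply, Finset.sum_eq_single B, single_same]
  · exact fun B' _ h => single_ne_right _ _ h.symm _
  · exact fun h => (h (mem_subgroups B)).elim
  · intro A' _ h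
    rw [sum_apply]
    exact Finset.sum_eq_zero fun B' _ => single_ne_left _ _ h.symm _
  · exact fun h => (h (mem_subgroups A)).elim

end

end BisetSemiring

/-! ### Elements of the Mackey semiring as sums of transitive bisets -/

namespace FusionSystem

section Types

variable {P : Type u} [Group P] {S S' : Subgroup P} {F : FusionSystem S} {A B C D J : Subgroup P}
  {f : P → P}

theorem IsMor.exists_preimage (h : F.IsMor A B f) (C : Subgroup P) :
    ∃ E ≤ A, ∀ x, x ∈ E ↔ x ∈ A ∧ f x ∈ C :=
  ⟨{ carrier := {x | x ∈ A ∧ f x ∈ C}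
     one_mem' := ⟨one_mem _, by rw [h.map_one]; exact one_mem _⟩
     mul_mem' := fun hx hy =>
      ⟨mul_mem hx.1 hy.1, by rw [h.map_mul hx.1 hy.1]; exact mul_mem hx.2 hy.2⟩
     inv_mem' := fun hx => ⟨inv_mem hx.1, by rw [h.map_inv hx.1]; exact inv_mem hx.2⟩ },
    fun _ hx => hx.1, fun _ => Iff.rfl⟩

variable (F) in
/-- The stabilizers of `X` are graphs of morphisms of `F`. -/
def HasType (X : FinBiset A B) : Prop :=
  ∀ x, ∃ D f, D ≤ B ∧ F.IsMor D A f ∧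
    ∀ (a : A) (b : B), X.l a x = X.r x b ↔ (b : P) ∈ D ∧ (a : P) = f b

/-- All stabilizers are conjugate to the one at `x`, and a conjugate of the graph of a morphism is
such a graph. -/
theorem HasType.of_generates (hB : B ≤ S) {X : FinBiset A B} {x : X.carrier}
    (hx : X.Generates x) (hD : D ≤ B) (hf : F.IsMor D A f)
    (h : ∀ (a : A) (b : B), X.l a x = X.r x b ↔ (b : P) ∈ D ∧ (a : P) = f b) : F.HasType X := by
  intro y
  obtain ⟨a₀, b₀, rfl⟩ := hx y
  obtain ⟨E, hE, _, hmem, hmor⟩ := hf.transport hB hD (inv_mem b₀.2) a₀.2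
  refine ⟨E, _, hE, hmor, fun a b => ?_⟩
  refine (FinBiset.mem_stab_translate X x a a₀ b b₀).trans ((h _ _).trans ?_)
  rw [hmem]
  simp only [inv_inv]
  refine and_congr Iff.rfl ?_
  change (a₀ : P)⁻¹ * a * a₀ = f (b₀ * b * (b₀ : P)⁻¹) ↔ _
  constructor
  · intro e
    rw [← e]
    group
  · intro e
    rw [e]
    group

variable (F) in
/-- The stabilizers of a class of bisets are graphs of morphisms of `F`. -/
def TypeIn (c : BisetClass A B) : Prop := ∃ X, BisetClass.mk X = c ∧ F.HasType X

theorem TypeIn.zero : F.TypeIn (0 : BisetClass A B) := ⟨_, rfl, fun x => x.elim⟩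

theorem TypeIn.add {c d : BisetClass A B} (hc : F.TypeIn c) (hd : F.TypeIn d) :
    F.TypeIn (c + d) := by
  obtain ⟨X, rfl, hX⟩ := hc
  obtain ⟨Y, rfl, hY⟩ := hd
  refine ⟨X.sum Y, rfl, ?_⟩
  rintro (x | y)
  · obtain ⟨D, f, hD, hf, h⟩ := hX x
    exact ⟨D, f, hD, hf, fun a b => Sum.inl_injective.eq_iff.trans (h a b)⟩
  · obtain ⟨D, f, hD, hf, h⟩ := hY y
    exact ⟨D, f, hD, hf, fun a b => Sum.inr_injective.eq_iff.trans (h a b)⟩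

/-- Stabilizers of a product are composites, and the composite of two graphs of morphisms is the
graph of the composite on the subgroup where it is defined. -/
theorem TypeIn.mul {c : BisetClass A B} {d : BisetClass B C} (hc : F.TypeIn c)
    (hd : F.TypeIn d) : F.TypeIn (c.mul d) := by
  obtain ⟨X, rfl, hX⟩ := hc
  obtain ⟨Y, rfl, hY⟩ := hd
  refine ⟨X.comp Y, rfl, ?_⟩
  intro q
  induction q using FinBiset.comp.ind with
  | h x y =>
    obtain ⟨D, f, hD, hf, h⟩ := hX x
    obtain ⟨E, g, hE, hg, h'⟩ := hY y
    obtain ⟨L, hL, hmem⟩ := hg.exists_preimage D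
    refine ⟨L, f ∘ g, hL.trans hE,
      hf.comp ((hg.mono hL).cod hf.left_le fun x hx => ((hmem x).1 hx).2), fun a c => ?_⟩
    rw [FinBiset.comp_l_eq_r_iff, hmem]
    simp only [h, h']
    constructor
    · rintro ⟨b, ⟨h1, h2⟩, h3, h4⟩
      exact ⟨⟨h3, h4 ▸ h1⟩, by rw [h2, h4]; rfl⟩
    · rintro ⟨⟨h1, h2⟩, h3⟩
      exact ⟨⟨g c, hg.mem h1⟩, ⟨h2, h3⟩, h1, rfl⟩

theorem typeIn_single_apply {c : BisetClass A B} (hc : F.TypeIn c) (A' B' : Subgroup P) :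
    F.TypeIn (BisetSemiring.single A B c A' B') := by
  by_cases hA : A' = A
  · by_cases hB : B' = B
    · subst hA hB
      rwa [BisetSemiring.single_same]
    · rw [BisetSemiring.single_ne_right _ _ hB]
      exact TypeIn.zero
  · rw [BisetSemiring.single_ne_left _ _ hA]
    exact TypeIn.zero

theorem TypeIn.sum {ι : Type*} (s : Finset ι) {c : ι → BisetClass A B}
    (h : ∀ i ∈ s, F.TypeIn (c i)) : F.TypeIn (∑ i ∈ s, c i) := by
  classical
  induction s using Finset.induction_on with
  | empty => exact TypeIn.zero
  | insert i s hi ih =>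
    rw [Finset.sum_insert hi]
    exact (h i (Finset.mem_insert_self _ _)).add
      (ih fun j hj => h j (Finset.mem_insert_of_mem hj))

variable [Finite P]

theorem typeIn_ofHoms (hB : B ≤ S) (hD : D ≤ B) {ψ : D →* A} (hψ : ψ ∈ F.Hom D A) :
    F.TypeIn (BisetClass.ofHoms ψ (Subgroup.inclusion hD)) := by
  refine ⟨_, rfl, HasType.of_generates hB (FinBiset.generates_basePt _ _) hD (isMor_extFun hψ)
    fun a b => ?_⟩
  rw [FinBiset.basePt_l_eq_r_iff]
  constructor
  · rintro ⟨x, rfl, rfl⟩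
    exact ⟨x.2, (extFun_coe ψ x).symm⟩
  · rintro ⟨h, e⟩
    refine ⟨⟨b, h⟩, Subtype.ext ?_, rfl⟩
    rw [e, extFun_mk ψ h]

theorem typeIn_of_mem {x : BisetSemiring P} (hx : x ∈ F.mackeySemiring) (A B : Subgroup P) :
    F.TypeIn (x A B) := by
  induction hx using NonUnitalSubsemiring.closure_induction generalizing A B with
  | mem x hx =>
    cases hx with
    | ind h hK => exact typeIn_single_apply (typeIn_ofHoms (h.trans hK) le_rfl
        (F.inclusion_mem h hK)) A B
    | res h hK => exact typeIn_single_apply (typeIn_ofHoms hK h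
        (F.inclusion_mem le_rfl (h.trans hK))) A B
    | conj φ hφ => exact typeIn_single_apply (typeIn_ofHoms (F.left_le hφ) le_rfl hφ) A B
  | zero => exact TypeIn.zero
  | add x y _ _ hx hy => exact (hx A B).add (hy A B)
  | mul x y _ _ hx hy =>
    rw [BisetSemiring.mul_apply]
    exact TypeIn.sum _ fun C _ => (hx A C).mul (hy C B)

/-- A class of bisets whose stabilizers are graphs of morphisms of `F` is a sum of classes of
transitive bisets. -/
theorem TypeIn.induction {p : BisetClass A B → Prop} (zero : p 0)
    (add : ∀ c d, p c → p d → p (c + d))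
    (trans : ∀ (D : Subgroup P) (hD : D ≤ B) (ψ : D →* A), ψ ∈ F.Hom D A →
      p (BisetClass.ofHoms ψ (Subgroup.inclusion hD))) {c : BisetClass A B} (hc : F.TypeIn c) :
    p c := by
  obtain ⟨X, rfl, hX⟩ := hc
  induction hn : Nat.card X.carrier using Nat.strong_induction_on generalizing X with
  | _ n ih =>
    have hfin := X.finite
    rcases isEmpty_or_nonempty X.carrier with he | ⟨⟨x⟩⟩
    · have : BisetClass.mk X = 0 :=
        BisetClass.mk_eq ⟨Equiv.equivOfIsEmpty _ PEmpty, fun _ x => he.elim x, fun x => he.elim x⟩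
      rw [this]
      exact zero
    -- Split off the orbit of `x`; the complement is a smaller biset of the same kind.
    let s : Set X.carrier := {y | ∃ a b, y = X.l a (X.r x b)}
    have hl : ∀ a y, X.l a y ∈ s ↔ y ∈ s := by
      intro a y
      constructor
      · rintro ⟨a', b, h⟩
        exact ⟨a⁻¹ * a', b, by rw [X.mul_l, ← h, X.l_inv_l]⟩
      · rintro ⟨a', b, h⟩
        exact ⟨a * a', b, by rw [X.mul_l, ← h]⟩
    have hr : ∀ y b, X.r y b ∈ s ↔ y ∈ s := by
      intro y b
      constructor
      · rintro ⟨a, b', h⟩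
        refine ⟨a, b' * b⁻¹, ?_⟩
        rw [X.r_mul, ← X.l_r, ← h, X.r_r_inv]
      · rintro ⟨a, b', h⟩
        refine ⟨a, b' * b, ?_⟩
        rw [X.r_mul, ← X.l_r, ← h]
    have hxs : x ∈ s := ⟨1, 1, by rw [X.r_one, X.one_l]⟩
    let Y := X.sub s (fun a y => (hl a y).2) fun y hy b => (hr y b).2 hy
    let Z := X.sub sᶜ (fun a y hy h => hy ((hl a y).1 h)) fun y hy b h => hy ((hr y b).1 h)
    have hYZ : BisetClass.mk X = BisetClass.mk Y + BisetClass.mk Z := by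
      classical
      refine (BisetClass.mk_eq (X := Y.sum Z) ⟨Equiv.Set.sumCompl s, ?_, ?_⟩).symm
      · rintro a (y | y) <;> rfl
      · rintro (y | y) b <;> rfl
    have hZ : F.HasType Z := by
      rintro ⟨z, hz⟩
      obtain ⟨D, f, hD, hf, h⟩ := hX z
      exact ⟨D, f, hD, hf, fun a b => Subtype.ext_iff.trans (h a b)⟩
    have hcard : Nat.card Z.carrier < n := by
      rw [← hn]
      exact Set.ncard_lt_card (s := sᶜ) fun h => (h ▸ Set.mem_univ x : x ∈ sᶜ) hxs
    obtain ⟨D, f, hD, ⟨ψ, hψ, e⟩, h⟩ := hX x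
    have hY : BisetClass.mk Y = BisetClass.ofHoms ψ (Subgroup.inclusion hD) := by
      refine BisetClass.mk_eq_iff.2 (FinBiset.nonempty_iso_of_generates (x := ⟨x, hxs⟩) ?_
        (FinBiset.generates_basePt _ _) fun a b => ?_)
      · rintro ⟨_, a, b, rfl⟩
        exact ⟨a, b, rfl⟩
      · refine (Subtype.ext_iff.trans (h a b)).trans ?_
        rw [FinBiset.basePt_l_eq_r_iff]
        constructor
        · rintro ⟨h1, h2⟩
          exact ⟨⟨b, h1⟩, Subtype.ext ((e _).trans h2.symm), rfl⟩
        · rintro ⟨y, rfl, rfl⟩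
          exact ⟨y.2, e y⟩
    rw [hYZ, hY]
    exact add _ _ (trans D hD ψ hψ) (ih _ hcard Z hZ rfl)

/-- Bisets stabilized by graphs of morphisms are closed under sums and products and include the
generators, and each is a sum of transitive ones. Decomposing into orbits thus replaces an explicit
double coset formula for `R` times `I`. -/
theorem mackeySemiring_induction {p : BisetSemiring P → Prop} (zero : p 0)
    (add : ∀ x y, p x → p y → p (x + y))
    (trans : ∀ (J B D : Subgroup P) (f : P → P), B ≤ S → D ≤ B → F.IsMor D J f →
      p (BisetSemiring.cls J D f * BisetSemiring.resS D B))
    {x : BisetSemiring P} (hx : x ∈ F.mackeySemiring) : p x := by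
  rw [BisetSemiring.eq_sum_single x]
  refine Finset.sum_induction _ p add zero fun A _ => Finset.sum_induction _ p add zero
    fun B _ => ?_
  by_cases hB : B ≤ S
  · refine TypeIn.induction (F := F) (p := fun c => p (BisetSemiring.single A B c)) ?_ ?_ ?_
      (typeIn_of_mem hx A B)
    · rw [map_zero]
      exact zero
    · intro c d hc hd
      rw [map_add]
      exact add _ _ hc hd
    · intro D hD ψ hψ
      rw [← BisetSemiring.cls_mul_resS (fun d => (extFun_coe ψ d).symm) hD]
      exact trans A B D _ hB hD (isMor_extFun hψ)
  · rw [apply_eq_zero_of_mem hx A hB, map_zero]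
    exact zero

theorem IsMor.cls_mem (h : F.IsMor D J f) : BisetSemiring.cls J D f ∈ F.mackeySemiring := by
  obtain ⟨ψ, hψ, e⟩ := h
  have h1 : BisetSemiring.cls J D f =
      BisetSemiring.single J (imageOf ψ) (indClass (imageOf_le ψ)) *
        BisetSemiring.single (imageOf ψ) D (conjClass (imageIso ψ (F.injective hψ))) := by
    rw [BisetSemiring.cls_eq e, BisetSemiring.single_mul_single, indClass, conjClass,
      BisetClass.ofHoms_mul]
    rfl
  rw [h1]
  exact mul_mem (NonUnitalSubsemiring.subset_closure (.ind _ (F.right_le hψ)))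
    (NonUnitalSubsemiring.subset_closure (.conj _ (F.imageIso_mem hψ)))

theorem resS_mem (F : FusionSystem S) (hD : D ≤ B) (hB : B ≤ S) :
    BisetSemiring.resS D B ∈ F.mackeySemiring := by
  rw [BisetSemiring.resS_eq hD]
  exact NonUnitalSubsemiring.subset_closure (.res hD hB)

/-- The two morphisms may belong to different fusion systems, since only the underlying
homomorphisms enter the product. -/
theorem IsMor.cls_mul_cls {F' : FusionSystem S'} {E : Subgroup P} {g : P → P}
    (hf : F.IsMor D J f) (hg : F'.IsMor E D g) :
    BisetSemiring.cls J D f * BisetSemiring.cls D E g = BisetSemiring.cls J E (f ∘ g) := by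
  obtain ⟨ψ, _, e⟩ := hf
  obtain ⟨φ, _, e'⟩ := hg
  exact BisetSemiring.cls_mul_cls e e'

theorem IsMor.cls_conj (hf : F.IsMor D J f) {j : P} (hj : j ∈ J) :
    BisetSemiring.cls J D (fun x => j * f x * j⁻¹) = BisetSemiring.cls J D f := by
  obtain ⟨ψ, _, e⟩ := hf
  exact BisetSemiring.cls_conj e hj

end Types

end FusionSystem

/-! ### The universal property of induction along a non-unital map -/

section CornerLemmas

variable {A : Type v} {B : Type w} [Ring A] [Ring B] (f : A →ₙ+* B)

namespace CornerInd

variable {N Z : Type*} [AddCommGroup N] [Module A N]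

theorem mul_map_one {b : B} (hb : b ∈ cornerIdeal f) : b * f 1 = b := by
  obtain ⟨c, rfl⟩ := Ideal.mem_span_singleton'.1 hb
  rw [mul_assoc, ← map_mul, one_mul]

@[elab_as_elim]
theorem induction_on {p : CornerInd f N → Prop} (t : CornerInd f N) (zero : p 0)
    (add : ∀ s t, p s → p t → p (s + t)) (tmul : ∀ b n, p (tmul f b n)) : p t := by
  obtain ⟨t, rfl⟩ := Submodule.mkQ_surjective (balancedRel f N) t
  induction t using TensorProduct.induction_on with
  | zero => rw [map_zero]; exact zero
  | add s t hs ht => rw [map_add]; exact add _ _ hs ht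
  | tmul x n =>
    have h : x = ⟨x * f 1, mul_map_mem_cornerIdeal f x 1⟩ := Subtype.ext (mul_map_one f x.2).symm
    rw [h]
    exact tmul x n

/-- The map `b ↦ n ↦ b ⊗ n`. -/
noncomputable def mkHom (N : Type*) [AddCommGroup N] [Module A N] : B →+ N →+ CornerInd f N where
  toFun b :=
    { toFun := fun n => tmul f b n
      map_zero' := by rw [tmul, TensorProduct.tmul_zero, map_zero]; rfl
      map_add' := fun m n => by rw [tmul, TensorProduct.tmul_add, map_add]; rfl }
  map_zero' := by
    ext n
    have h : (⟨0 * f 1, mul_map_mem_cornerIdeal f 0 1⟩ : cornerIdeal f) = 0 :=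
      Subtype.ext (zero_mul _)
    change tmul f 0 n = 0
    rw [tmul, h, TensorProduct.zero_tmul, map_zero]
    rfl
  map_add' b c := by
    ext n
    have h : (⟨(b + c) * f 1, mul_map_mem_cornerIdeal f _ 1⟩ : cornerIdeal f) =
      ⟨b * f 1, mul_map_mem_cornerIdeal f _ 1⟩ + ⟨c * f 1, mul_map_mem_cornerIdeal f _ 1⟩ :=
      Subtype.ext (add_mul _ _ _)
    change tmul f (b + c) n = tmul f b n + tmul f c n
    rw [tmul, h, TensorProduct.add_tmul, map_add]
    rfl

theorem mkHom_apply (b : B) (n : N) : mkHom f N b n = tmul f b n := rfl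

theorem smul_tmul (b c : B) (n : N) : b • tmul f c n = tmul f (b * c) n := by
  have h : (⟨b * c * f 1, mul_map_mem_cornerIdeal f _ 1⟩ : cornerIdeal f) =
    b • ⟨c * f 1, mul_map_mem_cornerIdeal f _ 1⟩ := Subtype.ext (mul_assoc _ _ _)
  rw [tmul, tmul, h, ← TensorProduct.smul_tmul', map_smul]
  rfl

theorem tmul_mul_map (b : B) (a : A) (n : N) : tmul f (b * f a) n = tmul f b (a • n) := by
  have h : (⟨b * f a * f 1, mul_map_mem_cornerIdeal f _ 1⟩ : cornerIdeal f) =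
    cornerMul f ⟨b * f 1, mul_map_mem_cornerIdeal f b 1⟩ a := Subtype.ext (by
      change b * f a * f 1 = b * f 1 * f a
      rw [mul_assoc, mul_assoc, ← map_mul, ← map_mul, one_mul, mul_one])
  refine (Submodule.Quotient.eq (balancedRel f N)).2 (Submodule.subset_span
    ⟨⟨b * f 1, mul_map_mem_cornerIdeal f b 1⟩, a, n, ?_⟩)
  rw [h]

theorem tmul_mul_map_one (b : B) (n : N) : tmul f (b * f 1) n = tmul f b n := by
  rw [tmul_mul_map, one_smul]

variable [AddCommGroup Z]

/-- The target is only an abelian group. This generality is needed for the inverse of `Γ`, which is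
constructed as an additive map. -/
theorem exists_addHom (Ψ : B →+ N →+ Z) (h : ∀ b a n, Ψ (b * f a) n = Ψ b (a • n)) :
    ∃ σ : CornerInd f N →+ Z, ∀ b n, σ (tmul f b n) = Ψ b n := by
  let σ₀ : TensorProduct ℤ (cornerIdeal f) N →+ Z :=
    TensorProduct.liftAddHom (Ψ.comp (cornerIdeal f).subtype.toAddMonoidHom) fun r m n => by
      rw [map_zsmul, map_zsmul]
      rfl
  have hσ₀ : ∀ x n, σ₀ (TensorProduct.tmul ℤ x n) = Ψ x n := fun _ _ => rfl
  have hker : ∀ t ∈ balancedRel f N, σ₀ t = 0 := by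
    intro t ht
    -- The relations form a `B`-submodule while `σ₀` is merely additive, so the vanishing has to be
    -- proved for all multiples `b • t` at once.
    have key : ∀ b : B, σ₀ (b • t) = 0 := by
      induction ht using Submodule.span_induction with
      | mem t ht =>
        obtain ⟨x, a, n, rfl⟩ := ht
        intro b
        rw [smul_sub, map_sub, TensorProduct.smul_tmul', TensorProduct.smul_tmul', hσ₀, hσ₀]
        change Ψ (b * (x * f a)) n - Ψ (b * x) (a • n) = 0
        rw [← mul_assoc, h, sub_self]
      | zero => intro b; rw [smul_zero, map_zero]
      | add s t _ _ hs ht => intro b; rw [smul_add, map_add, hs, ht, add_zero]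
      | smul c t _ ht => intro b; rw [smul_smul, ht]
    have h1 := key 1
    rwa [one_smul] at h1
  let σ : CornerInd f N →+ Z :=
    ((Submodule.liftQ ((balancedRel f N).restrictScalars ℤ) σ₀.toIntLinearMap
      (fun t ht => hker t ht)).comp
      (Submodule.Quotient.restrictScalarsEquiv ℤ (balancedRel f N)).symm.toLinearMap).toAddMonoidHom
  refine ⟨σ, fun b n => ?_⟩
  change Ψ (b * f 1) n = Ψ b n
  rw [h, one_smul]

variable [Module B Z]

theorem exists_linearMap (g : N →+ Z) (h : ∀ a n, g (a • n) = f a • g n) :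
    ∃ σ : CornerInd f N →ₗ[B] Z, ∀ b n, σ (tmul f b n) = b • g n := by
  let Ψ : B →+ N →+ Z :=
    { toFun := fun b => (DistribSMul.toAddMonoidHom Z b).comp g
      map_zero' := by ext n; exact zero_smul B (g n)
      map_add' := fun b c => by ext n; exact add_smul b c (g n) }
  obtain ⟨σ, hσ⟩ := exists_addHom f Ψ fun b a n => by
    change (b * f a) • g n = b • g (a • n)
    rw [h, mul_smul]
  refine ⟨{ σ with map_smul' := fun b t => ?_ }, hσ⟩
  change σ (b • t) = b • σ t
  induction t using induction_on with
  | zero => rw [smul_zero, map_zero, smul_zero]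
  | add s t hs ht => rw [smul_add, map_add, map_add, smul_add, hs, ht]
  | tmul c n =>
    rw [smul_tmul, hσ, hσ]
    exact mul_smul b c (g n)

end CornerInd

end CornerLemmas

/-! ### Elements of the Mackey algebra coming from bisets -/

namespace GrothendieckRing

/-- The quotient by the subgroup generated by `N` kills `N`, so the quotient map is zero by the
universal property. -/
theorem closure_range_of {N : Type u} [Semiring N] :
    AddSubgroup.closure (Set.range (of : N → GrothendieckRing N)) = ⊤ := by
  set W := AddSubgroup.closure (Set.range (of : N → GrothendieckRing N))
  have h : QuotientAddGroup.mk' W = 0 := hom_ext fun n =>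
    (QuotientAddGroup.eq_zero_iff _).2 (AddSubgroup.subset_closure ⟨n, rfl⟩)
  refine eq_top_iff.2 fun x _ => ?_
  exact (QuotientAddGroup.eq_zero_iff x).1 (DFunLike.congr_fun h x)

end GrothendieckRing

namespace MackeyAlgebra

open FusionSystem BisetSemiring

section

variable (R : Type v) [CommRing R] {P : Type u} [Group P] [Finite P] {S S' : Subgroup P}
  (F : FusionSystem S) {F' : FusionSystem S'}

open Classical in
/-- The element of the Mackey algebra given by an element of the biset semiring. -/
noncomputable def el (x : BisetSemiring P) : MackeyAlgebra R F :=
  if h : x ∈ F.mackeySemiring then of R F ⟨x, h⟩ else 0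

variable {F} {x y : BisetSemiring P}

theorem el_eq (h : x ∈ F.mackeySemiring) : el R F x = of R F ⟨x, h⟩ := dif_pos h

theorem of_add (x y : F.mackeySemiring) : of R F (x + y) = of R F x + of R F y := by
  rw [of, map_add, TensorProduct.tmul_add]
  rfl

theorem of_mul (x y : F.mackeySemiring) : of R F (x * y) = of R F x * of R F y := by
  rw [of, GrothendieckRing.of_mul]
  refine Eq.trans ?_ (Algebra.TensorProduct.tmul_mul_tmul (1 : R) (1 : R) _ _).symm
  rw [mul_one]

theorem el_zero : el R F 0 = 0 := by
  rw [el_eq R (zero_mem _)]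
  change of R F 0 = 0
  rw [of, map_zero, TensorProduct.tmul_zero]
  rfl

theorem el_add (hx : x ∈ F.mackeySemiring) (hy : y ∈ F.mackeySemiring) :
    el R F (x + y) = el R F x + el R F y := by
  rw [el_eq R hx, el_eq R hy, el_eq R (add_mem hx hy), ← of_add]
  rfl

theorem el_mul (hx : x ∈ F.mackeySemiring) (hy : y ∈ F.mackeySemiring) :
    el R F (x * y) = el R F x * el R F y := by
  rw [el_eq R hx, el_eq R hy, el_eq R (mul_mem hx hy), ← of_mul]
  rfl

theorem el_unitElement : el R F (unitElement S) = 1 := el_eq R F.unitElement_mem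

theorem smul_el (r : R) (hx : x ∈ F.mackeySemiring) :
    r • el R F x = TensorProduct.tmul ℤ r (GrothendieckRing.of ⟨x, hx⟩) := by
  rw [el_eq R hx]
  refine (TensorProduct.smul_tmul' r (1 : R) _).trans ?_
  rw [smul_eq_mul, mul_one]

theorem induction_on {p : MackeyAlgebra R F → Prop} (zero : p 0)
    (add : ∀ a b, p a → p b → p (a + b))
    (el : ∀ (r : R) (x : BisetSemiring P), x ∈ F.mackeySemiring → p (r • el R F x))
    (a : MackeyAlgebra R F) : p a := by
  induction a using TensorProduct.induction_on with
  | zero => exact zero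
  | add a b ha hb => exact add a b ha hb
  | tmul r x =>
    have hx : x ∈ AddSubgroup.closure (Set.range (GrothendieckRing.of (N := F.mackeySemiring))) := by
      rw [GrothendieckRing.closure_range_of]
      trivial
    induction hx using AddSubgroup.closure_induction generalizing r with
    | mem x hx =>
      obtain ⟨x, rfl⟩ := hx
      have h := el r x.1 x.2
      rwa [smul_el R r x.2] at h
    | zero =>
      rw [TensorProduct.tmul_zero]
      exact zero
    | add x y _ _ hx hy =>
      rw [TensorProduct.tmul_add]
      exact add _ _ (hx r) (hy r)
    | neg x _ hx =>
      -- Signs are moved into the scalar, so that `R`-multiples of biset classes suffice.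
      rw [TensorProduct.tmul_neg, ← TensorProduct.neg_tmul]
      exact hx (-r)

theorem ind_eq_el {A B : Subgroup P} (h : A ≤ B) (hB : B ≤ S) :
    ind R F h hB = el R F (cls B A id) := by
  have e : cls B A id = single B A (indClass h) :=
    cls_eq (ψ := Subgroup.inclusion h) fun _ => rfl
  have hm : single B A (indClass h) ∈ F.mackeySemiring :=
    NonUnitalSubsemiring.subset_closure (.ind h hB)
  rw [e, el_eq R hm]
  rfl

theorem indConj_eq_el {C J : Subgroup P} (θ : C →* J) (hθ : θ ∈ F.Hom C J) :
    indConj R F θ hθ = el R F (cls J C (extFun θ)) := by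
  have h1 : single J (imageOf θ) (indClass (imageOf_le θ)) ∈ F.mackeySemiring :=
    NonUnitalSubsemiring.subset_closure (.ind _ (F.right_le hθ))
  have h2 : single (imageOf θ) C (conjClass (imageIso θ (F.injective hθ))) ∈ F.mackeySemiring :=
    NonUnitalSubsemiring.subset_closure (.conj _ (F.imageIso_mem hθ))
  have e : cls J C (extFun θ) = single J (imageOf θ) (indClass (imageOf_le θ)) *
      single (imageOf θ) C (conjClass (imageIso θ (F.injective hθ))) := by
    rw [cls_eq fun d => (extFun_coe θ d).symm, single_mul_single, indClass, conjClass,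
      BisetClass.ofHoms_mul]
    rfl
  rw [e, el_mul R h1 h2, el_eq R h1, el_eq R h2]
  rfl

theorem incl_el (h : F.Le F') (hx : x ∈ F.mackeySemiring) : incl R h (el R F x) = el R F' x := by
  rw [el_eq R hx, el_eq R (mackeySemiring_mono h hx)]
  refine (baseChangeMap_tmul R _ 1 _).trans ?_
  rw [GrothendieckRing.map_of]
  rfl

theorem incl_smul_el (h : F.Le F') (r : R) (hx : x ∈ F.mackeySemiring) :
    incl R h (r • el R F x) = r • el R F' x := by
  rw [smul_el R r hx, smul_el R r (mackeySemiring_mono h hx)]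
  refine (baseChangeMap_tmul R _ r _).trans ?_
  rw [GrothendieckRing.map_of]
  rfl

theorem incl_smul (h : F.Le F') (r : R) (a : MackeyAlgebra R F) :
    incl R h (r • a) = r • incl R h a := by
  induction a using induction_on with
  | zero => rw [smul_zero, map_zero, smul_zero]
  | add a b ha hb => rw [smul_add, map_add, ha, hb, map_add, smul_add]
  | el s x hx => rw [smul_smul, incl_smul_el R h _ hx, incl_smul_el R h _ hx, smul_smul]

theorem hat_smul_el {H K : Subgroup P} (φ : H ≃* K) (r : R)
    (hx : x ∈ (inner H).mackeySemiring) :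
    hat R φ (r • el R (inner H) x) = r • el R (inner K) (twist φ x) := by
  rw [smul_el R r hx, smul_el R r (twist_mem φ hx)]
  refine (baseChangeMap_tmul R _ r _).trans ?_
  rw [GrothendieckRing.map_of]
  rfl

theorem hat_el {H K : Subgroup P} (φ : H ≃* K) (hx : x ∈ (inner H).mackeySemiring) :
    hat R φ (el R (inner H) x) = el R (inner K) (twist φ x) := by
  have h := hat_smul_el R φ 1 hx
  rwa [one_smul, one_smul] at h

end

end MackeyAlgebra

/-! ### Generators and relations for induced modules -/

open FusionSystem BisetSemiring MackeyAlgebra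

section InducedModule

variable (R : Type v) [CommRing R] {P : Type u} [Group P] [Finite P] {S H : Subgroup P}
  (F : FusionSystem S) {M : Type*} [AddCommGroup M] [Module (MackeyAlgebra R (inner H)) M]

namespace MackeyAlgebra

variable {R F} in
theorem el_smul_smul {x y : BisetSemiring P} (hx : x ∈ (inner H).mackeySemiring)
    (hy : y ∈ (inner H).mackeySemiring) (m : M) :
    el R (inner H) x • el R (inner H) y • m = el R (inner H) (x * y) • m := by
  rw [smul_smul, el_mul R hx hy]

/-- The unit of `F_H(H)` only involves subgroups of `H`, so the middle groups never match. -/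
theorem el_mul_el_one_of_not_le {J B : Subgroup P} (hH : H ≤ S) (hB : ¬ B ≤ H) (c : BisetClass J B)
    (hc : single J B c ∈ F.mackeySemiring) :
    el R F (single J B c) * incl R (inner_le (F := F) hH) 1 = 0 := by
  have h1 : unitElement H ∈ (inner H).mackeySemiring := (inner H).unitElement_mem
  rw [← el_unitElement R (F := inner H), incl_el R _ h1,
    ← el_mul R hc (mackeySemiring_mono (inner_le hH) h1), unitElement, Finset.mul_sum,
    Finset.sum_eq_zero, el_zero]
  intro A _
  exact single_mul_single_ne _ _ (fun e => hB (e.le.trans A.2)) _ _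

end MackeyAlgebra

variable {R F}

/-- The module induced to `F` is additively generated by the elements `cls J D f ⊗ m`. -/
theorem MackeyInduce.induction_on (hH : H ≤ S)
    {p : MackeyInduce R (inner_le (F := F) hH) M → Prop} (zero : p 0)
    (add : ∀ s t, p s → p t → p (s + t))
    (tmul : ∀ (J D : Subgroup P) (f : P → P), D ≤ H → F.IsMor D J f → ∀ m,
      p (CornerInd.tmul _ (el R F (cls J D f)) m))
    (t : MackeyInduce R (inner_le (F := F) hH) M) : p t := by
  have hz : ∀ m, p (CornerInd.tmul (incl R (inner_le (F := F) hH)) 0 m) := by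
    intro m
    rw [← CornerInd.mkHom_apply, map_zero]
    exact zero
  induction t using CornerInd.induction_on with
  | zero => exact zero
  | add s t hs ht => exact add s t hs ht
  | tmul b m =>
    induction b using MackeyAlgebra.induction_on generalizing m with
    | zero => exact hz m
    | add a b ha hb =>
      rw [← CornerInd.mkHom_apply, map_add]
      exact add _ _ (ha m) (hb m)
    | el r x hx =>
      suffices h : x ∈ F.mackeySemiring ∧ ∀ m,
          p (CornerInd.tmul (incl R (inner_le (F := F) hH)) (r • el R F x) m) from h.2 m
      refine mackeySemiring_induction (F := F) (p := fun x => x ∈ F.mackeySemiring ∧ ∀ m,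
          p (CornerInd.tmul (incl R (inner_le (F := F) hH)) (r • el R F x) m)) ?_ ?_ ?_ hx
      · refine ⟨zero_mem _, fun m => ?_⟩
        rw [el_zero, smul_zero]
        exact hz m
      · rintro x y ⟨hx, hx'⟩ ⟨hy, hy'⟩
        refine ⟨add_mem hx hy, fun m => ?_⟩
        rw [el_add R hx hy, smul_add, ← CornerInd.mkHom_apply, map_add]
        exact add _ _ (hx' m) (hy' m)
      · intro J B D f hB hD hf
        have hm := mul_mem hf.cls_mem (F.resS_mem hD hB)
        refine ⟨hm, fun m => ?_⟩
        -- When `B ≤ H`, both `R_D^B` and the scalar belong to the algebra of `F_H(H)` and move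
        -- across the tensor sign; otherwise the term is zero.
        by_cases hBH : B ≤ H
        · have hr := (inner H).resS_mem hD hBH
          rw [el_mul R hf.cls_mem (F.resS_mem hD hB), ← incl_el R (inner_le hH) hr,
            ← mul_smul_comm, ← incl_smul, CornerInd.tmul_mul_map]
          exact tmul J D f (hD.trans hBH) hf _
        · obtain ⟨ψ, _, e⟩ := hf
          rw [cls_mul_resS e hD] at hm ⊢
          rw [← CornerInd.tmul_mul_map_one, smul_mul_assoc,
            el_mul_el_one_of_not_le R F hH hBH _ hm, smul_zero]
          exact hz m

section Presentation

variable {N : Type*} [AddCommGroup N] (τ : Subgroup P → Subgroup P → (P → P) → M →+ N)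

variable (R F H) in
/-- Compatibility of a family of maps `τ J D f : M →+ N`, for morphisms `f : D → J`, with the
relations between the elements `cls J D f ⊗ m` of the induced module. -/
structure IsInductionFamily : Prop where
  congr : ∀ {J D : Subgroup P} {f g : P → P}, (∀ d ∈ D, f d = g d) → τ J D f = τ J D g
  smul : ∀ {J D E : Subgroup P} {f g : P → P}, D ≤ H → F.IsMor D J f → (inner H).IsMor E D g →
    ∀ m, τ J D f (el R (inner H) (cls D E g) • m) = τ J E (f ∘ g) m
  conj : ∀ {J D : Subgroup P} {f : P → P}, D ≤ H → F.IsMor D J f → ∀ j ∈ J,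
    τ J D (fun x => j * f x * j⁻¹) = τ J D f

open Classical in
/-- The map `M → N` attached to a stabilizer in a biset. -/
noncomputable def stabVal (R : Type v) [CommRing R] (F : FusionSystem S) (H : Subgroup P) {M : Type*}
    [AddCommGroup M] [Module (MackeyAlgebra R (inner H)) M] {N : Type*} [AddCommGroup N]
    (τ : Subgroup P → Subgroup P → (P → P) → M →+ N) (J B : Subgroup P) (s : Set (J × B)) :
    M →+ N :=
  if h : B ≤ H ∧ ∃ q : Subgroup P × (P → P), q.1 ≤ B ∧ F.IsMor q.1 J q.2 ∧
      s = {x | (x.2 : P) ∈ q.1 ∧ (x.1 : P) = q.2 x.2} then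
    (τ J h.2.choose.1 h.2.choose.2).comp
      (DistribSMul.toAddMonoidHom M (el R (inner H) (resS h.2.choose.1 B))) else 0

variable {τ} {J B D : Subgroup P} {f : P → P}

/-- The stabilizer determines `D` and the values of `f` on `D`, so the choice made in `stabVal` is
harmless. -/
theorem stabVal_eq (hτ : IsInductionFamily R H F τ) (hB : B ≤ H) (hD : D ≤ B)
    (hf : F.IsMor D J f) (m : M) :
    stabVal R F H τ J B {x | (x.2 : P) ∈ D ∧ (x.1 : P) = f x.2} m =
      τ J D f (el R (inner H) (resS D B) • m) := by
  have h : B ≤ H ∧ ∃ q : Subgroup P × (P → P), q.1 ≤ B ∧ F.IsMor q.1 J q.2 ∧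
      {x : J × B | (x.2 : P) ∈ D ∧ (x.1 : P) = f x.2} =
        {x | (x.2 : P) ∈ q.1 ∧ (x.1 : P) = q.2 x.2} := ⟨hB, ⟨D, f⟩, hD, hf, rfl⟩
  rw [stabVal, dif_pos h]
  obtain ⟨h1, h2, h3⟩ := h.2.choose_spec
  generalize h.2.choose = q at h1 h2 h3
  obtain ⟨E, g⟩ := q
  simp only at h1 h2 h3 ⊢
  have h4 : D = E := by
    ext x
    constructor
    · intro hx
      have h5 : ((⟨f x, hf.mem hx⟩, ⟨x, hD hx⟩) : J × B) ∈
        {x : J × B | (x.2 : P) ∈ D ∧ (x.1 : P) = f x.2} := ⟨hx, rfl⟩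
      rw [h3] at h5
      exact h5.1
    · intro hx
      have h5 : ((⟨g x, h2.mem hx⟩, ⟨x, h1 hx⟩) : J × B) ∈
        {x : J × B | (x.2 : P) ∈ E ∧ (x.1 : P) = g x.2} := ⟨hx, rfl⟩
      rw [← h3] at h5
      exact h5.1
  subst h4
  have h6 : τ J D g = τ J D f := hτ.congr fun x hx => by
    have h5 : ((⟨f x, hf.mem hx⟩, ⟨x, hD hx⟩) : J × B) ∈
      {x : J × B | (x.2 : P) ∈ D ∧ (x.1 : P) = f x.2} := ⟨hx, rfl⟩
    rw [h3] at h5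
    exact h5.2.symm
  rw [h6]
  rfl

theorem exists_conj_stab (hB : B ≤ S) (hD : D ≤ B) (hf : F.IsMor D J f) (a : J) (b : B) :
    ∃ E ≤ B, (∀ x, x ∈ E ↔ (b : P) * x * (b : P)⁻¹ ∈ D) ∧
      F.IsMor E J (fun x => a * f (b * x * (b : P)⁻¹) * (a : P)⁻¹) ∧
      {q : J × B | (a⁻¹ * q.1 * a, b * q.2 * b⁻¹) ∈
        {x : J × B | (x.2 : P) ∈ D ∧ (x.1 : P) = f x.2}} =
      {q : J × B | (q.2 : P) ∈ E ∧ (q.1 : P) = a * f (b * q.2 * (b : P)⁻¹) * (a : P)⁻¹} := by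
  obtain ⟨E, hE, _, hmem, hmor⟩ := hf.transport hB hD (inv_mem b.2) a.2
  simp only [inv_inv] at hmem hmor
  refine ⟨E, hE, hmem, hmor, ?_⟩
  ext ⟨x, y⟩
  simp only [Set.mem_ofPred_eq, hmem, Subgroup.coe_mul, Subgroup.coe_inv]
  refine and_congr Iff.rfl ?_
  constructor
  · intro e
    rw [← e]
    group
  · intro e
    rw [e]
    group

/-- Conjugation by `a ∈ J` is the relation `conj`. Conjugation by `b ∈ B` is the relation `smul` for
`c_b`, which is then absorbed by the restriction. -/
theorem invariant_stabVal (hH : H ≤ S) (hτ : IsInductionFamily R H F τ) :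
    FinBiset.Invariant (stabVal R F H τ J B) := by
  intro s a b
  by_cases h : B ≤ H ∧ ∃ q : Subgroup P × (P → P), q.1 ≤ B ∧ F.IsMor q.1 J q.2 ∧
      s = {x | (x.2 : P) ∈ q.1 ∧ (x.1 : P) = q.2 x.2}
  · obtain ⟨hB, ⟨D, f⟩, hD, hf, rfl⟩ := h
    simp only at hD hf ⊢
    obtain ⟨E, hE, hmem, hmor, e⟩ := exists_conj_stab (hB.trans hH) hD hf a b
    have hbH : (b : P) ∈ H := hB b.2
    have hc : (inner H).IsMor E D (fun x => b * x * (b : P)⁻¹) :=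
      (inner H).isMor_conj hbH (hE.trans hB) (hD.trans hB) fun x hx => (hmem x).1 hx
    rw [e]
    ext m
    rw [stabVal_eq hτ hB hE hmor, stabVal_eq hτ hB hD hf]
    have h1 := hτ.conj (hE.trans hB) (hf.comp (hc.of_le (inner_le hH))) a a.2
    have h2 := hτ.smul (hD.trans hB) hf hc (el R (inner H) (resS E B) • m)
    rw [el_smul_smul hc.cls_mem ((inner H).resS_mem hE hB), cls_conj_mul_resS hD hE b.2 hmem] at h2
    rw [h2, ← h1]
    rfl
  · rw [stabVal, stabVal, dif_neg h, dif_neg]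
    rintro ⟨hB, ⟨D, f⟩, hD, hf, e⟩
    simp only at hD hf e
    obtain ⟨E, hE, hmem, hmor, e'⟩ := exists_conj_stab (hB.trans hH) hD hf a⁻¹ b⁻¹
    refine h ⟨hB, ⟨E, _⟩, hE, hmor, ?_⟩
    simp only
    rw [← e', ← e]
    ext ⟨x, y⟩
    simp [mul_assoc]

/-- The additive map on the biset semiring attached to an induction family. -/
noncomputable def familyHom (hH : H ≤ S) (hτ : IsInductionFamily R H F τ) :
    BisetSemiring P →+ M →+ N :=
  ∑ J ∈ subgroups P, ∑ B ∈ subgroups P,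
    (BisetClass.orbitSum (stabVal R F H τ J B) (invariant_stabVal hH hτ)).comp
      { toFun := fun x => x J B, map_zero' := rfl, map_add' := fun _ _ => rfl }

theorem familyHom_single (hH : H ≤ S) (hτ : IsInductionFamily R H F τ) (c : BisetClass J B) :
    familyHom hH hτ (single J B c) =
      BisetClass.orbitSum (stabVal R F H τ J B) (invariant_stabVal hH hτ) c := by
  rw [familyHom, AddMonoidHom.finsetSum_apply, Finset.sum_eq_single J,
    AddMonoidHom.finsetSum_apply, Finset.sum_eq_single B]
  · change BisetClass.orbitSum _ _ (single J B c J B) = _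
    rw [single_same]
  · intro B' _ h
    change BisetClass.orbitSum _ _ (single J B c J B') = _
    rw [single_ne_right _ _ h, map_zero]
  · exact fun h => (h (mem_subgroups B)).elim
  · intro J' _ h
    rw [AddMonoidHom.finsetSum_apply]
    refine Finset.sum_eq_zero fun B' _ => ?_
    change BisetClass.orbitSum _ _ (single J B c J' B') = _
    rw [single_ne_left _ _ h, map_zero]
  · exact fun h => (h (mem_subgroups J)).elim

/-- Summing over orbits defines `familyHom` on all bisets without first proving freeness of the
semiring. A transitive biset has one orbit, whose stabilizer is a graph, so its value can be read
off. -/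
theorem familyHom_cls_mul_resS (hH : H ≤ S) (hτ : IsInductionFamily R H F τ) (hD : D ≤ B)
    (hf : F.IsMor D J f) (m : M) : familyHom hH hτ (cls J D f * resS D B) m =
      τ J D f (el R (inner H) (resS D B) • m) := by
  obtain ⟨ψ, hψ, e⟩ := id hf
  rw [cls_mul_resS e hD, familyHom_single, BisetClass.orbitSum_ofHoms]
  have h1 : {q : J × B | ∃ x, ψ x = q.1 ∧ Subgroup.inclusion hD x = q.2} =
      {q | (q.2 : P) ∈ D ∧ (q.1 : P) = f q.2} := by
    ext ⟨a, b⟩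
    constructor
    · rintro ⟨x, rfl, rfl⟩
      exact ⟨x.2, e x⟩
    · rintro ⟨h1, h2⟩
      exact ⟨⟨b, h1⟩, Subtype.ext ((e _).trans h2.symm), rfl⟩
  rw [h1]
  by_cases hB : B ≤ H
  · exact stabVal_eq hτ hB hD hf m
  · have h2 : resS D B ∉ (inner H).mackeySemiring := by
      intro h
      have h3 := apply_eq_zero_of_mem h D hB
      rw [resS_eq hD, single_same] at h3
      obtain ⟨i⟩ := BisetClass.mk_eq_iff.1 h3
      exact (i.e (FinBiset.basePt _ _)).elim
    rw [stabVal, dif_neg fun h => hB h.1, el, dif_neg h2, zero_smul, map_zero]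
    rfl

theorem familyHom_cls_mul (hH : H ≤ S) (hτ : IsInductionFamily R H F τ) (hD : D ≤ H)
    (hf : F.IsMor D J f) {x : BisetSemiring P} (hx : x ∈ (inner H).mackeySemiring) (m : M) :
    familyHom hH hτ (cls J D f * x) m = τ J D f (el R (inner H) x • m) := by
  suffices h : x ∈ (inner H).mackeySemiring ∧ ∀ m,
      familyHom hH hτ (cls J D f * x) m = τ J D f (el R (inner H) x • m) from h.2 m
  refine mackeySemiring_induction (F := inner H) (p := fun x => x ∈ (inner H).mackeySemiring ∧
    ∀ m, familyHom hH hτ (cls J D f * x) m = τ J D f (el R (inner H) x • m)) ?_ ?_ ?_ hx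
  · refine ⟨zero_mem _, fun m => ?_⟩
    rw [mul_zero, map_zero, el_zero, zero_smul, map_zero]
    rfl
  · rintro x y ⟨hx, hx'⟩ ⟨hy, hy'⟩
    refine ⟨add_mem hx hy, fun m => ?_⟩
    rw [mul_add, map_add, el_add R hx hy, add_smul, map_add, ← hx', ← hy']
    rfl
  · intro J' B E g hB hE hg
    refine ⟨mul_mem hg.cls_mem ((inner H).resS_mem hE hB), fun m => ?_⟩
    rw [← mul_assoc, ← el_smul_smul hg.cls_mem ((inner H).resS_mem hE hB)]
    by_cases hJ : D = J'
    · subst hJ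
      rw [hf.cls_mul_cls hg, familyHom_cls_mul_resS hH hτ hE
        (hf.comp (hg.of_le (inner_le hH))), hτ.smul hD hf hg]
    -- When `D ≠ J'` the product is zero; so is the right side, because `τ J D f` sees its argument
    -- only through `I_D^D`.
    · have hid : (FusionSystem.inner H).IsMor D D id := (FusionSystem.inner H).isMor_id le_rfl hD
      rw [cls_mul_cls_ne hJ, zero_mul, map_zero]
      have h1 := hτ.smul hD hf hid
        (el R (inner H) (cls J' E g) • el R (inner H) (resS E B) • m)
      rw [el_smul_smul hid.cls_mem hg.cls_mem, cls_mul_cls_ne hJ, el_zero, zero_smul,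
        map_zero] at h1
      exact h1

/-- This is the balancing condition needed to descend to the tensor product over the algebra of
`F_H(H)`. -/
theorem familyHom_mul (hH : H ≤ S) (hτ : IsInductionFamily R H F τ) {x y : BisetSemiring P}
    (hx : x ∈ F.mackeySemiring) (hy : y ∈ (inner H).mackeySemiring) (m : M) :
    familyHom hH hτ (x * y) m = familyHom hH hτ x (el R (inner H) y • m) := by
  refine mackeySemiring_induction (F := F) (p := fun x =>
    familyHom hH hτ (x * y) m = familyHom hH hτ x (el R (inner H) y • m)) ?_ ?_ ?_ hx
  · rw [zero_mul, map_zero]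
    rfl
  · intro x x' h h'
    rw [add_mul, map_add, map_add, AddMonoidHom.add_apply, AddMonoidHom.add_apply, h, h']
  · intro J B D f hB hD hf
    by_cases hBH : B ≤ H
    · have hr := (inner H).resS_mem hD hBH
      rw [mul_assoc, familyHom_cls_mul hH hτ (hD.trans hBH) hf (mul_mem hr hy),
        familyHom_cls_mul hH hτ (hD.trans hBH) hf hr, el_smul_smul hr hy]
    · rw [familyHom_cls_mul_resS hH hτ hD hf]
      have h2 : resS D B ∉ (inner H).mackeySemiring := by
        intro h
        have h3 := apply_eq_zero_of_mem h D hBH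
        rw [resS_eq hD, single_same] at h3
        obtain ⟨i⟩ := BisetClass.mk_eq_iff.1 h3
        exact (i.e (FinBiset.basePt _ _)).elim
      rw [el, dif_neg h2, zero_smul, map_zero, mul_assoc]
      have h4 : resS D B * y = 0 := by
        rw [← unitElement_mul hy, ← mul_assoc, resS_eq hD, unitElement, Finset.mul_sum,
          Finset.sum_eq_zero, zero_mul]
        intro A _
        exact single_mul_single_ne _ _ (fun e => hBH (e.le.trans A.2)) _ _
      rw [h4, mul_zero, map_zero]
      rfl

/-- An induction family defines an additive map on the induced module. -/
theorem IsInductionFamily.exists_addHom (hτ : IsInductionFamily R H F τ) (hH : H ≤ S) :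
    ∃ σ : MackeyInduce R (inner_le (F := F) hH) M →+ N,
      ∀ (J D : Subgroup P) (f : P → P), D ≤ H → F.IsMor D J f → ∀ m,
        σ (CornerInd.tmul _ (el R F (cls J D f)) m) = τ J D f m := by
  let Φ : GrothendieckRing F.mackeySemiring →+ M →+ N :=
    GrothendieckRing.lift ((familyHom hH hτ).comp (AddSubmonoidClass.subtype F.mackeySemiring))
  -- The target `N` has no `R`-action, so scalars are made to act on `M` before the family is
  -- applied.
  let act : R →+ M →+ M :=
    { toFun := fun r => DistribSMul.toAddMonoidHom M (algebraMap R (MackeyAlgebra R (inner H)) r)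
      map_zero' := by ext m; simp
      map_add' := fun r s => by ext m; simp [add_smul] }
  let Ψ₀ : R →+ GrothendieckRing F.mackeySemiring →+ M →+ N :=
    { toFun := fun r =>
        { toFun := fun x => (Φ x).comp (act r)
          map_zero' := by ext m; simp
          map_add' := fun x y => by ext m; simp }
      map_zero' := by ext x m; simp
      map_add' := fun r s => by ext x m; simp }
  let Ψ : MackeyAlgebra R F →+ M →+ N :=
    TensorProduct.liftAddHom Ψ₀ fun n r x => by rw [map_zsmul, map_zsmul]; rfl
  have hΨ : ∀ (r : R) (x : BisetSemiring P) (hx : x ∈ F.mackeySemiring) (m : M),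
      Ψ (r • el R F x) m =
        familyHom hH hτ x (algebraMap R (MackeyAlgebra R (inner H)) r • m) := by
    intro r x hx m
    rw [smul_el R r hx]
    change Φ (GrothendieckRing.of _) _ = _
    rw [GrothendieckRing.lift_of]
    rfl
  have hbal : ∀ b a m, Ψ (b * incl R (inner_le (F := F) hH) a) m = Ψ b (a • m) := by
    intro b a m
    induction b using MackeyAlgebra.induction_on with
    | zero => rw [zero_mul, map_zero]; rfl
    | add b c hb hc =>
      rw [add_mul, map_add, map_add, AddMonoidHom.add_apply, AddMonoidHom.add_apply, hb, hc]
    | el r x hx =>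
      induction a using MackeyAlgebra.induction_on with
      | zero => rw [map_zero, mul_zero, map_zero, zero_smul, map_zero]; rfl
      | add a c ha hc => rw [map_add, mul_add, map_add, AddMonoidHom.add_apply, ha, hc, add_smul,
          map_add]
      | el s y hy =>
        have hy' := mackeySemiring_mono (inner_le (F := F) hH) hy
        rw [incl_smul_el R _ _ hy, smul_mul_smul_comm, ← el_mul R hx hy', hΨ _ _ (mul_mem hx hy'),
          hΨ _ _ hx, familyHom_mul hH hτ hx hy, smul_smul, smul_smul, map_mul, Algebra.smul_def]
        congr 2
        rw [← map_mul, ← Algebra.commutes, map_mul, mul_assoc]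
  obtain ⟨σ, hσ⟩ := CornerInd.exists_addHom _ Ψ hbal
  refine ⟨σ, fun J D f hD hf m => ?_⟩
  have h1 := hΨ 1 _ hf.cls_mem m
  rw [one_smul, map_one, one_smul] at h1
  have hid : (FusionSystem.inner H).IsMor D D id := (FusionSystem.inner H).isMor_id le_rfl hD
  have h2 : cls J D f * cls D D id = cls J D f := hf.cls_mul_cls hid
  rw [hσ, h1, ← h2, familyHom_cls_mul hH hτ hD hf hid.cls_mem, hτ.smul hD hf hid]
  rfl

end Presentation

end InducedModule

/-! ### The intertwining element attached to an isomorphism -/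

open FusionSystem BisetSemiring MackeyAlgebra

section ConjSum

theorem BisetClass.push_refl {A B : Type u} [Group A] [Group B] (c : BisetClass A B) :
    push (MulEquiv.refl A) (MulEquiv.refl B) c = c := by
  induction c using BisetClass.ind with
  | h X => exact mk_eq ⟨Equiv.refl _, fun _ _ => rfl, fun _ _ => rfl⟩

variable {P : Type u} [Group P] [Finite P]

/-- The class of `i⁻¹` is the unit biset transported on one side. Commuting it past other classes
thus reduces to the unit laws and multiplicativity of transport. -/
theorem conjClass_symm {D E : Subgroup P} (i : D ≃* E) :
    conjClass i.symm = BisetClass.push (MulEquiv.refl D) i (indClass (le_refl D)) :=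
  (BisetClass.push_ofHoms _ _ _ _ _ _ i (fun x => i.symm_apply_apply x) (fun _ => rfl)).symm

theorem conjClass_symm_mul_push {D D' E E' : Subgroup P} (i : D ≃* D') (j : E ≃* E')
    (c : BisetClass D E) :
    (conjClass i.symm).mul (BisetClass.push i j c) = c.mul (conjClass j.symm) := by
  rw [conjClass_symm, conjClass_symm, ← BisetClass.push_mul, indClass_self, indClass_self,
    BisetClass.id_mul']
  conv_rhs => rw [← BisetClass.push_refl c]
  rw [← BisetClass.push_mul, BisetClass.mul_id']

variable {A B : Subgroup P} (e : A ≃* B)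

/-- The sum of the classes `c_e : e⁻¹(D) → D` over the subgroups `D ≤ B`. -/
noncomputable def conjSum : BisetSemiring P :=
  ∑ D ∈ subgroupsLe B, single D.1 (mapSub e.symm D) (conjClass (mapSubIso e.symm D).symm)

theorem single_mul_conjSum (J : Subgroup P) (D : {D : Subgroup P // D ≤ B})
    (c : BisetClass J D.1) :
    single J D.1 c * conjSum e =
      single J (mapSub e.symm D) (c.mul (conjClass (mapSubIso e.symm D).symm)) := by
  rw [conjSum, Finset.mul_sum, Finset.sum_eq_single D, single_mul_single]
  · exact fun D' _ h => single_mul_single_ne _ _ (fun h' => h (Subtype.ext h'.symm)) _ _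
  · exact fun h => (h (mem_subgroupsLe D)).elim

theorem conjSum_mul_single (E : Subgroup P) (D : {D : Subgroup P // D ≤ B})
    (c : BisetClass (mapSub e.symm D) E) :
    conjSum e * single (mapSub e.symm D) E c =
      single D.1 E ((conjClass (mapSubIso e.symm D).symm).mul c) := by
  rw [conjSum, Finset.sum_mul, Finset.sum_eq_single D, single_mul_single]
  · exact fun D' _ h => single_mul_single_ne _ _ (fun h' => h (mapSub_injective _ h')) _ _
  · exact fun h => (h (mem_subgroupsLe D)).elim

/-- The key identity for `Γ`: right multiplication by this sum converts the action of `F_B(B)` into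
its transport to `F_A(A)`. It is checked on transitive bisets, where a single summand survives on
each side. -/
theorem conjSum_mul_twist {z : BisetSemiring P} (hz : z ∈ (inner B).mackeySemiring) :
    conjSum e * twist e.symm z = z * conjSum e := by
  refine mackeySemiring_induction (F := FusionSystem.inner B) (p := fun z =>
    conjSum e * twist e.symm z = z * conjSum e) ?_ ?_ ?_ hz
  · rw [map_zero, mul_zero, zero_mul]
  · intro x y hx hy
    rw [map_add, mul_add, add_mul, hx, hy]
  · intro J D E f hD hE hf
    have hJ := hf.right_le
    obtain ⟨ψ, _, e'⟩ := hf
    rw [cls_mul_resS e' hE]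
    refine (congrArg (conjSum e * ·) (twist_single e.symm ⟨J, hJ⟩ ⟨D, hD⟩ _)).trans ?_
    refine (conjSum_mul_single e _ ⟨J, hJ⟩ _).trans ?_
    rw [conjClass_symm_mul_push]
    exact (single_mul_conjSum e J ⟨D, hD⟩ _).symm

theorem conjClass_eq_cls {g : P → P} (hg : ∀ a : A, (e a : P) = g a)
    (D : {D : Subgroup P // D ≤ B}) :
    single D.1 (mapSub e.symm D) (conjClass (mapSubIso e.symm D).symm) =
      cls D.1 (mapSub e.symm D) g := by
  refine (cls_eq fun d => ?_).symm
  obtain ⟨d, rfl⟩ := (mapSubIso e.symm D).surjective d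
  change ((mapSubIso e.symm D).symm (mapSubIso e.symm D d) : P) = _
  rw [MulEquiv.symm_apply_apply, coe_mapSubIso, ← hg, MulEquiv.apply_symm_apply]

theorem mem_mapSub_symm {g : P → P} (hg : ∀ a : A, (e a : P) = g a)
    (D : {D : Subgroup P // D ≤ B}) (x : P) : x ∈ mapSub e.symm D ↔ x ∈ A ∧ g x ∈ D.1 := by
  constructor
  · rintro ⟨d, rfl⟩
    have h : g (e.symm ⟨d, D.2 d.2⟩) = d := by rw [← hg, MulEquiv.apply_symm_apply]
    exact ⟨(e.symm ⟨d, D.2 d.2⟩).2, h.symm ▸ d.2⟩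
  · rintro ⟨hx, hd⟩
    refine ⟨⟨g x, hd⟩, ?_⟩
    have h : (⟨g x, D.2 hd⟩ : B) = e ⟨x, hx⟩ := Subtype.ext (hg ⟨x, hx⟩).symm
    change (e.symm ⟨g x, D.2 hd⟩ : P) = x
    rw [h, MulEquiv.symm_apply_apply]

variable {e} {S : Subgroup P} {F : FusionSystem S} {g : P → P}

/-- Only the summand at `C` survives, and its source `E` is the preimage of `C`. -/
theorem cls_mul_conjSum (hg : ∀ a : A, (e a : P) = g a) {J C E : Subgroup P} (hC : C ≤ B)
    (hE : ∀ x, x ∈ E ↔ x ∈ A ∧ g x ∈ C) (f : P → P) :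
    cls J C f * conjSum e = cls J C f * cls C E g := by
  have h : E = mapSub e.symm ⟨C, hC⟩ := by
    ext x
    rw [hE, mem_mapSub_symm e hg]
  obtain ⟨c, hc⟩ := exists_cls_eq_single J C f
  rw [h, hc, ← conjClass_eq_cls e hg ⟨C, hC⟩]
  exact (single_mul_conjSum e J ⟨C, hC⟩ c).trans (single_mul_single _ _ _ _ _).symm

theorem conjSum_mem (hg : ∀ a : A, (e a : P) = g a) (hF : F.IsMor A B g) :
    conjSum e ∈ F.mackeySemiring := by
  refine sum_mem fun D _ => ?_
  rw [conjClass_eq_cls e hg]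
  exact ((hF.mono (mapSub_le _ _)).cod (D.2.trans hF.right_le) fun x hx =>
    ((mem_mapSub_symm e hg D x).1 hx).2).cls_mem

theorem unitElement_mul_conjSum {K : Subgroup P} (hB : B ≤ K) :
    unitElement K * conjSum e = conjSum e := by
  rw [conjSum, Finset.mul_sum]
  exact Finset.sum_congr rfl fun D _ => unitElement_mul_single (D.2.trans hB) _ _

end ConjSum

/-! ### The homomorphism from one summand -/

section Gamma

variable (R : Type v) [CommRing R] {P : Type u} [Group P] [Finite P] {S H K A : Subgroup P}
  {F : FusionSystem S} {M : Type w} [AddCommGroup M] [Module (MackeyAlgebra R (inner H)) M]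

theorem MackeyConjRestrict.val_val_smul (hA : A ≤ H) (φ : A →* K)
    (hφ : Function.Injective φ) (a : MackeyAlgebra R (inner (imageOf φ)))
    (x : MackeyConjRestrict R hA φ hφ M) :
    (a • x).val.val = incl R (inner_le (F := inner H) hA) (hat R (imageIso φ hφ).symm a) •
      x.val.val := rfl

theorem MackeyAlgebra.incl_incl {S S' S'' : Subgroup P} {F : FusionSystem S}
    {F' : FusionSystem S'} {F'' : FusionSystem S''} (h : F.Le F') (h' : F'.Le F'')
    (h'' : F.Le F'') (a : MackeyAlgebra R F) : incl R h' (incl R h a) = incl R h'' a := by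
  induction a using MackeyAlgebra.induction_on with
  | zero => rw [map_zero, map_zero, map_zero]
  | add a b ha hb => rw [map_add, map_add, map_add, ha, hb]
  | el r x hx =>
    rw [incl_smul_el R h r hx, incl_smul_el R h' r (mackeySemiring_mono h hx),
      incl_smul_el R h'' r hx]

/-- The homomorphism from the induction of `^φ(M↓)` to `M↑↓` given by composition with `c_φ`. -/
theorem exists_conjRestrict_hom (hH : H ≤ S) (hK : K ≤ S) (hA : A ≤ H) (φ : A →* K)
    (hφ : φ ∈ F.Hom A K) :
    ∃ Γ : MackeyInduce R (inner_le (F := inner K) (imageOf_le φ))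
          (MackeyConjRestrict R hA φ (F.injective hφ) M) →ₗ[MackeyAlgebra R (inner K)]
        MackeyRestrict R (inner_le (F := F) hK) (MackeyInduce R (inner_le (F := F) hH) M),
      ∀ (J C E : Subgroup P) (f : P → P), C ≤ imageOf φ → (inner K).IsMor C J f →
        (∀ x, x ∈ E ↔ x ∈ A ∧ extFun φ x ∈ C) →
        ∀ x, (Γ (CornerInd.tmul _ (el R (inner K) (cls J C f)) x)).val =
          CornerInd.tmul _ (el R F (cls J E (f ∘ extFun φ))) x.val.val := by
  set e := imageIso φ (F.injective hφ) with he
  have hg : ∀ a : A, (e a : P) = extFun φ a := fun a => (extFun_coe φ a).symm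
  have hφ' : F.IsMor A K (extFun φ) := isMor_extFun hφ
  have hφ'' : F.IsMor A (imageOf φ) (extFun φ) :=
    hφ'.cod ((imageOf_le φ).trans hK) fun a ha => by
      rw [extFun_mk φ ha]
      exact mem_imageOf φ _
  have hC : conjSum e ∈ F.mackeySemiring := conjSum_mem hg hφ''
  -- The sum only involves target subgroups of `φ(A) ≤ K`, so the unit of `F_K(K)` fixes it and the
  -- map below lands in the restriction to `F_K(K)`.
  have hone : incl R (inner_le (F := F) hK) 1 * el R F (conjSum e) = el R F (conjSum e) := by
    rw [← el_unitElement R (F := inner K), incl_el R _ (inner K).unitElement_mem,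
      ← el_mul R (mackeySemiring_mono (inner_le hK) (inner K).unitElement_mem) hC,
      unitElement_mul_conjSum (imageOf_le φ)]
  let g₀ : MackeyConjRestrict R hA φ (F.injective hφ) M →+
      MackeyInduce R (inner_le (F := F) hH) M :=
    { toFun := fun x => CornerInd.tmul _ (el R F (conjSum e)) x.val.val
      map_zero' := map_zero (CornerInd.mkHom _ M (el R F (conjSum e)))
      map_add' := fun x y => map_add (CornerInd.mkHom _ M (el R F (conjSum e))) _ _ }
  have hg₀ : ∀ x, g₀ x = CornerInd.tmul _ (el R F (conjSum e)) x.val.val := fun _ => rfl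
  let g : MackeyConjRestrict R hA φ (F.injective hφ) M →+
      MackeyRestrict R (inner_le (F := F) hK) (MackeyInduce R (inner_le (F := F) hH) M) :=
    g₀.codRestrict (DistribSMul.toAddMonoidHom _ (incl R (inner_le (F := F) hK) 1)).range
      fun x => ⟨g₀ x, by
        change incl R (inner_le (F := F) hK) 1 • g₀ x = g₀ x
        rw [hg₀, CornerInd.smul_tmul, hone]⟩
  have hgv : ∀ x, (g x).val = CornerInd.tmul _ (el R F (conjSum e)) x.val.val := fun _ => rfl
  -- This makes the map compatible with the algebra of `F_{φ(A)}(φ(A))`, as the universal property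
  -- of induction requires.
  have hcomm : ∀ a : MackeyAlgebra R (inner (imageOf φ)),
      incl R (inner_le (F := F) ((imageOf_le φ).trans hK)) a * el R F (conjSum e) =
        el R F (conjSum e) * incl R (inner_le (F := F) (hA.trans hH)) (hat R e.symm a) := by
    intro a
    induction a using MackeyAlgebra.induction_on with
    | zero => rw [map_zero, map_zero, map_zero, zero_mul, mul_zero]
    | add a b ha hb => rw [map_add, map_add, map_add, add_mul, mul_add, ha, hb]
    | el r z hz =>
      have hz' := twist_mem e.symm hz
      rw [hat_smul_el R e.symm r hz, incl_smul_el R _ r hz, incl_smul_el R _ r hz', smul_mul_assoc,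
        mul_smul_comm, ← el_mul R (mackeySemiring_mono (inner_le ((imageOf_le φ).trans hK)) hz) hC,
        ← el_mul R hC (mackeySemiring_mono (inner_le (hA.trans hH)) hz'), conjSum_mul_twist e hz]
  obtain ⟨Γ, hΓ⟩ := CornerInd.exists_linearMap
    (incl R (inner_le (F := inner K) (imageOf_le φ))) g fun a x => by
      apply CornerRes.ext
      rw [hgv, CornerRes.val_smul, hgv, MackeyConjRestrict.val_val_smul, ← CornerInd.tmul_mul_map,
        incl_incl R _ _ (inner_le (F := F) (hA.trans hH)), CornerInd.smul_tmul,
        incl_incl R _ _ (inner_le (F := F) ((imageOf_le φ).trans hK)), hcomm]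
  refine ⟨Γ, fun J C E f hCφ hf hE x => ?_⟩
  have hf' := hf.of_le (inner_le (F := F) hK)
  have hCE : F.IsMor E C (extFun φ) :=
    (hφ'.mono fun x hx => ((hE x).1 hx).1).cod (hCφ.trans hφ''.right_le)
      fun x hx => ((hE x).1 hx).2
  rw [hΓ, CornerRes.val_smul, hgv, CornerInd.smul_tmul, incl_el R _ hf.cls_mem,
    ← el_mul R hf'.cls_mem hC, cls_mul_conjSum hg hCφ hE, hf'.cls_mul_cls hCE]

end Gamma

/-! ### The conjugated restrictions are centric Mackey functors -/

open FusionSystem BisetSemiring MackeyAlgebra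

section Finiteness

variable (R : Type v) [CommRing R] {P : Type u} [Group P] [Finite P] {S T H K A : Subgroup P}

/-- The Mackey algebra of a fusion system over `R` is a finitely generated `R`-module. -/
theorem MackeyAlgebra.moduleFinite (F : FusionSystem S) : Module.Finite R (MackeyAlgebra R F) := by
  let v : Subgroup P × Subgroup P × Subgroup P × (P → P) → MackeyAlgebra R F := fun t =>
    el R F (cls t.1 t.2.2.1 t.2.2.2 * resS t.2.2.1 t.2.1)
  refine ⟨Submodule.fg_def.2 ⟨Set.range v, Set.finite_range v, eq_top_iff.2 fun a _ => ?_⟩⟩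
  induction a using MackeyAlgebra.induction_on with
  | zero => exact zero_mem _
  | add a b ha hb => exact add_mem (ha trivial) (hb trivial)
  | el r x hx =>
    refine Submodule.smul_mem _ r ?_
    suffices h : x ∈ F.mackeySemiring ∧ el R F x ∈ Submodule.span R (Set.range v) from h.2
    refine mackeySemiring_induction (F := F) (p := fun x => x ∈ F.mackeySemiring ∧
      el R F x ∈ Submodule.span R (Set.range v)) ?_ ?_ ?_ hx
    · exact ⟨zero_mem _, by rw [el_zero]; exact zero_mem _⟩
    · rintro x y ⟨hx, hx'⟩ ⟨hy, hy'⟩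
      exact ⟨add_mem hx hy, by rw [el_add R hx hy]; exact add_mem hx' hy'⟩
    · intro J B D f hB hD hf
      exact ⟨mul_mem hf.cls_mem (F.resS_mem hD hB), Submodule.subset_span ⟨(J, B, D, f), rfl⟩⟩

variable (M : Type w) [AddCommGroup M] [Module (MackeyAlgebra R (inner H)) M]

/-- Finite generation passes through `R`: Mackey algebras are finite `R`-modules, so `M` is finite
over `R`. The restriction is an `R`-linear quotient of `M`, by multiplication with the idempotent,
and finiteness over `R` gives finiteness over the smaller algebra. -/
theorem MackeyConjRestrict.finite (hA : A ≤ H) (φ : A →* K) (hφ : Function.Injective φ)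
    (hM : Module.Finite (MackeyAlgebra R (inner H)) M) :
    Module.Finite (MackeyAlgebra R (inner (imageOf φ))) (MackeyConjRestrict R hA φ hφ M) := by
  have := MackeyAlgebra.moduleFinite R (FusionSystem.inner H)
  let _ : Module R M := Module.compHom M (algebraMap R (MackeyAlgebra R (FusionSystem.inner H)))
  have : IsScalarTower R (MackeyAlgebra R (FusionSystem.inner H)) M :=
    IsScalarTower.of_algebraMap_smul fun _ _ => rfl
  have : Module.Finite R M := Module.Finite.trans (MackeyAlgebra R (FusionSystem.inner H)) M
  let _ : Module R (MackeyConjRestrict R hA φ hφ M) :=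
    Module.compHom _ (algebraMap R (MackeyAlgebra R (FusionSystem.inner (imageOf φ))))
  have : IsScalarTower R (MackeyAlgebra R (FusionSystem.inner (imageOf φ)))
      (MackeyConjRestrict R hA φ hφ M) := IsScalarTower.of_algebraMap_smul fun _ _ => rfl
  have hone : ∀ r : R, incl R (inner_le (F := inner H) hA)
      (hat R (imageIso φ hφ).symm (algebraMap R _ r)) =
        r • incl R (inner_le (F := inner H) hA) 1 := by
    intro r
    rw [Algebra.algebraMap_eq_smul_one, ← el_unitElement R,
      hat_smul_el R _ r (FusionSystem.inner (imageOf φ)).unitElement_mem, twist_unitElement,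
      el_unitElement, incl_smul]
  let g : M →ₗ[R] MackeyConjRestrict R hA φ hφ M :=
    { toFun := fun m => (DistribSMul.toAddMonoidHom M
        (incl R (inner_le (F := inner H) hA) 1)).rangeRestrict m
      map_add' := fun m n => map_add _ m n
      map_smul' := fun r m => by
        apply CornerRes.ext
        change incl R (inner_le (F := inner H) hA) 1 •
          (algebraMap R (MackeyAlgebra R (FusionSystem.inner H)) r • m) =
          incl R (inner_le (F := inner H) hA) (hat R (imageIso φ hφ).symm (algebraMap R _ r)) •
            incl R (inner_le (F := inner H) hA) 1 • m
        rw [hone, smul_smul, smul_smul, ← Algebra.commutes, ← Algebra.smul_def, smul_mul_assoc,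
          ← map_mul, one_mul] }
  have : Module.Finite R (MackeyConjRestrict R hA φ hφ M) :=
    Module.Finite.of_surjective g (AddMonoidHom.rangeRestrict_surjective _)
  exact Module.Finite.of_restrictScalars_finite R _ _

variable {M}

theorem MackeyConjRestrict.val_val_ind_smul (hA : A ≤ H) (φ : A →* K)
    (hφ : Function.Injective φ) {C E : Subgroup P} (hC : C ≤ imageOf φ)
    (hE : ∀ x, x ∈ E ↔ x ∈ A ∧ extFun φ x ∈ C) (x : MackeyConjRestrict R hA φ hφ M) :
    (ind R (inner (imageOf φ)) (le_refl C) hC • x).val.val =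
      ind R (inner H) (le_refl E) ((fun x hx => hA ((hE x).1 hx).1 : E ≤ H)) • x.val.val := by
  obtain rfl : E = mapSub (imageIso φ hφ).symm ⟨C, hC⟩ := by
    ext x
    rw [hE, mem_mapSub_symm (imageIso φ hφ) fun a => (extFun_coe φ a).symm]
  have hm : single C C (indClass (le_refl C)) ∈
      (FusionSystem.inner (imageOf φ)).mackeySemiring :=
    NonUnitalSubsemiring.subset_closure (.ind _ hC)
  have ht := twist_mem (imageIso φ hφ).symm hm
  rw [MackeyConjRestrict.val_val_smul, ind_eq_el, ind_eq_el, cls_id, cls_id, hat_el R _ hm,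
    incl_el R _ ht]
  congr 2
  refine (twist_single _ ⟨C, hC⟩ ⟨C, hC⟩ _).trans ?_
  congr 1
  exact BisetClass.push_ofHoms _ _ _ _ _ _ (mapSubIso _ ⟨C, hC⟩) (fun _ => rfl) (fun _ => rfl)

theorem exists_preimage_mem {F : FusionSystem S} {φ : A →* K} (hφ : φ ∈ F.Hom A K)
    (C : Subgroup P) : ∃ E ≤ A, ∀ x, x ∈ E ↔ x ∈ A ∧ extFun φ x ∈ C :=
  (isMor_extFun hφ).exists_preimage C

/-- The element `I_J^J` acts as `I_E^E` with `E = φ⁻¹(J)`. Since `φ` maps `E` to `J` inside `G`, a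
non-centric `J` forces `E` to be non-centric. -/
theorem MackeyConjRestrict.isCentricMackeyFunctor {F : FusionSystem S} {G : FusionSystem T}
    (hFG : F.Le G) (hM : IsCentricMackeyFunctor R (inner H) G M) (hA : A ≤ H) {φ : A →* K}
    (hφ : φ ∈ F.Hom A K) :
    IsCentricMackeyFunctor R (inner (imageOf φ)) G
      (MackeyConjRestrict R hA φ (F.injective hφ) M) := by
  refine ⟨MackeyConjRestrict.finite R M hA φ _ hM.finite, fun J hJ hJG x => ?_⟩
  obtain ⟨E, hEA, hE⟩ := exists_preimage_mem hφ J
  apply CornerRes.ext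
  refine (MackeyConjRestrict.val_val_ind_smul R hA φ _ hJ hE x).trans ?_
  have hφ' : G.IsMor A K (extFun φ) := (isMor_extFun hφ).of_le hFG
  refine hM.ind_smul_eq_zero E (hEA.trans hA) (fun h => hJG (h.target ((hφ'.mono hEA).cod
    (hJ.trans ((imageOf_le φ).trans hφ'.right_le)) fun x hx => ((hE x).1 hx).2))) _

end Finiteness

/-! ### Vanishing of generators and the projection onto a conjugated restriction -/

open FusionSystem BisetSemiring MackeyAlgebra

section InducedElements

variable (R : Type v) [CommRing R] {P : Type u} [Group P] [Finite P] {S T H K A : Subgroup P}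
  {F : FusionSystem S} {G : FusionSystem T} {D E J : Subgroup P} {f g : P → P}
  {M : Type*} [AddCommGroup M] [Module (MackeyAlgebra R (inner H)) M]

theorem tmul_cls_smul (hH : H ≤ S) (hf : F.IsMor D J f) (hg : (inner H).IsMor E D g) (m : M) :
    CornerInd.tmul (incl R (inner_le (F := F) hH)) (el R F (cls J D f))
        (el R (inner H) (cls D E g) • m) =
      CornerInd.tmul _ (el R F (cls J E (f ∘ g))) m := by
  rw [← CornerInd.tmul_mul_map, incl_el R _ hg.cls_mem,
    ← el_mul R hf.cls_mem (hg.of_le (inner_le (F := F) hH)).cls_mem, hf.cls_mul_cls hg]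

theorem tmul_cls_ind (hH : H ≤ S) (hD : D ≤ H) (hf : F.IsMor D J f) (m : M) :
    CornerInd.tmul (incl R (inner_le (F := F) hH)) (el R F (cls J D f))
        (ind R (inner H) (le_refl D) hD • m) =
      CornerInd.tmul _ (el R F (cls J D f)) m := by
  rw [ind_eq_el, tmul_cls_smul R hH hf ((FusionSystem.inner H).isMor_id le_rfl hD)]
  rfl

/-- The element `m` can be replaced by `I_D^D m`, which is zero. -/
theorem tmul_cls_eq_zero (hH : H ≤ S) (hM : IsCentricMackeyFunctor R (inner H) G M) (hD : D ≤ H)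
    (hDG : ¬ G.IsCentric D) (hf : F.IsMor D J f) (m : M) :
    CornerInd.tmul (incl R (inner_le (F := F) hH)) (el R F (cls J D f)) m = 0 := by
  rw [← tmul_cls_ind R hH hD hf, hM.ind_smul_eq_zero D hD hDG]
  exact map_zero (CornerInd.mkHom _ M (el R F (cls J D f)))

theorem el_cls_smul_eq_zero (hM : IsCentricMackeyFunctor R (inner H) G M) (hD : D ≤ H)
    (hDG : ¬ G.IsCentric D) (hf : (inner H).IsMor D J f) (m : M) :
    el R (inner H) (cls J D f) • m = 0 := by
  have hid : (FusionSystem.inner H).IsMor D D id := (FusionSystem.inner H).isMor_id le_rfl hD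
  have h : el R (FusionSystem.inner H) (cls J D f) • m =
      el R (FusionSystem.inner H) (cls J D f) • el R (FusionSystem.inner H) (cls D D id) • m := by
    rw [el_smul_smul hf.cls_mem hid.cls_mem, hf.cls_mul_cls hid]
    rfl
  rw [h, ← ind_eq_el R (le_refl D) hD, hM.ind_smul_eq_zero D hD hDG, smul_zero]

end InducedElements

section ConjProj

variable {P : Type u} [Group P] [Finite P] {H K A B : Subgroup P}

theorem twist_cls {e : A ≃* B} {φ : P → P} (hφ : ∀ a : A, (e a : P) = φ a)
    {C C' D D' : Subgroup P} {f g : P → P} (hC : C ≤ B) (hC' : C' ≤ B)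
    (hD : ∀ x, x ∈ D ↔ x ∈ A ∧ φ x ∈ C) (hD' : ∀ x, x ∈ D' ↔ x ∈ A ∧ φ x ∈ C')
    (hf : (inner A).IsMor D D' f) (hg : (inner B).IsMor C C' g)
    (hfg : ∀ x ∈ D, φ (f x) = g (φ x)) : twist e.symm (cls C' C g) = cls D' D f := by
  obtain rfl : D = mapSub e.symm ⟨C, hC⟩ := by
    ext x
    rw [hD, mem_mapSub_symm e hφ]
  obtain rfl : D' = mapSub e.symm ⟨C', hC'⟩ := by
    ext x
    rw [hD', mem_mapSub_symm e hφ]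
  obtain ⟨α, _, hα⟩ := hf
  obtain ⟨β, _, hβ⟩ := hg
  rw [cls_eq hα, cls_eq hβ]
  refine (twist_single _ ⟨C', hC'⟩ ⟨C, hC⟩ _).trans ?_
  congr 1
  refine BisetClass.push_ofHoms _ _ _ _ _ _ (mapSubIso e.symm ⟨C, hC⟩) (fun x => ?_) fun _ => rfl
  apply Subtype.ext
  rw [hα, coe_mapSubIso, coe_mapSubIso]
  have h1 : (e.symm ⟨x, hC x.2⟩ : P) ∈ mapSub e.symm ⟨C, hC⟩ := ⟨x, rfl⟩
  have h2 : f (e.symm ⟨x, hC x.2⟩) ∈ A := by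
    have h3 := (α ⟨_, h1⟩).2
    rw [hα] at h3
    exact mapSub_le _ _ h3
  have h4 : e ⟨f (e.symm ⟨x, hC x.2⟩), h2⟩ = ⟨β x, hC' (β x).2⟩ := by
    apply Subtype.ext
    rw [hφ, hβ]
    refine (hfg _ h1).trans ?_
    rw [← hφ, MulEquiv.apply_symm_apply]
  have h5 := congrArg Subtype.val (e.symm_apply_eq.2 h4.symm)
  exact h5.symm

variable (R : Type v) [CommRing R] {M : Type w} [AddCommGroup M]
  [Module (MackeyAlgebra R (inner H)) M]

/-- The projection of `M` onto its direct summand `^φ(M↓)`. -/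
noncomputable def conjProj (hA : A ≤ H) (φ : A →* K) (hφ : Function.Injective φ) :
    M →+ MackeyConjRestrict R hA φ hφ M :=
  (DistribSMul.toAddMonoidHom M (incl R (inner_le (F := inner H) hA) 1)).rangeRestrict

variable {R}

theorem conjProj_val_val (hA : A ≤ H) (φ : A →* K) (hφ : Function.Injective φ) (m : M) :
    (conjProj R hA φ hφ m).val.val = incl R (inner_le (F := inner H) hA) 1 • m := rfl

theorem conjProj_of_val_val (hA : A ≤ H) (φ : A →* K) (hφ : Function.Injective φ)
    (x : MackeyConjRestrict R hA φ hφ M) : conjProj R hA φ hφ x.val.val = x :=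
  CornerRes.ext (CornerRes.map_one_smul_val x.val)

theorem incl_one_smul_el (hA : A ≤ H) {x : BisetSemiring P} (hx : x ∈ (inner A).mackeySemiring)
    (m : M) : incl R (inner_le (F := inner H) hA) 1 • el R (inner H) x • m =
      el R (inner H) x • m := by
  rw [smul_smul, ← el_unitElement R (F := FusionSystem.inner A),
    ← incl_el R (inner_le (F := FusionSystem.inner H) hA) hx,
    ← map_mul, ← el_mul R (FusionSystem.inner A).unitElement_mem hx, unitElement_mul hx]

theorem el_smul_incl_one (hA : A ≤ H) {x : BisetSemiring P} (hx : x ∈ (inner A).mackeySemiring)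
    (m : M) : el R (inner H) x • incl R (inner_le (F := inner H) hA) 1 • m =
      el R (inner H) x • m := by
  rw [smul_smul, ← el_unitElement R (F := FusionSystem.inner A),
    ← incl_el R (inner_le (F := FusionSystem.inner H) hA) hx,
    ← map_mul, ← el_mul R hx (FusionSystem.inner A).unitElement_mem, mul_unitElement hx]

/-- If `φ` conjugates `f` to `g`, then `c_f` on `M` corresponds to `c_g` on the conjugated module.
-/
theorem conjProj_el_smul (hA : A ≤ H) (φ : A →* K) (hφ : Function.Injective φ)
    {C C' D D' : Subgroup P} {f g : P → P} (hC : C ≤ imageOf φ) (hC' : C' ≤ imageOf φ)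
    (hD : ∀ x, x ∈ D ↔ x ∈ A ∧ extFun φ x ∈ C) (hD' : ∀ x, x ∈ D' ↔ x ∈ A ∧ extFun φ x ∈ C')
    (hf : (inner A).IsMor D D' f) (hg : (inner (imageOf φ)).IsMor C C' g)
    (hfg : ∀ x ∈ D, extFun φ (f x) = g (extFun φ x)) (m : M) :
    conjProj R hA φ hφ (el R (inner H) (cls D' D f) • m) =
      el R (inner (imageOf φ)) (cls C' C g) • conjProj R hA φ hφ m := by
  apply CornerRes.ext
  change _ = ((el R (inner (imageOf φ)) (cls C' C g) • conjProj R hA φ hφ m)).val.val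
  rw [MackeyConjRestrict.val_val_smul, hat_el R _ hg.cls_mem,
    twist_cls (fun a => (extFun_coe φ a).symm) hC hC' hD hD' hf hg hfg, incl_el R _ hf.cls_mem,
    conjProj_val_val, el_smul_incl_one hA hf.cls_mem]
  exact incl_one_smul_el hA hf.cls_mem m

end ConjProj

/-! ### Factorizations and the transfer maps -/

open FusionSystem BisetSemiring MackeyAlgebra

section Factor

variable {P : Type u} [Group P] {S H K A : Subgroup P} {F : FusionSystem S}

/-- `f` is, on `D`, the composite of conjugation by `h`, the map `φ` on `A`, and conjugation
by `k`. -/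
def IsFactor (H K A : Subgroup P) (φ : P → P) (h k : P) (D : Subgroup P) (f : P → P) : Prop :=
  h ∈ H ∧ k ∈ K ∧ ∀ d ∈ D, h * d * h⁻¹ ∈ A ∧ f d = k * φ (h * d * h⁻¹) * k⁻¹

theorem FusionSystem.IsMor.mem_iff_apply_mem_img {D : Subgroup P} {φ : P → P}
    (hφ : F.IsMor A K φ) (hD : D ≤ A) (x : P) : x ∈ D ↔ x ∈ A ∧ φ x ∈ img D φ := by
  constructor
  · exact fun hx => ⟨hD hx, apply_mem_img hx⟩
  · rintro ⟨hx, h⟩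
    obtain ⟨d, hd, e⟩ := (hφ.mono hD).mem_img.1 h
    rwa [hφ.inj hx (hD hd) e.symm]

theorem FusionSystem.isMor_conj_img {D : Subgroup P} (hD : D ≤ H) {h : P} (hh : h ∈ H) :
    (inner H).IsMor D (img D fun x => h * x * h⁻¹) (fun x => h * x * h⁻¹) :=
  ((inner H).isMor_conj hh hD le_rfl fun _ hx => mul_mem (mul_mem hh (hD hx)) (inv_mem hh)).to_img

theorem FusionSystem.IsMor.img_le_imageOf {D : Subgroup P} {φ : A →* K} (hφ : φ ∈ F.Hom A K)
    (hD : D ≤ A) : img D (extFun φ) ≤ imageOf φ := by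
  intro x hx
  obtain ⟨d, hd, rfl⟩ := ((isMor_extFun hφ).mono hD).mem_img.1 hx
  rw [extFun_mk φ (hD hd)]
  exact mem_imageOf φ _

variable {D J : Subgroup P} {φ : A →* K} {h k : P} {f : P → P}

namespace IsFactor

theorem img_le (hf : IsFactor H K A (extFun φ) h k D f) (hD : D ≤ H) :
    img D (fun x => h * x * h⁻¹) ≤ A := by
  intro x hx
  obtain ⟨d, hd, rfl⟩ := (isMor_conj_img hD hf.1).mem_img.1 hx
  exact (hf.2.2 d hd).1

theorem exists_of_mem (hf : IsFactor H K A (extFun φ) h k D f) (hφ : φ ∈ F.Hom A K) (hD : D ≤ H)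
    {y : P} (hy : y ∈ img (img D fun x => h * x * h⁻¹) (extFun φ)) :
    ∃ d ∈ D, y = extFun φ (h * d * h⁻¹) ∧ f d = k * y * k⁻¹ := by
  obtain ⟨x, hx, rfl⟩ := ((isMor_extFun hφ).mono (hf.img_le hD)).mem_img.1 hy
  obtain ⟨d, hd, rfl⟩ := (isMor_conj_img hD hf.1).mem_img.1 hx
  exact ⟨d, hd, rfl, (hf.2.2 d hd).2⟩

theorem isMor_conj (hf : IsFactor H K A (extFun φ) h k D f) (hφ : φ ∈ F.Hom A K) (hD : D ≤ H)
    (hJ : J ≤ K) (hfJ : F.IsMor D J f) :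
    (inner K).IsMor (img (img D fun x => h * x * h⁻¹) (extFun φ)) J (fun x => k * x * k⁻¹) := by
  refine (FusionSystem.inner K).isMor_conj hf.2.1
    ((IsMor.img_le_imageOf hφ (hf.img_le hD)).trans (imageOf_le φ)) hJ fun y hy => ?_
  obtain ⟨d, hd, _, e⟩ := hf.exists_of_mem hφ hD hy
  rw [← e]
  exact hfJ.mem hd

end IsFactor

end Factor

section Transfer

variable (R : Type v) [CommRing R] {P : Type u} [Group P] [Finite P] {S H K A : Subgroup P}
  {F : FusionSystem S} {M : Type w} [AddCommGroup M] [Module (MackeyAlgebra R (inner H)) M]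

/-- The map `y ↦ c_k ⊗ c_h y` on the part of `M` attached to a subgroup `D` with `hDh⁻¹ ≤ A`. -/
noncomputable def transfer (hA : A ≤ H) (φ : A →* K) (hφ : Function.Injective φ)
    (J D : Subgroup P) (h k : P) :
    M →+ MackeyInduce R (inner_le (F := inner K) (imageOf_le φ))
      (MackeyConjRestrict R hA φ hφ M) :=
  (CornerInd.mkHom _ (MackeyConjRestrict R hA φ hφ M) (el R (inner K)
    (cls J (img (img D fun x => h * x * h⁻¹) (extFun φ)) (fun x => k * x * k⁻¹)))).comp
    ((conjProj R hA φ hφ).comp (DistribSMul.toAddMonoidHom M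
      (el R (inner H) (cls (img D fun x => h * x * h⁻¹) D (fun x => h * x * h⁻¹)))))

theorem transfer_apply (hA : A ≤ H) (φ : A →* K) (hφ : Function.Injective φ)
    (J D : Subgroup P) (h k : P) (m : M) : transfer R hA φ hφ J D h k m =
      CornerInd.tmul _ (el R (inner K)
        (cls J (img (img D fun x => h * x * h⁻¹) (extFun φ)) (fun x => k * x * k⁻¹)))
        (conjProj R hA φ hφ (el R (inner H)
          (cls (img D fun x => h * x * h⁻¹) D (fun x => h * x * h⁻¹)) • m)) := rfl

variable {R} {D E J : Subgroup P} {φ : A →* K} {h k h' k' s : P} {f g : P → P}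

/-- With `h' = a h s` and `a ∈ A`, one has `c_h c_s = c_a⁻¹ c_{h'}`. The factor `c_a⁻¹` lies in
`F_A(A)`, turns into conjugation by `φ(a⁻¹)`, crosses the tensor sign and is absorbed in the change
from `k` to `k'`. -/
theorem transfer_cls_smul (hA : A ≤ H) (hφ : φ ∈ F.Hom A K) (hD : D ≤ H)
    (hJ : J ≤ K) (hf : F.IsMor D J f) (hg : (inner H).IsMor E D g)
    (hgs : ∀ x ∈ E, g x = s * x * s⁻¹) (hfh : IsFactor H K A (extFun φ) h k D f)
    (hfh' : IsFactor H K A (extFun φ) h' k' E (f ∘ g)) (ha : h' * (h * s)⁻¹ ∈ A) (m : M) :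
    transfer R hA φ (F.injective hφ) J D h k (el R (inner H) (cls D E g) • m) =
      transfer R hA φ (F.injective hφ) J E h' k' m := by
  have hφ' := isMor_extFun hφ
  have hE : E ≤ H := hg.left_le
  rw [transfer_apply, transfer_apply]
  have hDA := hfh.img_le hD
  have hEA := hfh'.img_le hE
  have hm1 := isMor_conj_img hD hfh.1
  have hm2 := isMor_conj_img hE hfh'.1
  have hk1 := hfh.isMor_conj hφ hD hJ hf
  have hmemE := fun y => hfh'.exists_of_mem hφ hE (y := y)
  have hmE := fun x => hm2.mem_img (x := x)
  have hC1 := IsMor.img_le_imageOf hφ hDA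
  have hC2 := IsMor.img_le_imageOf hφ hEA
  have hi1 := hφ'.mem_iff_apply_mem_img hDA
  have hi2 := hφ'.mem_iff_apply_mem_img hEA
  have hgD : ∀ x ∈ E, h * g x * h⁻¹ ∈ img D fun x => h * x * h⁻¹ := fun x hx =>
    IsMor.apply_mem_img (f := fun x => h * x * h⁻¹) (hg.mem hx)
  generalize (img D fun x => h * x * h⁻¹) = D' at *
  generalize (img E fun x => h' * x * h'⁻¹) = E' at *
  set a := h' * (h * s)⁻¹ with ha'
  have hak : ∀ x ∈ E, a⁻¹ * (h' * x * h'⁻¹) * a = h * g x * h⁻¹ := fun x hx => by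
    rw [hgs x hx, ha']
    group
  have haE : ∀ x ∈ E', a⁻¹ * x * a⁻¹⁻¹ ∈ D' := by
    intro x hx
    obtain ⟨y, hy, rfl⟩ := (hmE x).1 hx
    rw [inv_inv, hak y hy]
    exact hgD y hy
  have hm3 : (FusionSystem.inner A).IsMor E' D' (fun x => a⁻¹ * x * a⁻¹⁻¹) :=
    (FusionSystem.inner A).isMor_conj (inv_mem ha) hEA hDA haE
  have hb : extFun φ a⁻¹ ∈ imageOf φ := by
    rw [extFun_mk φ (inv_mem ha)]
    exact mem_imageOf φ _
  have hab : ∀ x ∈ A, extFun φ (a⁻¹ * x * a⁻¹⁻¹) =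
      extFun φ a⁻¹ * extFun φ x * (extFun φ a⁻¹)⁻¹ := fun x hx => hφ'.map_conj (inv_mem ha) hx
  have hm4 : (FusionSystem.inner (imageOf φ)).IsMor (img E' (extFun φ)) (img D' (extFun φ))
      (fun x => extFun φ a⁻¹ * x * (extFun φ a⁻¹)⁻¹) := by
    refine (FusionSystem.inner _).isMor_conj hb hC2 hC1 fun y hy => ?_
    obtain ⟨x, hx, rfl⟩ := (hφ'.mono hEA).mem_img.1 hy
    rw [← hab x (hEA hx)]
    exact IsMor.apply_mem_img (haE x hx)
  have e1 : cls D' D (fun x => h * x * h⁻¹) * cls D E g =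
      cls D' E' (fun x => a⁻¹ * x * a⁻¹⁻¹) * cls E' E (fun x => h' * x * h'⁻¹) := by
    rw [hm1.cls_mul_cls hg, hm3.cls_mul_cls hm2]
    refine cls_congr fun x hx => ?_
    simp only [Function.comp_apply]
    rw [inv_inv, hak x hx]
  rw [el_smul_smul hm1.cls_mem hg.cls_mem, e1,
    ← el_smul_smul (hm3.of_le (inner_le hA)).cls_mem hm2.cls_mem,
    conjProj_el_smul hA φ _ hC2 hC1 hi2 hi1 hm3 hm4 (fun x hx => hab x (hEA hx)),
    tmul_cls_smul R (imageOf_le φ) hk1 hm4]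
  -- The remaining maps agree because both factorizations compute `f (g x)`.
  congr 2
  refine cls_congr fun y hy => ?_
  obtain ⟨x, hx, e2, e3⟩ := hmemE y hy
  rw [← e3]
  simp only [Function.comp_apply]
  rw [(hfh.2.2 _ (hg.mem hx)).2, ← hak x hx, e2]
  have h1 := hab _ (hfh'.2.2 x hx).1
  rw [inv_inv] at h1
  rw [h1]

/-- The case of the identity of `D`: changing `h` within its coset of `A` does not affect the
transfer. -/
theorem transfer_congr (hA : A ≤ H) (hφ : φ ∈ F.Hom A K) (hD : D ≤ H)
    (hJ : J ≤ K) (hf : F.IsMor D J f) (hfh : IsFactor H K A (extFun φ) h k D f)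
    (hfh' : IsFactor H K A (extFun φ) h' k' D f) (ha : h' * h⁻¹ ∈ A) :
    transfer (M := M) R hA φ (F.injective hφ) J D h k =
      transfer R hA φ (F.injective hφ) J D h' k' := by
  have hid : (FusionSystem.inner H).IsMor D D id := (FusionSystem.inner H).isMor_id le_rfl hD
  ext m
  rw [← transfer_cls_smul (s := 1) hA hφ hD hJ hf hid (fun x _ => by simp) hfh hfh'
    (by rwa [mul_one]), transfer_apply, transfer_apply,
    el_smul_smul (isMor_conj_img hD hfh.1).cls_mem hid.cls_mem,
    (isMor_conj_img hD hfh.1).cls_mul_cls hid]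
  rfl

end Transfer

/-! ### The inverse map as an induction family -/

open FusionSystem BisetSemiring MackeyAlgebra

section ProductFamily

variable (R : Type v) [CommRing R] {P : Type u} [Group P] [Finite P] {S T H K : Subgroup P}
  {F : FusionSystem S} {G : FusionSystem T} {Q : Set (F.ProdPair H K)} {φ : ∀ q : Q, q.1.A →* K}
  (hφ : ∀ q : Q, φ q ∈ F.Hom q.1.A K)
  (M : Type w) [AddCommGroup M] [Module (MackeyAlgebra R (inner H)) M]

/-- The summand of the product formula attached to an element of `[H × K]`. -/
abbrev ProductSummand (q : Q) : Type _ :=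
  MackeyInduce R (inner_le (F := inner K) (imageOf_le (φ q)))
    (MackeyConjRestrict R q.1.le (φ q) (F.injective (hφ q)) M)

variable [DecidableEq Q] {M}

open Classical in
/-- The maps `y ↦ c_k ⊗ c_h y` attached to the factorizations `f = c_k φ c_h` of the morphisms
`f : D → J ≤ K` with `D ≤ H` centric. -/
noncomputable def productFamily (J D : Subgroup P) (f : P → P) :
    M →+ DirectSum Q (ProductSummand R hφ M) :=
  if hc : (J ≤ K ∧ F.IsCentric D ∧ F.IsMor D J f) ∧ ∃ t : Q × P × P,
      IsFactor H K t.1.1.A (extFun (φ t.1)) t.2.1 t.2.2 D f then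
    (DirectSum.of (ProductSummand R hφ M) hc.2.choose.1).comp
      (transfer R hc.2.choose.1.1.le (φ hc.2.choose.1) (F.injective (hφ hc.2.choose.1)) J D
        hc.2.choose.2.1 hc.2.choose.2.2) else 0

variable {R} {D E J : Subgroup P} {f g : P → P}

theorem productFamily_eq_zero (h : ¬ (J ≤ K ∧ F.IsCentric D)) :
    productFamily (M := M) R hφ J D f = 0 :=
  dif_neg fun h' => h ⟨h'.1.1, h'.1.2.1⟩

theorem FusionSystem.IsProduct.exists_isFactor {hH : H ≤ S} (hQ : F.IsProduct hH Q)
    (hφQ : ∀ q : Q, OrbitHom.mk (φ q) (hφ q) = q.1.hom) (hD : F.IsCentric D) (hDH : D ≤ H)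
    (hf : F.IsMor D K f) :
    ∃ (q : Q) (h k : P), IsFactor H K q.1.A (extFun (φ q)) h k D f := by
  obtain ⟨q, hq, hp⟩ := hQ.exists_prec hD hDH hf
  obtain ⟨h, hh, k, hk, e⟩ := hp (φ ⟨q, hq⟩) (hφ ⟨q, hq⟩) (hφQ ⟨q, hq⟩)
  refine ⟨⟨q, hq⟩, h⁻¹, k, inv_mem hh, hk, fun d hd => ?_⟩
  rw [inv_inv]
  exact e d hd

variable {p : ℕ} [Fact p.Prime]

/-- Unique factorization makes the value independent of the chosen `(q, h, k)`. -/
theorem productFamily_eq (hS : IsPGroup p S) (hF : F.IsSaturated p) {hH : H ≤ S}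
    (hQ : F.IsProduct hH Q) (hφQ : ∀ q : Q, OrbitHom.mk (φ q) (hφ q) = q.1.hom) (hJ : J ≤ K)
    (hD : F.IsCentric D) (hDH : D ≤ H) (hf : F.IsMor D J f) {q : Q} {h k : P}
    (hfac : IsFactor H K q.1.A (extFun (φ q)) h k D f) :
    productFamily (M := M) R hφ J D f = (DirectSum.of (ProductSummand R hφ M) q).comp
      (transfer R q.1.le (φ q) (F.injective (hφ q)) J D h k) := by
  have hc : (J ≤ K ∧ F.IsCentric D ∧ F.IsMor D J f) ∧ ∃ t : Q × P × P,
      IsFactor H K t.1.1.A (extFun (φ t.1)) t.2.1 t.2.2 D f := ⟨⟨hJ, hD, hf⟩, (q, h, k), hfac⟩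
  have key : ∀ (q' : Q) (h' k' : P), IsFactor H K q'.1.A (extFun (φ q')) h' k' D f →
      (DirectSum.of (ProductSummand R hφ M) q').comp
        (transfer R q'.1.le (φ q') (F.injective (hφ q')) J D h' k') =
      (DirectSum.of (ProductSummand R hφ M) q).comp
        (transfer R q.1.le (φ q) (F.injective (hφ q)) J D h k) := by
    intro q' h' k' hs
    obtain ⟨e, ha⟩ := hQ.unique_factorization hS hF hD q'.2 q.2 (hφQ q') (hφQ q) hs.1 hfac.1
      hs.2.1 hfac.2.1 hs.2.2 hfac.2.2
    obtain rfl : q' = q := Subtype.ext e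
    rw [transfer_congr q'.1.le (hφ q') hDH hJ hf hs hfac ha]
  rw [productFamily, dif_pos hc]
  exact key _ _ _ hc.2.choose_spec

theorem IsFactor.source_le {A : Subgroup P} {φ f : P → P} {h k : P}
    (hf : IsFactor H K A φ h k D f) (hA : A ≤ H) : D ≤ H := by
  intro d hd
  have h1 := mul_mem (mul_mem (inv_mem hf.1) (hA (hf.2.2 d hd).1)) hf.1
  rwa [show h⁻¹ * (h * d * h⁻¹) * h = d by group] at h1

/-- A factorization `f = c_k φ c_h` induces one of `f c_s`, with `h s` for `h`, and one of `c_j f`,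
with `j k` for `k`; comparing the transfers gives the relations. -/
theorem isInductionFamily_productFamily (hS : IsPGroup p S) (hF : F.IsSaturated p)
    (hFG : F.Le G) (hM : IsCentricMackeyFunctor R (inner H) G M) {hH : H ≤ S} (hK : K ≤ S)
    (hQ : F.IsProduct hH Q) (hφQ : ∀ q : Q, OrbitHom.mk (φ q) (hφ q) = q.1.hom) :
    IsInductionFamily R H F (productFamily (M := M) R hφ) where
  congr {J D f g} e := by
    have h1 : ∀ t : Q × P × P, IsFactor H K t.1.1.A (extFun (φ t.1)) t.2.1 t.2.2 D f ↔
        IsFactor H K t.1.1.A (extFun (φ t.1)) t.2.1 t.2.2 D g := fun t => by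
      refine and_congr_right fun _ => and_congr_right fun _ => ?_
      exact forall₂_congr fun d hd => by rw [e d hd]
    have h2 : F.IsMor D J f ↔ F.IsMor D J g :=
      ⟨fun h => h.congr e, fun h => h.congr fun d hd => (e d hd).symm⟩
    by_cases hc : (J ≤ K ∧ F.IsCentric D ∧ F.IsMor D J f) ∧ ∃ t : Q × P × P,
      IsFactor H K t.1.1.A (extFun (φ t.1)) t.2.1 t.2.2 D f
    · obtain ⟨⟨hJ, hD, hf⟩, t, ht⟩ := hc
      have hDH := ht.source_le t.1.1.le
      rw [productFamily_eq hφ hS hF hQ hφQ hJ hD hDH hf ht,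
        productFamily_eq hφ hS hF hQ hφQ hJ hD hDH (h2.1 hf) ((h1 t).1 ht)]
    · rw [productFamily, productFamily, dif_neg hc, dif_neg]
      rintro ⟨⟨hJ, hD, hf⟩, t, ht⟩
      exact hc ⟨⟨hJ, hD, h2.2 hf⟩, t, (h1 t).2 ht⟩
  smul {J D E f g} hD hf hg m := by
    by_cases hJ : J ≤ K
    · by_cases hEc : F.IsCentric E
      · have hDc : F.IsCentric D := hEc.target (hg.of_le (inner_le hH))
        obtain ⟨q, h, k, hfac⟩ := hQ.exists_isFactor hφ hφQ hDc hD (hf.mono_right hJ hK)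
        obtain ⟨s, hs, hgs⟩ : ∃ s ∈ H, ∀ x ∈ E, g x = s * x * s⁻¹ := by
          obtain ⟨γ, ⟨_, _, s, hs, hγ⟩, e⟩ := hg
          exact ⟨s, hs, fun x hx => (e ⟨x, hx⟩).symm.trans (hγ ⟨x, hx⟩)⟩
        have hfac' : IsFactor H K q.1.A (extFun (φ q)) (h * s) k E (f ∘ g) := by
          refine ⟨mul_mem hfac.1 hs, hfac.2.1, fun x hx => ?_⟩
          have h1 := hfac.2.2 _ (hg.mem hx)
          have h2 : h * g x * h⁻¹ = h * s * x * (h * s)⁻¹ := by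
            rw [hgs x hx]
            group
          rw [h2] at h1
          exact h1
        rw [productFamily_eq hφ hS hF hQ hφQ hJ hDc hD hf hfac,
          productFamily_eq hφ hS hF hQ hφQ hJ hEc hg.left_le
            (hf.comp (hg.of_le (inner_le hH))) hfac', AddMonoidHom.comp_apply,
          AddMonoidHom.comp_apply, transfer_cls_smul q.1.le (hφ q) hD hJ hf hg hgs hfac hfac'
            (by rw [mul_inv_cancel]; exact one_mem _)]
      -- A subgroup `E` that is not `F`-centric is not `G`-centric either, so `c_g m = 0`. This is
      -- where the centricity of `M` enters.
      · rw [productFamily_eq_zero hφ (J := J) (D := E) fun h => hEc h.2,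
          el_cls_smul_eq_zero R hM hg.left_le
            (fun h => hEc (h.of_le hFG (hg.left_le.trans hH))) hg, map_zero]
        rfl
    · rw [productFamily_eq_zero hφ (J := J) (D := E) fun h => hJ h.1,
        productFamily_eq_zero hφ (J := J) (D := D) fun h => hJ h.1]
      rfl
  conj {J D f} hD hf j hj := by
    by_cases h : J ≤ K ∧ F.IsCentric D
    · obtain ⟨hJ, hDc⟩ := h
      obtain ⟨q, h, k, hfac⟩ := hQ.exists_isFactor hφ hφQ hDc hD (hf.mono_right hJ hK)
      have hfac' : IsFactor H K q.1.A (extFun (φ q)) h (j * k) D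
          (fun x => j * f x * j⁻¹) := by
        refine ⟨hfac.1, mul_mem (hJ hj) hfac.2.1, fun x hx => ⟨(hfac.2.2 x hx).1, ?_⟩⟩
        change j * f x * j⁻¹ = _
        rw [(hfac.2.2 x hx).2]
        group
      have hj' : F.IsMor D J (fun x => j * f x * j⁻¹) :=
        (F.isMor_conj (hf.right_le hj) hf.right_le hf.right_le
          fun x hx => mul_mem (mul_mem hj hx) (inv_mem hj)).comp hf
      rw [productFamily_eq hφ hS hF hQ hφQ hJ hDc hD hf hfac,
        productFamily_eq hφ hS hF hQ hφQ hJ hDc hD hj' hfac']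
      ext m
      rw [AddMonoidHom.comp_apply, AddMonoidHom.comp_apply, transfer_apply, transfer_apply,
        ← (hfac.isMor_conj (hφ q) hD hJ hf).cls_conj hj]
      have e : (fun x => j * k * x * (j * k)⁻¹) = fun x => j * (k * x * k⁻¹) * j⁻¹ := by
        ext x
        group
      rw [e]
    · rw [productFamily_eq_zero hφ h, productFamily_eq_zero hφ h]

end ProductFamily

/-! ### The product formula -/

open FusionSystem BisetSemiring MackeyAlgebra

section ProductFormula

variable (R : Type v) [CommRing R] {P : Type u} [Group P] [Finite P] {S T H K : Subgroup P}
  {F : FusionSystem S} {G : FusionSystem T}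

theorem incl_one_mul_el_of_not_le {J D : Subgroup P} {f : P → P} (hK : K ≤ S) (hJ : ¬ J ≤ K)
    (hf : F.IsMor D J f) : incl R (inner_le (F := F) hK) 1 * el R F (cls J D f) = 0 := by
  rw [← el_unitElement R (F := FusionSystem.inner K),
    incl_el R _ (FusionSystem.inner K).unitElement_mem,
    ← el_mul R (mackeySemiring_mono (inner_le hK) (FusionSystem.inner K).unitElement_mem)
      hf.cls_mem]
  obtain ⟨c, hc⟩ := exists_cls_eq_single J D f
  rw [hc, unitElement, Finset.sum_mul, Finset.sum_eq_zero, el_zero]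
  exact fun A _ => single_mul_single_ne _ _ (fun e => hJ (e.ge.trans A.2)) _ _

theorem incl_one_mul_el {J D : Subgroup P} {f : P → P} (hK : K ≤ S) (hJ : J ≤ K)
    (hf : F.IsMor D J f) :
    incl R (inner_le (F := F) hK) 1 * el R F (cls J D f) = el R F (cls J D f) := by
  rw [← el_unitElement R (F := FusionSystem.inner K),
    incl_el R _ (FusionSystem.inner K).unitElement_mem,
    ← el_mul R (mackeySemiring_mono (inner_le hK) (FusionSystem.inner K).unitElement_mem)
      hf.cls_mem]
  obtain ⟨c, hc⟩ := exists_cls_eq_single J D f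
  rw [hc, unitElement_mul_single hJ]

variable {R} {Q : Set (F.ProdPair H K)} {φ : ∀ q : Q, q.1.A →* K}
  (hφ : ∀ q : Q, φ q ∈ F.Hom q.1.A K) {M : Type w} [AddCommGroup M]
  [Module (MackeyAlgebra R (inner H)) M]

theorem exists_cls_eq_conj {C J : Subgroup P} {f : P → P} (hf : (inner K).IsMor C J f) :
    ∃ k ∈ K, ∀ x ∈ C, f x = k * x * k⁻¹ := by
  obtain ⟨γ, ⟨_, _, k, hk, hγ⟩, e⟩ := hf
  exact ⟨k, hk, fun x hx => (e ⟨x, hx⟩).symm.trans (hγ ⟨x, hx⟩)⟩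

theorem FusionSystem.img_preimage {A C E : Subgroup P} {φ : A →* K} (hφ : φ ∈ F.Hom A K)
    (hC : C ≤ imageOf φ) (hE : ∀ x, x ∈ E ↔ x ∈ A ∧ extFun φ x ∈ C) : img E (extFun φ) = C := by
  have hEA : E ≤ A := fun x hx => ((hE x).1 hx).1
  ext y
  rw [((isMor_extFun hφ).mono hEA).mem_img]
  constructor
  · rintro ⟨x, hx, rfl⟩
    exact ((hE x).1 hx).2
  · intro hy
    obtain ⟨a, rfl⟩ := hC hy
    exact ⟨a, (hE a).2 ⟨a.2, by rw [extFun_coe]; exact hy⟩, extFun_coe φ a⟩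

/-- The transfer along a trivial factorization. -/
theorem transfer_one {A C E J : Subgroup P} (hA : A ≤ H) {φ : A →* K} (hφ : φ ∈ F.Hom A K)
    {f : P → P} {k : P} (hf : (inner K).IsMor C J f) (hk : ∀ x ∈ C, f x = k * x * k⁻¹)
    (hC : C ≤ imageOf φ) (hE : ∀ x, x ∈ E ↔ x ∈ A ∧ extFun φ x ∈ C)
    (x : MackeyConjRestrict R hA φ (F.injective hφ) M) :
    transfer R hA φ (F.injective hφ) J E 1 k x.val.val =
      CornerInd.tmul _ (el R (inner K) (cls J C f)) x := by
  have hEA : E ≤ A := fun x hx => ((hE x).1 hx).1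
  have h1 : (fun x : P => 1 * x * 1⁻¹) = id := by
    ext x
    simp
  have h2 : img E id = E := by
    ext x
    rw [((FusionSystem.inner A).isMor_id le_rfl hEA).mem_img]
    simp
  have hcls : cls J C (fun x => k * x * k⁻¹) = cls J C f :=
    cls_congr fun x hx => (hk x hx).symm
  have hCid : (FusionSystem.inner (imageOf φ)).IsMor C C id :=
    (FusionSystem.inner _).isMor_id le_rfl hC
  rw [transfer_apply, h1, h2, img_preimage hφ hC hE, hcls,
    conjProj_el_smul hA φ _ hC hC hE hE ((FusionSystem.inner A).isMor_id le_rfl hEA) hCid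
      (fun _ _ => rfl), conjProj_of_val_val, tmul_cls_smul R (imageOf_le φ) hf hCid]
  rfl

variable [DecidableEq Q] {p : ℕ} [Fact p.Prime]

theorem exists_productEquiv (hS : IsPGroup p S) (hF : F.IsSaturated p) (hFG : F.Le G)
    (hM : IsCentricMackeyFunctor R (inner H) G M) (hH : H ≤ S) (hK : K ≤ S)
    (hQ : F.IsProduct hH Q) (hφQ : ∀ q : Q, OrbitHom.mk (φ q) (hφ q) = q.1.hom) :
    ∃ Γ : DirectSum Q (ProductSummand R hφ M) ≃ₗ[MackeyAlgebra R (inner K)]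
        MackeyRestrict R (inner_le (F := F) hK) (MackeyInduce R (inner_le (F := F) hH) M),
      ∀ (q : Q) (J C E : Subgroup P) (f : P → P), C ≤ imageOf (φ q) → (inner K).IsMor C J f →
        (∀ x, x ∈ E ↔ x ∈ q.1.A ∧ extFun (φ q) x ∈ C) →
        ∀ x, (Γ (DirectSum.of (ProductSummand R hφ M) q
            (CornerInd.tmul _ (el R (inner K) (cls J C f)) x))).val =
          CornerInd.tmul _ (el R F (cls J E (f ∘ extFun (φ q)))) x.val.val := by
  choose Γ₀ hΓ₀ using fun q : Q =>
    exists_conjRestrict_hom R (M := M) hH hK q.1.le (φ q) (hφ q)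
  let Γ₁ : DirectSum Q (ProductSummand R hφ M) →ₗ[MackeyAlgebra R (FusionSystem.inner K)]
      MackeyRestrict R (inner_le (F := F) hK) (MackeyInduce R (inner_le (F := F) hH) M) :=
    DirectSum.toModule _ Q _ Γ₀
  have hΓ₁ : ∀ (q : Q) (J C E : Subgroup P) (f : P → P), C ≤ imageOf (φ q) →
      (FusionSystem.inner K).IsMor C J f →
        (∀ x, x ∈ E ↔ x ∈ q.1.A ∧ extFun (φ q) x ∈ C) →
        ∀ x, (Γ₁ (DirectSum.of (ProductSummand R hφ M) q
            (CornerInd.tmul _ (el R (inner K) (cls J C f)) x))).val =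
          CornerInd.tmul _ (el R F (cls J E (f ∘ extFun (φ q)))) x.val.val := by
    intro q J C E f hC hf hE x
    rw [← hΓ₀ q J C E f hC hf hE x]
    exact congrArg CornerRes.val (DirectSum.toModule_lof (MackeyAlgebra R (FusionSystem.inner K)) q _)
  obtain ⟨σ, hσ⟩ := (isInductionFamily_productFamily hφ hS hF hFG hM hK hQ hφQ).exists_addHom hH
  -- On a generator `c_f ⊗ x` of the summand `q`, the morphism `f φ` comes with the factorization
  -- with `h = 1`, whose transfer gives back `c_f ⊗ x`.
  have hleft : ∀ t, σ (Γ₁ t).val = t := by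
    intro t
    induction t using DirectSum.induction_on with
    | zero =>
      rw [map_zero]
      exact map_zero σ
    | add s t hs ht =>
      rw [map_add, CornerRes.val_add, map_add, hs, ht]
    | of q t =>
      induction t using MackeyInduce.induction_on (imageOf_le (φ q)) with
      | zero =>
        rw [map_zero, map_zero]
        exact map_zero σ
      | add s t hs ht =>
        rw [map_add, map_add, CornerRes.val_add, map_add, hs, ht]
      | tmul J C f hC hf x =>
        obtain ⟨E, hEA, hE⟩ := exists_preimage_mem (hφ q) C
        have hE' : F.IsMor E C (extFun (φ q)) :=
          ((isMor_extFun (hφ q)).mono hEA).cod (hC.trans ((imageOf_le _).trans hK))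
            fun x hx => ((hE x).1 hx).2
        have hfF := (hf.of_le (inner_le (F := F) hK)).comp hE'
        rw [hΓ₁ q J C E f hC hf hE, hσ J E _ (hEA.trans q.1.le) hfF]
        by_cases hEc : F.IsCentric E
        · obtain ⟨k, hk, hfk⟩ := exists_cls_eq_conj hf
          have hfac : IsFactor H K q.1.A (extFun (φ q)) 1 k E (f ∘ extFun (φ q)) := by
            refine ⟨one_mem _, hk, fun d hd => ?_⟩
            rw [inv_one, mul_one, one_mul]
            exact ⟨hEA hd, hfk _ ((hE d).1 hd).2⟩
          rw [productFamily_eq hφ hS hF hQ hφQ hf.right_le hEc (hEA.trans q.1.le) hfF hfac,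
            AddMonoidHom.comp_apply, transfer_one q.1.le (hφ q) hf hfk hC hE]
        -- If `E = φ⁻¹(C)` is not `F`-centric, then `C` is not `G`-centric and the generator itself
        -- is zero.
        · rw [productFamily_eq_zero hφ fun h => hEc h.2, tmul_cls_eq_zero R (imageOf_le (φ q))
            (MackeyConjRestrict.isCentricMackeyFunctor R hFG hM q.1.le (hφ q)) hC ?_ hf, map_zero]
          · rfl
          · intro h
            have h1 := h.of_le hFG (hC.trans ((imageOf_le _).trans hK))
            rw [← img_preimage (hφ q) hC hE] at h1
            exact hEc (h1.of_img ((isMor_extFun (hφ q)).mono hEA))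
  -- It suffices to reach the projections of the generators `c_f ⊗ m`. These vanish unless `J ≤ K`
  -- and `D` is centric, and then `Γ₁` sends `c_k ⊗ c_h m` to `c_k φ c_h ⊗ m = c_f ⊗ m`.
  have hright : Function.Surjective Γ₁ := by
    let π : MackeyInduce R (inner_le (F := F) hH) M →+
        MackeyRestrict R (inner_le (F := F) hK) (MackeyInduce R (inner_le (F := F) hH) M) :=
      (DistribSMul.toAddMonoidHom _ (incl R (inner_le (F := F) hK) 1)).rangeRestrict
    have hπ : ∀ t, (π t).val = incl R (inner_le (F := F) hK) 1 • t := fun _ => rfl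
    have key : ∀ t, ∃ s, Γ₁ s = π t := by
      intro t
      induction t using MackeyInduce.induction_on hH with
      | zero => exact ⟨0, by rw [map_zero, map_zero]⟩
      | add t t' ht ht' =>
        obtain ⟨s, hs⟩ := ht
        obtain ⟨s', hs'⟩ := ht'
        exact ⟨s + s', by rw [map_add, map_add, hs, hs']⟩
      | tmul J D f hD hf m =>
        have hzero : ∀ {t : MackeyInduce R (inner_le (F := F) hH) M},
            incl R (inner_le (F := F) hK) 1 • t = 0 → ∃ s, Γ₁ s = π t := fun {t} h =>
          ⟨0, by
            rw [map_zero]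
            exact CornerRes.ext ((hπ t).trans h).symm⟩
        by_cases hJ : J ≤ K
        · by_cases hDc : F.IsCentric D
          · obtain ⟨q, h, k, hfac⟩ := hQ.exists_isFactor hφ hφQ hDc hD (hf.mono_right hJ hK)
            refine ⟨DirectSum.of (ProductSummand R hφ M) q
              (transfer R q.1.le (φ q) (F.injective (hφ q)) J D h k m), CornerRes.ext ?_⟩
            have hDA := hfac.img_le hD
            have hm1 := isMor_conj_img hD hfac.1
            rw [transfer_apply, hΓ₁ q J _ _ _ (IsMor.img_le_imageOf (hφ q) hDA)
              (hfac.isMor_conj (hφ q) hD hJ hf) ((isMor_extFun (hφ q)).mem_iff_apply_mem_img hDA),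
              hπ, CornerInd.smul_tmul, incl_one_mul_el R hK hJ hf, conjProj_val_val]
            have hid := (FusionSystem.inner q.1.A).isMor_id (le_refl _) hDA
            have hid' := hid.of_le (inner_le (F := FusionSystem.inner H) q.1.le)
            have hk := ((hfac.isMor_conj (hφ q) hD hJ hf).of_le (inner_le (F := F) hK)).comp
              ((isMor_extFun (hφ q)).mono hDA).to_img
            refine (tmul_cls_smul R hH hk hid' _).symm.trans ?_
            rw [el_smul_incl_one q.1.le hid.cls_mem, tmul_cls_smul R hH hk hid',
              tmul_cls_smul R hH (hk.comp (hid'.of_le (inner_le hH))) hm1]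
            congr 2
            exact cls_congr fun d hd => (hfac.2.2 d hd).2.symm
          · refine hzero ?_
            rw [tmul_cls_eq_zero R hH hM hD (fun h => hDc (h.of_le hFG (hD.trans hH))) hf,
              smul_zero]
        · refine hzero ?_
          rw [CornerInd.smul_tmul, incl_one_mul_el_of_not_le R hK hJ hf]
          exact DFunLike.congr_fun (map_zero (CornerInd.mkHom (incl R (inner_le (F := F) hH)) M)) m
    intro z
    obtain ⟨_, t, rfl⟩ := z
    exact key t
  exact ⟨LinearEquiv.ofBijective Γ₁ ⟨fun s t e => by rw [← hleft s, e, hleft],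
    hright⟩, hΓ₁⟩

end ProductFormula

/-! ### Generators indexed by the products, and the theorem -/

open FusionSystem BisetSemiring MackeyAlgebra

section Generation

variable {R : Type v} [CommRing R] {P : Type u} [Group P] [Finite P] {S T K A : Subgroup P}
  {F : FusionSystem S} {G : FusionSystem T}

theorem mem_preimageOf_iff {φ : A →* K} {C : Subgroup P} {x : P} :
    x ∈ preimageOf φ C ↔ x ∈ A ∧ extFun φ x ∈ C := by
  constructor
  · rintro ⟨a, ha, rfl⟩
    exact ⟨a.2, by rw [Subgroup.coe_subtype, extFun_coe]; exact ha⟩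
  · rintro ⟨hx, h⟩
    rw [extFun_mk φ hx] at h
    exact ⟨⟨x, hx⟩, h, rfl⟩

theorem extFun_comp_restrictPreimage {φ : A →* K} {C J : Subgroup P} (θ : C →* J) {x : P}
    (hx : x ∈ preimageOf φ C) :
    extFun θ (extFun φ x) = extFun (θ.comp (restrictPreimage φ C)) x := by
  have h := mem_preimageOf_iff.1 hx
  rw [extFun_mk _ hx, MonoidHom.comp_apply, extFun_mk θ h.2]
  congr 2
  exact Subtype.ext (extFun_mk φ h.1)

/-- The generators of an induced module can be taken of the form `c_θ ⊗ x` with `θ` a representative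
of an element of a product `[A × J]`. -/
theorem exists_tmul_eq_of_isProduct (hK : K ≤ S) (hA : A ≤ K) {N : Type*} [AddCommGroup N]
    [Module (MackeyAlgebra R (inner A)) N] {C J : Subgroup P} {f : P → P} (hCA : C ≤ A)
    (hC : F.IsCentric C) (hf : (inner K).IsMor C J f) {Q : Set ((inner K).ProdPair A J)}
    (hQ : (inner K).IsProduct hA Q) (x : N) :
    ∃ c ∈ Q, F.IsCentric c.A ∧ ∃ (θ : c.A →* J) (hθ : θ ∈ (inner K).Hom c.A J),
      OrbitHom.mk θ hθ = c.hom ∧ ∃ y : N, ind R (inner A) (le_refl c.A) c.le • y = y ∧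
        CornerInd.tmul (incl R (inner_le (F := inner K) hA)) (el R (inner K) (cls J C f)) x =
          CornerInd.tmul _ (indConj R (inner K) θ hθ) y := by
  obtain ⟨c, hc, hp⟩ := hQ.exists_prec (hC.of_le (inner_le hK) (hCA.trans hA)) hCA hf
  obtain ⟨θ, hθ, e⟩ := c.hom.exists_rep
  -- Here `f` is `θ` composed with conjugations by `h⁻¹ ∈ A` and `j ∈ J`. The first crosses the
  -- tensor sign and turns `x` into `y`; the second does not change the class.
  obtain ⟨h, hh, j, hj, hfac⟩ := hp θ hθ e
  have hm : (FusionSystem.inner A).IsMor C c.A (fun x => h⁻¹ * x * h⁻¹⁻¹) :=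
    (FusionSystem.inner A).isMor_conj (inv_mem hh) hCA c.le fun x hx => by
      rw [inv_inv]
      exact (hfac x hx).1
  have hid : (FusionSystem.inner A).IsMor c.A c.A id :=
    (FusionSystem.inner A).isMor_id le_rfl c.le
  have hθ' := isMor_extFun hθ
  refine ⟨c, hc, hC.target (hm.of_le (inner_le (F := F) (hA.trans hK))), θ, hθ, e,
    el R (FusionSystem.inner A) (cls c.A C (fun x => h⁻¹ * x * h⁻¹⁻¹)) • x, ?_, ?_⟩
  · rw [ind_eq_el, el_smul_smul hid.cls_mem hm.cls_mem, hid.cls_mul_cls hm]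
    rfl
  · rw [indConj_eq_el, tmul_cls_smul R hA hθ' hm]
    congr 2
    rw [← (hθ'.comp (hm.of_le (inner_le (F := FusionSystem.inner K) hA))).cls_conj hj]
    refine cls_congr fun x hx => ?_
    simp only [Function.comp_apply]
    rw [inv_inv]
    exact (hfac x hx).2

end Generation

theorem mainTheorem6 {p : ℕ} [Fact p.Prime] {P : Type u} [Group P] [Finite P] {S T : Subgroup P}
    (hS : IsPGroup p S) (hT : IsPGroup p T)
    (F : FusionSystem S) (hF : F.IsSaturated p) (G : FusionSystem T) (hFG : F.Le G)
    (R : Type v) [CommRing R] {H K : Subgroup P} (hH : F.IsCentric H) (hK : F.IsCentric K)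
    (M : Type w) [AddCommGroup M] [Module (MackeyAlgebra R (FusionSystem.inner H)) M]
    (hM : IsCentricMackeyFunctor R (FusionSystem.inner H) G M)
    (Q : Set (F.ProdPair H K)) (hQ : F.IsProduct hH.1 Q) [DecidableEq Q]
    (φ : ∀ q : Q, q.1.A →* K) (hφ : ∀ q : Q, φ q ∈ F.Hom q.1.A K)
    (hφQ : ∀ q : Q, FusionSystem.OrbitHom.mk (φ q) (hφ q) = q.1.hom)
    (Q' : ∀ (q : Q) (J : Subgroup P),
      Set ((FusionSystem.inner K).ProdPair (imageOf (φ q)) J))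
    (hQ' : ∀ (q : Q) (J : Subgroup P), J ≤ K → F.IsCentric J →
      (FusionSystem.inner K).IsProduct (imageOf_le (φ q)) (Q' q J)) :
    (∀ q : Q, IsCentricMackeyFunctor R (FusionSystem.inner (imageOf (φ q))) G
      (MackeyConjRestrict R q.1.le (φ q) (F.injective (hφ q)) M)) ∧
    ∃ Γ : (DirectSum Q fun q => MackeyInduce R
          (FusionSystem.inner_le (F := FusionSystem.inner K) (imageOf_le (φ q)))
          (MackeyConjRestrict R q.1.le (φ q) (F.injective (hφ q)) M))
        ≃ₗ[MackeyAlgebra R (FusionSystem.inner K)]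
        MackeyRestrict R (FusionSystem.inner_le (F := F) hK.1)
          (MackeyInduce R (FusionSystem.inner_le (F := F) hH.1) M),
      ∀ Γ' : (DirectSum Q fun q => MackeyInduce R
          (FusionSystem.inner_le (F := FusionSystem.inner K) (imageOf_le (φ q)))
          (MackeyConjRestrict R q.1.le (φ q) (F.injective (hφ q)) M))
        →+ MackeyRestrict R (FusionSystem.inner_le (F := F) hK.1)
          (MackeyInduce R (FusionSystem.inner_le (F := F) hH.1) M),
      Γ' = Γ.toLinearMap.toAddMonoidHom ↔
        ∀ (q : Q) (J : Subgroup P) (_ : J ≤ K) (_ : F.IsCentric J),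
        ∀ c ∈ Q' q J, ∀ hc : F.IsCentric c.A,
        ∀ (θ : c.A →* J) (hθ : θ ∈ (FusionSystem.inner K).Hom c.A J),
        FusionSystem.OrbitHom.mk θ hθ = c.hom →
        ∀ x : MackeyConjRestrict R q.1.le (φ q) (F.injective (hφ q)) M,
        MackeyAlgebra.ind R (FusionSystem.inner (imageOf (φ q))) (le_refl c.A) c.le • x = x →
        (Γ' (DirectSum.of (fun q : Q => MackeyInduce R
            (FusionSystem.inner_le (F := FusionSystem.inner K) (imageOf_le (φ q)))
            (MackeyConjRestrict R q.1.le (φ q) (F.injective (hφ q)) M)) q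
          (CornerInd.tmul (MackeyAlgebra.incl R
              (FusionSystem.inner_le (F := FusionSystem.inner K) (imageOf_le (φ q))))
            (MackeyAlgebra.indConj R (FusionSystem.inner K) θ hθ) x))).val =
          CornerInd.tmul (MackeyAlgebra.incl R (FusionSystem.inner_le (F := F) hH.1))
            (MackeyAlgebra.indConj R F (θ.comp (restrictPreimage (φ q) c.A))
              (F.comp_mem ((FusionSystem.inner_le hK.1).hom_subset _ _ hθ)
                (restrictPreimage_mem (hφ q) hc.1)))
            x.val.val := by
  have hcentric : ∀ q : Q, IsCentricMackeyFunctor R (FusionSystem.inner (imageOf (φ q))) G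
      (MackeyConjRestrict R q.1.le (φ q) (F.injective (hφ q)) M) := fun q =>
    MackeyConjRestrict.isCentricMackeyFunctor R hFG hM q.1.le (hφ q)
  obtain ⟨Γ, hΓ⟩ := exists_productEquiv (R := R) hφ hS hF hFG hM hH.1 hK.1 hQ hφQ
  -- The formula holds for every morphism `θ` from a centric `C`, whether or not it represents an
  -- element of a product.
  have heq : ∀ (q : Q) (J : Subgroup P) (C : Subgroup P) (hC : F.IsCentric C)
      (hCA : C ≤ imageOf (φ q)) (θ : C →* J) (hθ : θ ∈ (FusionSystem.inner K).Hom C J)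
      (x : MackeyConjRestrict R q.1.le (φ q) (F.injective (hφ q)) M),
      (Γ (DirectSum.of (ProductSummand R hφ M) q
        (CornerInd.tmul _ (indConj R (FusionSystem.inner K) θ hθ) x))).val =
      CornerInd.tmul (incl R (inner_le (F := F) hH.1))
        (indConj R F (θ.comp (restrictPreimage (φ q) C))
          (F.comp_mem ((inner_le hK.1).hom_subset _ _ hθ) (restrictPreimage_mem (hφ q) hC.1)))
        x.val.val := by
    intro q J C hC hCA θ hθ x
    rw [indConj_eq_el, indConj_eq_el, hΓ q J C (preimageOf (φ q) C) (extFun θ) hCA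
      (isMor_extFun hθ) (fun _ => mem_preimageOf_iff)]
    congr 2
    exact cls_congr fun y hy => extFun_comp_restrictPreimage θ hy
  refine ⟨hcentric, Γ, fun Γ' => ⟨?_, fun h => ?_⟩⟩
  · rintro rfl q J _ _ c _ hc θ hθ _ x _
    exact heq q J c.A hc c.le θ hθ x
  -- For uniqueness it is enough to compare generators: those with `C` not centric are zero, and the
  -- others can be rewritten with a representative from `Q' q J`.
  · refine DirectSum.addHom_ext fun q t => ?_
    induction t using MackeyInduce.induction_on (imageOf_le (φ q)) with
    | zero => simp only [map_zero]
    | add s t hs ht => rw [map_add, map_add, map_add, hs, ht]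
    | tmul J C f hCA hf x =>
      by_cases hC : F.IsCentric C
      · have hJ : F.IsCentric J := hC.target (hf.of_le (inner_le hK.1))
        obtain ⟨c, hc, hcA, θ, hθ, e, y, hy, e'⟩ := exists_tmul_eq_of_isProduct (R := R) hK.1
          (imageOf_le (φ q)) hCA hC hf (hQ' q J hf.right_le hJ) x
        rw [e']
        apply CornerRes.ext
        exact (h q J hf.right_le hJ c hc hcA θ hθ e y hy).trans
          (heq q J c.A hcA c.le θ hθ y).symm
      · rw [tmul_cls_eq_zero R (imageOf_le (φ q)) (hcentric q) hCA
          (fun h => hC (h.of_le hFG (hCA.trans ((imageOf_le _).trans hK.1)))) hf]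
        simp only [map_zero]
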